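/- **Setting.** Let $M$ be a smooth $m$-dimensional manifold ($m\ge 1$) with a volume form $\omega_M$, let $E$ be a smooth manifold of dimension $m+n$ ($n\ge 0$), and let $\pi\colon E\to M$ be a smooth submersion (for instance a fibre bundle). Let $J^1\pi$ be the first jet bundle of $\pi$, let $\mathcal M\pi=\Lambda^m_2T^*E$ be the bundle of $m$-covectors of $E$ that vanish when two of their arguments are $\pi$-vertical, and let $J^{1*}\pi=\mathcal M\pi/\pi^*\Lambda^mT^*M$. Put $$\mathcal P=J^1\pi\times_M\Lambda^{m-1}T^*M,\qquad \mathcal P^*=J^{1*}\pi\times_M\Lambda^{m-1}T^*M,\qquad \mathcal W=(J^1\pi\times_E\mathcal M\pi)\times_M\Lambda^{m-1}T^*M .$$ *Natural coordinates* are those induced by coordinates $(x^\mu,y^A)$ of $E$ adapted to $\pi$ for which $\omega_M=d^mx:=dx^1\wedge\dots\wedge dx^m$; with $d^{m-1}x_\mu=i_{\partial/\partial x^\mu}d^mx$ they are $y^A_\mu$ on $J^1\pi$; $p^\mu_A,p$ on $\mathcal M\pi$, for the covector $p^\mu_A\,dy^A\wedge d^{m-1}x_\mu+p\,d^mx$;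 and $s^\mu$ on $\Lambda^{m-1}T^*M$, for $s^\mu d^{m-1}x_\mu$. Let $L\colon\mathcal P\to\mathbb R$ be smooth. The Hamiltonian submanifold is $$\mathcal W_\circ=\{(j^1\phi(x),\mathbf p,s)\in\mathcal W \mid (T_x\phi)^*\mathbf p=L(j^1\phi(x),s)\,\omega_M(x)\},$$ locally $p=L-p^\mu_Ay^A_\mu$, with coordinates $(x^\mu,y^A,y^A_\mu,p^\mu_A,s^\mu)$ and inclusion ${\rm j}_\circ\colon\mathcal W_\circ\hookrightarrow\mathcal W$. Let $\Theta_{\mathcal W}=-\Theta+d\theta$, where $\Theta$ and $\theta$ are the pull-backs to $\mathcal W$ of the tautological forms of $\mathcal M\pi$ and $\Lambda^{m-1}T^*M$, let $\Theta_\circ={\rm j}_\circ^*\Theta_{\mathcal W}$, let $\rho_M\colon\mathcal W_\circ\to M$ be the projection, and let $\omega=\rho_M^*\omega_M$. **Definitions.** Let $\Theta,\omega$ be smooth $m$-forms, with $\omega$ closed, on a manifold of dimension $m+N$. For a $j$-form $\alpha$ at a point, $\ker\alpha=\{v\mid i_v\alpha=0\}$; $\mathcal A^j(D)$ denotes the set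 of $j$-forms at the point that are annihilated by contraction with every vector of $D$; and $\mathfrak R=\{R\in\ker\omega\mid i_Rd\Theta\in\mathcal A^m(\ker\omega)\}$ is the Reeb distribution. The pair $(\Theta,\omega)$ is *special premulticontact on the points of a subset $S$*, with characteristic rank $k$, where $0\le k\le N-m$, if $\dim\ker\Theta$ is constant on $S$ and at every point of $S$: (1) $\dim\ker\omega=N$; (2) $\dim\mathfrak R=m+k$; (3) $\dim(\ker\omega\cap\ker\Theta\cap\ker d\Theta)=k$; (4) $\mathcal A^{m-1}(\ker\omega)=\{i_R\Theta\mid R\in\mathfrak R\}$. It is a special premulticontact *bundle* there if moreover $\omega$ is the pull-back of a volume form of the base along a smooth submersion (here $\rho_M$). A *dissipation form* at a point is a covector $\sigma$ with $\sigma\wedge i_R\Theta=i_Rd\Theta$ for all $R\in\mathfrak R$. **Proposition.** Let $$\mathcal W_1=\{w\in\mathcal W_\circ\mid (i_Xd\Theta_\circ)(w)=0\text{ for every } X \text{ vertical for the projection } \mathcal W_\circ\to\mathcal P^*\}.$$ 1. $\mathcal W_1$ is a submanifold of $\mathcal W_\circ$ of codimension $nm$, and it is $\rho_M$-transversal: $T\rho_M$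 maps $T_w\mathcal W_1$ onto $T_{\rho_M(w)}M$ for every $w\in\mathcal W_1$. 2. In all natural coordinates $\mathcal W_1$ is given by $p^\mu_A=\dfrac{\partial L}{\partial y^A_\mu}$ for all $\mu,A$. 3. $(\mathcal W_\circ,\Theta_\circ,\omega)$ is a special premulticontact bundle on the points of $\mathcal W_1$, with $k=nm$. 4. It is one exactly there: for every subset $S\subseteq\mathcal W_\circ$, $(\mathcal W_\circ,\Theta_\circ,\omega)$ is a special premulticontact bundle on the points of $S$ for some $k$ if and only if $S\subseteq\mathcal W_1$. 5. At every point of $\mathcal W_1$ there is exactly one dissipation form, and in all natural coordinates it is $\sigma_{\Theta_\circ}=-\dfrac{\partial L}{\partial s^\mu}\,dx^\mu$. -/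

import Mathlib

set_option linter.unusedSectionVars false
open scoped Manifold ContDiff Topology
open Set

noncomputable section

namespace Multicontact

/-- Model space of the base `M`, whose dimension `m = d + 1` is positive. -/
abbrev Base (d : ℕ) : Type := Fin (d + 1) → ℝ
/-- Model space of `E`, of dimension `m + n`. -/
abbrev Mdl (d n : ℕ) : Type := Base d × (Fin n → ℝ)

section Alternating

theorem finiteDimensional_multi (V : Type*) [NormedAddCommGroup V] [NormedSpace ℝ V]
    [FiniteDimensional ℝ V] (k : ℕ) :
    FiniteDimensional ℝ (ContinuousMultilinearMap ℝ (fun _ : Fin k => V) ℝ) :=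
  Module.Finite.of_injective
    (ContinuousMultilinearMap.toMultilinearMapLinear (R' := ℝ) (A := ℝ)
      (M₁ := fun _ : Fin k => V) (M₂ := ℝ))
    ContinuousMultilinearMap.toMultilinearMap_injective

instance finiteDimensional_alt (V : Type*) [NormedAddCommGroup V] [NormedSpace ℝ V]
    [FiniteDimensional ℝ V] (k : ℕ) : FiniteDimensional ℝ (V [⋀^Fin k]→L[ℝ] ℝ) :=
  have := finiteDimensional_multi V k
  Module.Finite.of_injective
    (ContinuousAlternatingMap.toContinuousMultilinearMapCLM (𝕜 := ℝ) (E := V) (F := ℝ)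
      (ι := Fin k) ℝ).toLinearMap
    ContinuousAlternatingMap.toContinuousMultilinearMap_injective

theorem contDiff_altPullback (V W : Type*) [NormedAddCommGroup V] [NormedSpace ℝ V]
    [FiniteDimensional ℝ V] [NormedAddCommGroup W] [NormedSpace ℝ W] (k : ℕ) :
    ContDiff ℝ ∞ (fun p : (W [⋀^Fin k]→L[ℝ] ℝ) × (V →L[ℝ] W) =>
      p.1.compContinuousLinearMap p.2) := by
  have := finiteDimensional_multi V k
  let T := ContinuousAlternatingMap.toContinuousMultilinearMapCLM (𝕜 := ℝ) (E := V) (F := ℝ)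
    (ι := Fin k) ℝ
  let T' := ContinuousAlternatingMap.toContinuousMultilinearMapCLM (𝕜 := ℝ) (E := W) (F := ℝ)
    (ι := Fin k) ℝ
  have hT : Function.Injective T :=
    ContinuousAlternatingMap.toContinuousMultilinearMap_injective
  obtain ⟨S, hS⟩ := LinearMap.exists_leftInverse_of_injective T.toLinearMap
    (LinearMap.ker_eq_bot.2 hT)
  let S' := LinearMap.toContinuousLinearMap S
  have h1 : ∀ p : (W [⋀^Fin k]→L[ℝ] ℝ) × (V →L[ℝ] W), p.1.compContinuousLinearMap p.2 =
      S' ((ContinuousMultilinearMap.compContinuousLinearMapContinuousMultilinear ℝ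
        (fun _ : Fin k => V) (fun _ : Fin k => W) ℝ (fun _ => p.2)) (T' p.1)) := by
    intro p
    exact (LinearMap.congr_fun hS (p.1.compContinuousLinearMap p.2)).symm
  simp_rw [h1]
  refine S'.contDiff.comp (ContDiff.clm_apply ?_ (T'.contDiff.comp contDiff_fst))
  exact (ContinuousMultilinearMap.contDiff _).comp (contDiff_pi.2 fun _ => contDiff_snd)

variable {T Q T' Q' : Type*}
  [AddCommGroup T] [Module ℝ T] [TopologicalSpace T]
  [AddCommGroup Q] [Module ℝ Q] [TopologicalSpace Q]
  [AddCommGroup T'] [Module ℝ T'] [TopologicalSpace T']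
  [AddCommGroup Q'] [Module ℝ Q'] [TopologicalSpace Q']

/-- The alternating `k`-forms on `T` that vanish when two of their arguments are vertical,
i.e. lie in the kernel of `p : T → Q`. -/
def semibasic2 (p : T →L[ℝ] Q) (k : ℕ) : Submodule ℝ (T [⋀^Fin k]→L[ℝ] ℝ) where
  carrier := {α | ∀ (v : Fin k → T) (i j : Fin k), i ≠ j → p (v i) = 0 → p (v j) = 0 → α v = 0}
  add_mem' := by
    intro α β hα hβ v i j hij hi hj
    simp [hα v i j hij hi hj, hβ v i j hij hi hj]
  zero_mem' := by intro v i j _ _ _; rfl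
  smul_mem' := by
    intro r α hα v i j hij hi hj
    simp [hα v i j hij hi hj]

/-- Two forms are identified when they differ by a form pulled back along `p : T → Q`. -/
def basicSetoid (p : T →L[ℝ] Q) (k : ℕ) : Setoid (semibasic2 p k) where
  r α α' := ∃ β : Q [⋀^Fin k]→L[ℝ] ℝ, (α : T [⋀^Fin k]→L[ℝ] ℝ) =
    (α' : T [⋀^Fin k]→L[ℝ] ℝ) + β.compContinuousLinearMap p
  iseqv :=
    { refl := fun α => ⟨0, by ext v; simp⟩
      symm := by
        rintro α α' ⟨β, h⟩
        exact ⟨-β, by ext v; simp [h]⟩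
      trans := by
        rintro α α' α'' ⟨β, h⟩ ⟨β', h'⟩
        exact ⟨β' + β, by ext v; simp [h, h', add_assoc]⟩ }

/-- Transport of forms along linear isomorphisms compatible with the projections. -/
def semibasic2Equiv {p : T →L[ℝ] Q} {p' : T' →L[ℝ] Q'} (A : T ≃L[ℝ] T') (a : Q ≃L[ℝ] Q')
    (h : ∀ v, p' (A v) = a (p v)) (k : ℕ) : semibasic2 p k ≃ₗ[ℝ] semibasic2 p' k where
  toFun α := ⟨(α : T [⋀^Fin k]→L[ℝ] ℝ).compContinuousLinearMap (A.symm : T' →L[ℝ] T), by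
    intro v i j hij hi hj
    have key : ∀ w, p' w = 0 → p (A.symm w) = 0 := fun w hw => by
      apply a.injective
      rw [← h, A.apply_symm_apply, hw, map_zero]
    exact α.2 _ i j hij (key _ hi) (key _ hj)⟩
  invFun α := ⟨(α : T' [⋀^Fin k]→L[ℝ] ℝ).compContinuousLinearMap (A : T →L[ℝ] T'), by
    intro v i j hij hi hj
    have key : ∀ w, p w = 0 → p' (A w) = 0 := fun w hw => by rw [h, hw, map_zero]
    exact α.2 _ i j hij (key _ hi) (key _ hj)⟩
  map_add' α β := by ext v; simp
  map_smul' r α := by ext v; simp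
  left_inv α := by
    ext v
    simp only [ContinuousAlternatingMap.compContinuousLinearMap_apply]
    congr 1; funext i; simp
  right_inv α := by
    ext v
    simp only [ContinuousAlternatingMap.compContinuousLinearMap_apply]
    congr 1; funext i; simp


end Alternating

section Splitting

variable {d n : ℕ}

/-- Fibre coordinates `p^μ_A`: the linear map sending `∂/∂y^A` to `p^μ_A d^{m-1}x_μ`. -/
abbrev MomMdl (d n : ℕ) : Type := (Fin n → ℝ) →L[ℝ] (Base d [⋀^Fin d]→L[ℝ] ℝ)

/-- `α ↦ (v ↦ (i_v α)|_{ℝ^(d+1)})`, `v` vertical. -/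
def verPart : (Mdl d n [⋀^Fin (d + 1)]→L[ℝ] ℝ) →ₗ[ℝ] MomMdl d n where
  toFun α := (ContinuousAlternatingMap.compContinuousLinearMapCLM
    (ContinuousLinearMap.inl ℝ (Base d) (Fin n → ℝ))).comp
      (α.curryLeft.comp (ContinuousLinearMap.inr ℝ (Base d) (Fin n → ℝ)))
  map_add' α β := by ext v w; simp
  map_smul' r α := by ext v w; simp

/-- `α ↦ α|_{ℝ^(d+1)}`. -/
def horPart : (Mdl d n [⋀^Fin (d + 1)]→L[ℝ] ℝ) →ₗ[ℝ] (Base d [⋀^Fin (d + 1)]→L[ℝ] ℝ) where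
  toFun α := α.compContinuousLinearMap (ContinuousLinearMap.inl ℝ (Base d) (Fin n → ℝ))
  map_add' α β := by ext v; simp
  map_smul' r α := by ext v; simp

/-- The form `p_A^μ dy^A ∧ d^{m-1}x_μ`. -/
def ofVer : MomMdl d n →ₗ[ℝ] (Mdl d n [⋀^Fin (d + 1)]→L[ℝ] ℝ) where
  toFun P := ContinuousAlternatingMap.alternatizeUncurryFin
    ((ContinuousAlternatingMap.compContinuousLinearMapCLM
      (ContinuousLinearMap.fst ℝ (Base d) (Fin n → ℝ))).comp
        (P.comp (ContinuousLinearMap.snd ℝ (Base d) (Fin n → ℝ))))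
  map_add' P P' := by
    rw [← ContinuousAlternatingMap.alternatizeUncurryFin_add]
    congr 1
  map_smul' r P := by
    rw [RingHom.id_apply, ← ContinuousAlternatingMap.alternatizeUncurryFin_smul]
    congr 1

/-- The form `p d^m x`. -/
def ofHor : (Base d [⋀^Fin (d + 1)]→L[ℝ] ℝ) →ₗ[ℝ] (Mdl d n [⋀^Fin (d + 1)]→L[ℝ] ℝ) where
  toFun β := β.compContinuousLinearMap (ContinuousLinearMap.fst ℝ (Base d) (Fin n → ℝ))
  map_add' α β := by ext v; simp
  map_smul' r α := by ext v; simp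

theorem ofVer_apply (P : MomMdl d n) (u : Fin (d + 1) → Mdl d n) :
    ofVer P u = ∑ i : Fin (d + 1), (-1 : ℤ) ^ (i : ℕ) •
      P (u i).2 (fun j => (i.removeNth u j).1) := by
  simp [ofVer, ContinuousAlternatingMap.alternatizeUncurryFin_apply, Function.comp_def]

theorem ofVer_mem (P : MomMdl d n) :
    ofVer P ∈ semibasic2 (ContinuousLinearMap.fst ℝ (Base d) (Fin n → ℝ)) (d + 1) := by
  intro u i j hij hi hj
  rw [ofVer_apply]
  refine Finset.sum_eq_zero fun k _ => ?_
  have : ∃ l : Fin d, (k.removeNth u l).1 = 0 := by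
    rcases eq_or_ne i k with rfl | hik
    · obtain ⟨l, hl⟩ := Fin.exists_succAbove_eq hij.symm
      exact ⟨l, by simpa [Fin.removeNth, hl] using hj⟩
    · obtain ⟨l, hl⟩ := Fin.exists_succAbove_eq hik
      exact ⟨l, by simpa [Fin.removeNth, hl] using hi⟩
  obtain ⟨l, hl⟩ := this
  rw [(P (u k).2).map_coord_zero l hl, smul_zero]

theorem ofHor_mem (β : Base d [⋀^Fin (d + 1)]→L[ℝ] ℝ) :
    ofHor (n := n) β ∈ semibasic2 (ContinuousLinearMap.fst ℝ (Base d) (Fin n → ℝ)) (d + 1) := by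
  intro u i j hij hi hj
  exact β.map_coord_zero i hi

theorem verPart_ofVer (P : MomMdl d n) : verPart (ofVer P) = P := by
  ext v w
  change ofVer P (Matrix.vecCons (0, v) (fun j => (w j, 0))) = P v w
  rw [ofVer_apply, Fin.sum_univ_succ]
  simp [Fin.removeNth]

theorem verPart_ofHor (β : Base d [⋀^Fin (d + 1)]→L[ℝ] ℝ) :
    verPart (n := n) (ofHor β) = 0 := by
  ext v w
  exact β.map_coord_zero 0 (by simp)

theorem horPart_ofVer (P : MomMdl d n) : horPart (ofVer P) = 0 := by
  ext w
  change ofVer P (fun j => (w j, 0)) = 0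
  rw [ofVer_apply]
  simp

theorem horPart_ofHor (β : Base d [⋀^Fin (d + 1)]→L[ℝ] ℝ) :
    horPart (n := n) (ofHor β) = β := by
  ext w; rfl

theorem eq_zero_of_parts {α : Mdl d n [⋀^Fin (d + 1)]→L[ℝ] ℝ}
    (hα : α ∈ semibasic2 (ContinuousLinearMap.fst ℝ (Base d) (Fin n → ℝ)) (d + 1))
    (h1 : verPart α = 0) (h2 : horPart α = 0) : α = 0 := by
  ext u
  have hu : u = (fun j => ((u j).1, (0 : Fin n → ℝ))) + (fun j => ((0 : Base d), (u j).2)) := by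
    funext j; simp
  have hexp : α u = ∑ s : Finset (Fin (d + 1)),
      α (s.piecewise (fun j => ((u j).1, (0 : Fin n → ℝ))) (fun j => ((0 : Base d), (u j).2))) := by
    conv_lhs => rw [hu]
    exact α.toMultilinearMap.map_add_univ _ _
  rw [hexp]
  refine Finset.sum_eq_zero fun s _ => ?_
  by_cases hs : ∃ i j, i ≠ j ∧ i ∉ s ∧ j ∉ s
  · obtain ⟨i, j, hij, hi, hj⟩ := hs
    exact hα _ i j hij (by simp [hi]) (by simp [hj])
  push Not at hs
  by_cases hs' : ∃ i, i ∉ s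
  · obtain ⟨i, hi⟩ := hs'
    have hother : ∀ j, j ≠ i → j ∈ s := fun j hj => hs i j hj.symm hi
    set w := s.piecewise (fun j => ((u j).1, (0 : Fin n → ℝ))) (fun j => ((0 : Base d), (u j).2))
    have hz : α (w ∘ Equiv.swap 0 i) = 0 := by
      have hw : w ∘ Equiv.swap 0 i = Matrix.vecCons ((0 : Base d), (u i).2)
          (fun j => (((w ∘ Equiv.swap 0 i) j.succ).1, (0 : Fin n → ℝ))) := by
        funext k
        refine Fin.cases ?_ (fun k => ?_) k
        · simp [w, hi]
        · have hne : Equiv.swap 0 i k.succ ≠ i := by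
            intro h
            have := (Equiv.swap 0 i).injective (h.trans (Equiv.swap_apply_left 0 i).symm)
            exact Fin.succ_ne_zero k this
          simp [w, hother _ hne]
      rw [hw]
      exact congrArg (fun l => l (u i).2 (fun j => ((w ∘ Equiv.swap 0 i) j.succ).1)) h1
    by_cases h0 : (0 : Fin (d + 1)) = i
    · rw [← h0, Equiv.swap_self] at hz
      exact hz
    · have := α.toAlternatingMap.map_swap w h0
      exact neg_eq_zero.1 (this.symm.trans hz)
  · push Not at hs'
    have : s = Finset.univ := Finset.eq_univ_of_forall hs'
    subst this
    simp only [Finset.piecewise_univ]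
    exact congrArg (fun l => l (fun j => (u j).1)) h2

theorem ofVer_add_ofHor {α : Mdl d n [⋀^Fin (d + 1)]→L[ℝ] ℝ}
    (hα : α ∈ semibasic2 (ContinuousLinearMap.fst ℝ (Base d) (Fin n → ℝ)) (d + 1)) :
    ofVer (verPart α) + ofHor (horPart α) = α := by
  rw [← sub_eq_zero]
  refine eq_zero_of_parts (Submodule.sub_mem _ (Submodule.add_mem _ (ofVer_mem _)
    (ofHor_mem _)) hα) ?_ ?_
  · rw [map_sub, map_add, verPart_ofVer, verPart_ofHor]
    ext v w; simp
  · rw [map_sub, map_add, horPart_ofVer, horPart_ofHor, zero_add, sub_self]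

theorem contDiff_of_linear {V W : Type*} [NormedAddCommGroup V] [NormedSpace ℝ V]
    [FiniteDimensional ℝ V] [NormedAddCommGroup W] [NormedSpace ℝ W] (f : V → W)
    (h1 : ∀ x y, f (x + y) = f x + f y) (h2 : ∀ (r : ℝ) x, f (r • x) = r • f x) :
    ContDiff ℝ ∞ f :=
  (LinearMap.toContinuousLinearMap
    ({ toFun := f, map_add' := h1, map_smul' := h2 } : V →ₗ[ℝ] W)).contDiff

theorem contDiff_verPart : ContDiff ℝ ∞ (fun α => verPart (d := d) (n := n) α) := by
  apply contDiff_of_linear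
  · intro x y; ext v w; simp [verPart]
  · intro r x; ext v w; simp [verPart]

theorem contDiff_horPart : ContDiff ℝ ∞ (fun α => horPart (d := d) (n := n) α) := by
  apply contDiff_of_linear
  · exact fun x y => map_add horPart x y
  · exact fun r x => map_smul horPart r x

theorem contDiff_ofVer : ContDiff ℝ ∞ (fun P => ofVer (d := d) (n := n) P) := by
  apply contDiff_of_linear
  · exact fun x y => map_add ofVer x y
  · exact fun r x => map_smul ofVer r x

theorem contDiff_ofHor : ContDiff ℝ ∞ (fun β => ofHor (d := d) (n := n) β) := by
  apply contDiff_of_linear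
  · exact fun x y => map_add ofHor x y
  · exact fun r x => map_smul ofHor r x

theorem contDiff_graph : ContDiff ℝ ∞ (fun Γ : Base d →L[ℝ] (Fin n → ℝ) =>
    (ContinuousLinearMap.id ℝ (Base d)).prod Γ) := by
  have h : (fun Γ : Base d →L[ℝ] (Fin n → ℝ) => (ContinuousLinearMap.id ℝ (Base d)).prod Γ) =
      fun Γ => (ContinuousLinearMap.inl ℝ (Base d) (Fin n → ℝ)) +
        (ContinuousLinearMap.inr ℝ (Base d) (Fin n → ℝ)).comp Γ := by
    funext Γ
    ext u <;> simp
  rw [h]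
  exact contDiff_const.add (contDiff_const.clm_comp contDiff_id)

end Splitting

section Charts

variable {d n : ℕ}
  {M : Type*} [TopologicalSpace M] [ChartedSpace (Base d) M]
  {E : Type*} [TopologicalSpace E] [ChartedSpace (Mdl d n) E]

/-- Charts `φ` of `M` and `ψ` of `E` with `φ ∘ π = pr₁ ∘ ψ`, i.e. coordinates `(x^μ, y^A)` of `E`
adapted to the bundle structure. -/
structure AdaptedChart (d n : ℕ) {M : Type*} [TopologicalSpace M] [ChartedSpace (Base d) M]
    {E : Type*} [TopologicalSpace E] [ChartedSpace (Mdl d n) E] (π : E → M) where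
  φ : OpenPartialHomeomorph M (Base d)
  ψ : OpenPartialHomeomorph E (Mdl d n)
  φ_mem : φ ∈ IsManifold.maximalAtlas 𝓘(ℝ, Base d) ∞ M
  ψ_mem : ψ ∈ IsManifold.maximalAtlas 𝓘(ℝ, Mdl d n) ∞ E
  mapsTo : ∀ y ∈ ψ.source, π y ∈ φ.source
  proj : ∀ y ∈ ψ.source, φ (π y) = (ψ y).1

theorem exists_adaptedChart [IsManifold 𝓘(ℝ, Mdl d n) ∞ E] {π : E → M}
    (hπ : Manifold.IsSubmersion 𝓘(ℝ, Mdl d n) 𝓘(ℝ, Base d) ∞ π) (y : E) :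
    ∃ c : AdaptedChart d n π, y ∈ c.ψ.source := by
  obtain ⟨F', _, _, hF⟩ := hπ
  have h := hF y
  have e := h.equiv
  have : FiniteDimensional ℝ (Base d × F') := Module.Finite.equiv e.toLinearEquiv
  have : FiniteDimensional ℝ F' := Module.Finite.of_surjective (LinearMap.snd ℝ (Base d) F')
    LinearMap.snd_surjective
  have hfin : Module.finrank ℝ F' = Module.finrank ℝ (Fin n → ℝ) := by
    have := e.toLinearEquiv.finrank_eq
    rw [Module.finrank_prod, Module.finrank_prod] at this
    omega
  let f : F' ≃L[ℝ] (Fin n → ℝ) := ContinuousLinearEquiv.ofFinrankEq hfin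
  let g : Mdl d n ≃L[ℝ] Mdl d n := h.equiv.trans ((ContinuousLinearEquiv.refl ℝ (Base d)).prodCongr f)
  refine ⟨⟨h.codChart, h.domChart.trans g.toHomeomorph.toOpenPartialHomeomorph,
    h.codChart_mem_maximalAtlas, ?_, ?_, ?_⟩, ?_⟩
  · have h1 : ContMDiff 𝓘(ℝ, Mdl d n) 𝓘(ℝ, Mdl d n) ∞ g := g.contDiff.contMDiff
    have h2 : ContMDiff 𝓘(ℝ, Mdl d n) 𝓘(ℝ, Mdl d n) ∞ g.symm := g.symm.contDiff.contMDiff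
    refine OpenPartialHomeomorph.mem_maximalAtlas_of_contMDiffOn _ ?_ ?_
    · exact (h1.comp_contMDiffOn
        (contMDiffOn_of_mem_maximalAtlas h.domChart_mem_maximalAtlas)).mono (by simp)
    · exact (contMDiffOn_symm_of_mem_maximalAtlas h.domChart_mem_maximalAtlas).comp
        h2.contMDiffOn (by intro z hz; simpa using hz)
  · intro z hz
    exact h.mapsto_domChart_source_codChart_source (by simpa using hz)
  · intro z hz
    have hz' : z ∈ h.domChart.source := by simpa using hz
    have hz2 : h.domChart z ∈ (h.domChart.extend 𝓘(ℝ, Mdl d n)).target := by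
      simpa using h.domChart.map_source hz'
    have := h.writtenInCharts hz2
    simp [h.domChart.left_inv hz'] at this
    simp [g, this]
  · simpa using h.mem_domChart_source

namespace AdaptedChart

variable {π : E → M} (c c' : AdaptedChart d n π)

theorem φ_mdiff [IsManifold 𝓘(ℝ, Base d) ∞ M] :
    c.φ.MDifferentiable 𝓘(ℝ, Base d) 𝓘(ℝ, Base d) :=
  ⟨(contMDiffOn_of_mem_maximalAtlas c.φ_mem).mdifferentiableOn (by simp),
    (contMDiffOn_symm_of_mem_maximalAtlas c.φ_mem).mdifferentiableOn (by simp)⟩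

theorem ψ_mdiff [IsManifold 𝓘(ℝ, Mdl d n) ∞ E] :
    c.ψ.MDifferentiable 𝓘(ℝ, Mdl d n) 𝓘(ℝ, Mdl d n) :=
  ⟨(contMDiffOn_of_mem_maximalAtlas c.ψ_mem).mdifferentiableOn (by simp),
    (contMDiffOn_symm_of_mem_maximalAtlas c.ψ_mem).mdifferentiableOn (by simp)⟩

variable [IsManifold 𝓘(ℝ, Base d) ∞ M] [IsManifold 𝓘(ℝ, Mdl d n) ∞ E]

/-- The tangent map of the chart of the base, as an isomorphism `T_x M ≃ ℝ^(d+1)`. -/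
def dφ {x : M} (hx : x ∈ c.φ.source) : TangentSpace 𝓘(ℝ, Base d) x ≃L[ℝ] Base d :=
  c.φ_mdiff.mfderiv hx

/-- The tangent map of the chart of the total space, as an isomorphism
`T_y E ≃ ℝ^(d+1) × ℝ^n`. -/
def dψ {y : E} (hy : y ∈ c.ψ.source) : TangentSpace 𝓘(ℝ, Mdl d n) y ≃L[ℝ] Mdl d n :=
  c.ψ_mdiff.mfderiv hy

theorem fst_dψ {y : E} (hy : y ∈ c.ψ.source) (v : TangentSpace 𝓘(ℝ, Mdl d n) y) :
    ContinuousLinearMap.fst ℝ (Base d) (Fin n → ℝ) (c.dψ hy v) =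
      c.dφ (c.mapsTo y hy) (mfderiv 𝓘(ℝ, Mdl d n) 𝓘(ℝ, Base d) π y v) := by
  have hπ : MDifferentiableAt 𝓘(ℝ, Mdl d n) 𝓘(ℝ, Base d) π y := by
    have h1 : MDifferentiableAt 𝓘(ℝ, Mdl d n) 𝓘(ℝ, Base d)
        (c.φ.symm ∘ Prod.fst ∘ c.ψ) y := by
      have h2 : MDifferentiableAt 𝓘(ℝ, Base d) 𝓘(ℝ, Base d) c.φ.symm (c.ψ y).1 :=
        c.φ_mdiff.mdifferentiableAt_symm
          (by rw [← c.proj y hy]; exact c.φ.map_source (c.mapsTo y hy))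
      have h3 : MDifferentiableAt 𝓘(ℝ, Mdl d n) 𝓘(ℝ, Base d) (Prod.fst : Mdl d n → Base d)
          (c.ψ y) := (differentiableAt_fst).mdifferentiableAt
      exact h2.comp y (h3.comp y (c.ψ_mdiff.mdifferentiableAt hy))
    refine h1.congr_of_eventuallyEq ?_
    filter_upwards [c.ψ.open_source.mem_nhds hy] with z hz
    simp [← c.proj z hz, c.φ.left_inv (c.mapsTo z hz)]
  have h3 : MDifferentiableAt 𝓘(ℝ, Mdl d n) 𝓘(ℝ, Base d) (Prod.fst : Mdl d n → Base d)
      (c.ψ y) := (differentiableAt_fst).mdifferentiableAt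
  have e1 : mfderiv 𝓘(ℝ, Mdl d n) 𝓘(ℝ, Base d) (c.φ ∘ π) y =
      mfderiv 𝓘(ℝ, Mdl d n) 𝓘(ℝ, Base d) (Prod.fst ∘ c.ψ) y := by
    apply Filter.EventuallyEq.mfderiv_eq
    filter_upwards [c.ψ.open_source.mem_nhds hy] with z hz using c.proj z hz
  rw [mfderiv_comp y (c.φ_mdiff.mdifferentiableAt (c.mapsTo y hy)) hπ,
    mfderiv_comp y h3 (c.ψ_mdiff.mdifferentiableAt hy), mfderiv_eq_fderiv] at e1
  have e2 := congrArg (fun l => l v) e1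
  have e3 : fderiv ℝ (Prod.fst : Mdl d n → Base d) (c.ψ y) =
    ContinuousLinearMap.fst ℝ (Base d) (Fin n → ℝ) := fderiv_fst
  rw [e3] at e2
  exact e2.symm

/-- Derivative of a change of coordinates of the base. -/
def tφ (u : Base d) : Base d →L[ℝ] Base d := fderiv ℝ (c'.φ ∘ c.φ.symm) u

/-- Derivative of a change of adapted coordinates of the total space. -/
def tψ (z : Mdl d n) : Mdl d n →L[ℝ] Mdl d n := fderiv ℝ (c'.ψ ∘ c.ψ.symm) z

theorem contDiffOn_φ : ContDiffOn ℝ ∞ (c'.φ ∘ c.φ.symm) (c.φ.symm.trans c'.φ).source :=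
  contMDiffOn_iff_contDiffOn.1 ((contMDiffOn_of_mem_maximalAtlas c'.φ_mem).comp
    ((contMDiffOn_symm_of_mem_maximalAtlas c.φ_mem).mono (by intro u hu; simp at hu; exact hu.1))
    (by intro u hu; simp at hu; exact hu.2))

theorem contDiffOn_ψ : ContDiffOn ℝ ∞ (c'.ψ ∘ c.ψ.symm) (c.ψ.symm.trans c'.ψ).source :=
  contMDiffOn_iff_contDiffOn.1 ((contMDiffOn_of_mem_maximalAtlas c'.ψ_mem).comp
    ((contMDiffOn_symm_of_mem_maximalAtlas c.ψ_mem).mono (by intro u hu; simp at hu; exact hu.1))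
    (by intro u hu; simp at hu; exact hu.2))

theorem contDiffOn_tφ : ContDiffOn ℝ ∞ (c.tφ c') (c.φ.symm.trans c'.φ).source :=
  (c.contDiffOn_φ c').fderiv_of_isOpen (c.φ.symm.trans c'.φ).open_source (by simp)

theorem contDiffOn_tψ : ContDiffOn ℝ ∞ (c.tψ c') (c.ψ.symm.trans c'.ψ).source :=
  (c.contDiffOn_ψ c').fderiv_of_isOpen (c.ψ.symm.trans c'.ψ).open_source (by simp)

theorem tφ_dφ {x : M} (hx : x ∈ c.φ.source) (hx' : x ∈ c'.φ.source)
    (v : TangentSpace 𝓘(ℝ, Base d) x) : c.tφ c' (c.φ x) (c.dφ hx v) = c'.dφ hx' v := by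
  have h1 : MDifferentiableAt 𝓘(ℝ, Base d) 𝓘(ℝ, Base d) (c'.φ ∘ c.φ.symm) (c.φ x) := by
    refine MDifferentiableAt.comp _ ?_ (c.φ_mdiff.mdifferentiableAt_symm (c.φ.map_source hx))
    rw [c.φ.left_inv hx]
    exact c'.φ_mdiff.mdifferentiableAt hx'
  have e1 : mfderiv 𝓘(ℝ, Base d) 𝓘(ℝ, Base d) ((c'.φ ∘ c.φ.symm) ∘ c.φ) x =
      mfderiv 𝓘(ℝ, Base d) 𝓘(ℝ, Base d) c'.φ x := by
    apply Filter.EventuallyEq.mfderiv_eq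
    filter_upwards [c.φ.open_source.mem_nhds hx] with z hz
    simp [c.φ.left_inv hz]
  rw [mfderiv_comp x h1 (c.φ_mdiff.mdifferentiableAt hx), mfderiv_eq_fderiv] at e1
  exact congrArg (fun l => l v) e1

theorem tψ_dψ {y : E} (hy : y ∈ c.ψ.source) (hy' : y ∈ c'.ψ.source)
    (v : TangentSpace 𝓘(ℝ, Mdl d n) y) : c.tψ c' (c.ψ y) (c.dψ hy v) = c'.dψ hy' v := by
  have h1 : MDifferentiableAt 𝓘(ℝ, Mdl d n) 𝓘(ℝ, Mdl d n) (c'.ψ ∘ c.ψ.symm) (c.ψ y) := by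
    refine MDifferentiableAt.comp _ ?_ (c.ψ_mdiff.mdifferentiableAt_symm (c.ψ.map_source hy))
    rw [c.ψ.left_inv hy]
    exact c'.ψ_mdiff.mdifferentiableAt hy'
  have e1 : mfderiv 𝓘(ℝ, Mdl d n) 𝓘(ℝ, Mdl d n) ((c'.ψ ∘ c.ψ.symm) ∘ c.ψ) y =
      mfderiv 𝓘(ℝ, Mdl d n) 𝓘(ℝ, Mdl d n) c'.ψ y := by
    apply Filter.EventuallyEq.mfderiv_eq
    filter_upwards [c.ψ.open_source.mem_nhds hy] with z hz
    simp [c.ψ.left_inv hz]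
  rw [mfderiv_comp y h1 (c.ψ_mdiff.mdifferentiableAt hy), mfderiv_eq_fderiv] at e1
  exact congrArg (fun l => l v) e1

theorem mapsTo_ψ {z : Mdl d n} (hz : z ∈ (c.ψ.symm.trans c'.ψ).source) :
    (c'.ψ ∘ c.ψ.symm) z ∈ (c'.ψ.symm.trans c.ψ).source := by
  obtain ⟨h1, h2⟩ := hz
  have h2 : c.ψ.symm z ∈ c'.ψ.source := h2
  refine ⟨c'.ψ.map_source h2, ?_⟩
  change c'.ψ.symm (c'.ψ (c.ψ.symm z)) ∈ c.ψ.source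
  rw [c'.ψ.left_inv h2]
  exact c.ψ.map_target h1

theorem mapsTo_φ {z : Mdl d n} (hz : z ∈ (c.ψ.symm.trans c'.ψ).source) :
    ((c'.ψ ∘ c.ψ.symm) z).1 ∈ (c'.φ.symm.trans c.φ).source := by
  obtain ⟨h1, h2⟩ := hz
  have h1 : z ∈ c.ψ.target := h1
  have h2 : c.ψ.symm z ∈ c'.ψ.source := h2
  rw [Function.comp_apply, ← c'.proj _ h2]
  refine ⟨c'.φ.map_source (c'.mapsTo _ h2), ?_⟩
  change c'.φ.symm (c'.φ (π (c.ψ.symm z))) ∈ c.φ.source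
  rw [c'.φ.left_inv (c'.mapsTo _ h2)]
  exact c.mapsTo _ (c.ψ.map_target h1)

theorem smooth_tψ (V : Type*) [NormedAddCommGroup V] [NormedSpace ℝ V] :
    ContDiffOn ℝ ∞ (fun q : Mdl d n × V => c.tψ c' q.1)
      ((c.ψ.symm.trans c'.ψ).source ×ˢ univ) :=
  (c.contDiffOn_tψ c').comp contDiff_fst.contDiffOn (fun _ hq => hq.1)

theorem smooth_tψ' (V : Type*) [NormedAddCommGroup V] [NormedSpace ℝ V] :
    ContDiffOn ℝ ∞ (fun q : Mdl d n × V => c'.tψ c ((c'.ψ ∘ c.ψ.symm) q.1))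
      ((c.ψ.symm.trans c'.ψ).source ×ˢ univ) :=
  ((c'.contDiffOn_tψ c).comp (c.contDiffOn_ψ c') (fun _ hz => c.mapsTo_ψ c' hz)).comp
    contDiff_fst.contDiffOn (fun _ hq => hq.1)

theorem smooth_tφ' (V : Type*) [NormedAddCommGroup V] [NormedSpace ℝ V] :
    ContDiffOn ℝ ∞ (fun q : Mdl d n × V => c'.tφ c ((c'.ψ ∘ c.ψ.symm) q.1).1)
      ((c.ψ.symm.trans c'.ψ).source ×ˢ univ) :=
  ((c'.contDiffOn_tφ c).comp (contDiff_fst.comp_contDiffOn (c.contDiffOn_ψ c'))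
    (fun _ hz => c.mapsTo_φ c' hz)).comp contDiff_fst.contDiffOn (fun _ hq => hq.1)

theorem tψ'_apply {y : E} (hy : y ∈ c.ψ.source) (hy' : y ∈ c'.ψ.source) (w : Mdl d n) :
    c'.tψ c ((c'.ψ ∘ c.ψ.symm) (c.ψ y)) w = c.dψ hy ((c'.dψ hy').symm w) := by
  rw [Function.comp_apply, c.ψ.left_inv hy, ← c'.tψ_dψ c hy' hy,
    ContinuousLinearEquiv.apply_symm_apply]

theorem tφ'_apply {y : E} (hy : y ∈ c.ψ.source) (hy' : y ∈ c'.ψ.source) (u : Base d) :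
    c'.tφ c ((c'.ψ ∘ c.ψ.symm) (c.ψ y)).1 u =
      c.dφ (c.mapsTo y hy) ((c'.dφ (c'.mapsTo y hy')).symm u) := by
  rw [Function.comp_apply, c.ψ.left_inv hy, ← c'.proj y hy',
    ← c'.tφ_dφ c (c'.mapsTo y hy') (c.mapsTo y hy), ContinuousLinearEquiv.apply_symm_apply]

end AdaptedChart

end Charts


section Bundles

variable {d n : ℕ}
  {M : Type*} [TopologicalSpace M] [ChartedSpace (Base d) M]
  {E : Type*} [TopologicalSpace E] [ChartedSpace (Mdl d n) E]

/-- A smooth bundle over `E` with fibres `X y` modelled on `V`, given by the natural fibre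
coordinates that each adapted chart induces and by their smooth changes of coordinates. -/
structure FibreModel (d n : ℕ) {M : Type*} [TopologicalSpace M] [ChartedSpace (Base d) M]
    {E : Type*} [TopologicalSpace E] [ChartedSpace (Mdl d n) E] (π : E → M) (X : E → Type*)
    (V : Type*) [NormedAddCommGroup V] [NormedSpace ℝ V] where
  coord : ∀ (c : AdaptedChart d n π) {y : E}, y ∈ c.ψ.source → X y ≃ V
  tr : AdaptedChart d n π → AdaptedChart d n π → Mdl d n × V → V
  tr_smooth : ∀ c c', ContDiffOn ℝ ∞ (tr c c') ((c.ψ.symm.trans c'.ψ).source ×ˢ univ)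
  tr_coord : ∀ c c' {y : E} (hy : y ∈ c.ψ.source) (hy' : y ∈ c'.ψ.source) (x : X y),
    tr c c' (c.ψ y, coord c hy x) = coord c' hy' x

namespace FibreModel

variable {π : E → M} {X X' : E → Type*} {V V' : Type*}
  [NormedAddCommGroup V] [NormedSpace ℝ V] [NormedAddCommGroup V'] [NormedSpace ℝ V']

/-- Fibre product of two bundles. -/
def prod (K : FibreModel d n π X V) (K' : FibreModel d n π X' V') :
    FibreModel d n π (fun y => X y × X' y) (V × V') where
  coord c _ hy := (K.coord c hy).prodCongr (K'.coord c hy)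
  tr c c' q := (K.tr c c' (q.1, q.2.1), K'.tr c c' (q.1, q.2.2))
  tr_smooth c c' := by
    refine ContDiffOn.prodMk ?_ ?_
    · exact (K.tr_smooth c c').comp
        (contDiff_fst.prodMk (contDiff_fst.comp contDiff_snd)).contDiffOn
        (fun q hq => ⟨hq.1, trivial⟩)
    · exact (K'.tr_smooth c c').comp
        (contDiff_fst.prodMk (contDiff_snd.comp contDiff_snd)).contDiffOn
        (fun q hq => ⟨hq.1, trivial⟩)
  tr_coord c c' y hy hy' x := by
    exact Prod.ext (K.tr_coord c c' hy hy' x.1) (K'.tr_coord c c' hy hy' x.2)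

/-- Transport of the coordinates of a bundle along fibrewise bijections. -/
def congr (K : FibreModel d n π X V) (e : ∀ y, X' y ≃ X y) : FibreModel d n π X' V where
  coord c _ hy := (e _).trans (K.coord c hy)
  tr := K.tr
  tr_smooth := K.tr_smooth
  tr_coord c c' _ hy hy' _ := K.tr_coord c c' hy hy' _

/-- The total space of the bundle. -/
def Tot (_K : FibreModel d n π X V) : Type _ := Σ y, X y

variable (K : FibreModel d n π X V)

open Classical in
/-- The natural coordinates of a point of the total space. -/
def chartFun (c : AdaptedChart d n π) (w : K.Tot) : Mdl d n × V :=
  if h : w.1 ∈ c.ψ.source then (c.ψ w.1, K.coord c h w.2) else 0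

open Classical in
/-- The point with given natural coordinates (`w₀` is a junk value). -/
def chartInv (c : AdaptedChart d n π) (w₀ : K.Tot) (q : Mdl d n × V) : K.Tot :=
  if h : q.1 ∈ c.ψ.target then
    ⟨c.ψ.symm q.1, (K.coord c (c.ψ.map_target h)).symm q.2⟩ else w₀

theorem chartFun_apply (c : AdaptedChart d n π) {y : E} (hy : y ∈ c.ψ.source) (x : X y) :
    K.chartFun c ⟨y, x⟩ = (c.ψ y, K.coord c hy x) := dif_pos hy

theorem chartInv_apply (c : AdaptedChart d n π) (w₀ : K.Tot) {q : Mdl d n × V}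
    (hq : q.1 ∈ c.ψ.target) : K.chartInv c w₀ q =
      ⟨c.ψ.symm q.1, (K.coord c (c.ψ.map_target hq)).symm q.2⟩ := dif_pos hq

/-- The natural chart induced by an adapted chart. -/
def chart (c : AdaptedChart d n π) (w₀ : K.Tot) : PartialEquiv K.Tot (Mdl d n × V) where
  toFun := K.chartFun c
  invFun := K.chartInv c w₀
  source := {w | w.1 ∈ c.ψ.source}
  target := c.ψ.target ×ˢ univ
  map_source' := by
    rintro ⟨y, x⟩ hy
    rw [K.chartFun_apply c hy]
    exact ⟨c.ψ.map_source hy, trivial⟩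
  map_target' := by
    rintro q ⟨hq, -⟩
    rw [K.chartInv_apply c w₀ hq]
    exact c.ψ.map_target hq
  left_inv' := by
    rintro ⟨y, x⟩ hy
    have key : ∀ (z : E) (hz : z ∈ c.ψ.source), z = y →
        (⟨z, (K.coord c hz).symm (K.coord c hy x)⟩ : K.Tot) = ⟨y, x⟩ := by
      rintro z hz rfl
      rw [Equiv.symm_apply_apply]
    rw [K.chartFun_apply c hy, K.chartInv_apply c w₀ (c.ψ.map_source hy)]
    exact key _ _ (c.ψ.left_inv hy)
  right_inv' := by
    rintro ⟨z, v⟩ ⟨hz, -⟩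
    have hz : z ∈ c.ψ.target := hz
    rw [K.chartInv_apply c w₀ hz, K.chartFun_apply c (c.ψ.map_target hz),
      Equiv.apply_symm_apply, c.ψ.right_inv hz]

theorem chart_trans_source (c c' : AdaptedChart d n π) (w₀ w₁ : K.Tot) :
    ((K.chart c w₀).symm.trans (K.chart c' w₁)).source =
      (c.ψ.symm.trans c'.ψ).source ×ˢ univ := by
  ext q
  constructor
  · rintro ⟨h1, h2⟩
    have hq : q.1 ∈ c.ψ.target := h1.1
    have h2 : (K.chartInv c w₀ q).1 ∈ c'.ψ.source := h2
    rw [K.chartInv_apply c w₀ hq] at h2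
    exact ⟨⟨hq, h2⟩, trivial⟩
  · rintro ⟨⟨hq, h2⟩, -⟩
    refine ⟨⟨hq, trivial⟩, ?_⟩
    change (K.chartInv c w₀ q).1 ∈ c'.ψ.source
    rw [K.chartInv_apply c w₀ hq]
    exact h2

theorem chart_trans_eqOn (c c' : AdaptedChart d n π) (w₀ w₁ : K.Tot) :
    EqOn ((K.chart c w₀).symm.trans (K.chart c' w₁))
      (fun q => (c'.ψ (c.ψ.symm q.1), K.tr c c' q))
      ((c.ψ.symm.trans c'.ψ).source ×ˢ univ) := by
  rintro q ⟨⟨hq, hq'⟩, -⟩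
  have hq : q.1 ∈ c.ψ.target := hq
  have hq' : c.ψ.symm q.1 ∈ c'.ψ.source := hq'
  change K.chartFun c' (K.chartInv c w₀ q) = _
  rw [K.chartInv_apply c w₀ hq, K.chartFun_apply c' hq', ← K.tr_coord c c' (c.ψ.map_target hq) hq',
    Equiv.apply_symm_apply, c.ψ.right_inv hq]

section

variable [IsManifold 𝓘(ℝ, Base d) ∞ M] [IsManifold 𝓘(ℝ, Mdl d n) ∞ E]

theorem chart_trans_contDiffOn (c c' : AdaptedChart d n π) (w₀ w₁ : K.Tot) :
    ContDiffOn ℝ ∞ ((K.chart c w₀).symm.trans (K.chart c' w₁))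
      ((K.chart c w₀).symm.trans (K.chart c' w₁)).source := by
  rw [chart_trans_source]
  refine ContDiffOn.congr ?_ (K.chart_trans_eqOn c c' w₀ w₁)
  refine ContDiffOn.prodMk ?_ (K.tr_smooth c c')
  exact (c.contDiffOn_ψ c').comp contDiff_fst.contDiffOn (fun q hq => hq.1)

variable [hπ : Fact (Manifold.IsSubmersion 𝓘(ℝ, Mdl d n) 𝓘(ℝ, Base d) ∞ π)]

/-- The atlas of all natural charts. -/
def core : ChartedSpaceCore (Mdl d n × V) K.Tot where
  atlas := {e | ∃ c w₀, e = K.chart c w₀}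
  chartAt w := K.chart (exists_adaptedChart hπ.out w.1).choose w
  mem_chart_source w := (exists_adaptedChart hπ.out w.1).choose_spec
  chart_mem_atlas w := ⟨_, _, rfl⟩
  open_source := by
    rintro _ _ ⟨c, w₀, rfl⟩ ⟨c', w₁, rfl⟩
    rw [chart_trans_source]
    exact (c.ψ.symm.trans c'.ψ).open_source.prod isOpen_univ
  continuousOn_toFun := by
    rintro _ _ ⟨c, w₀, rfl⟩ ⟨c', w₁, rfl⟩
    exact (K.chart_trans_contDiffOn c c' w₀ w₁).continuousOn

instance : TopologicalSpace K.Tot := K.core.toTopologicalSpace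

instance : ChartedSpace (Mdl d n × V) K.Tot := K.core.toChartedSpace

instance : IsManifold 𝓘(ℝ, Mdl d n × V) ∞ K.Tot := by
  refine isManifold_of_contDiffOn _ _ _ ?_
  rintro e e' he he'
  simp only [atlas, ChartedSpace.atlas, mem_iUnion, mem_singleton_iff] at he he'
  obtain ⟨_, ⟨c, w₀, rfl⟩, rfl⟩ := he
  obtain ⟨_, ⟨c', w₁, rfl⟩, rfl⟩ := he'
  have h := K.chart_trans_contDiffOn c c' w₀ w₁
  simp only [modelWithCornersSelf_coe, modelWithCornersSelf_coe_symm, Function.comp_id,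
    Function.id_comp, preimage_id, range_id, inter_univ]
  exact h

end

end FibreModel

section Concrete

variable (d n) (π : E → M)

/-- The fibre of `J¹π` at `y`: a 1-jet `j¹φ(x)` with `φ(x) = y` is the linear map
`T_x φ : T_x M → T_y E`, a right inverse of `T_y π`. -/
def Jet1 (y : E) : Type :=
  {γ : TangentSpace 𝓘(ℝ, Base d) (π y) →L[ℝ] TangentSpace 𝓘(ℝ, Mdl d n) y //
    ∀ u, mfderiv 𝓘(ℝ, Mdl d n) 𝓘(ℝ, Base d) π y (γ u) = u}

/-- The fibre of `𝓜π = Λ₂ᵐ T*E` at `y`. -/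
abbrev ExtMom (y : E) : Type :=
  semibasic2 (mfderiv 𝓘(ℝ, Mdl d n) 𝓘(ℝ, Base d) π y) (d + 1)

/-- The fibre of `J¹*π = 𝓜π / π*Λᵐ T*M` at `y`. -/
abbrev ResMom (y : E) : Type :=
  Quotient (basicSetoid (mfderiv 𝓘(ℝ, Mdl d n) 𝓘(ℝ, Base d) π y) (d + 1))

/-- The fibre of `Λ^{m-1} T*M` at `π y`. -/
abbrev ActFib (d : ℕ) {M : Type*} [TopologicalSpace M] [ChartedSpace (Base d) M]
    {E : Type*} (π : E → M) (y : E) : Type :=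
  TangentSpace 𝓘(ℝ, Base d) (π y) [⋀^Fin d]→L[ℝ] ℝ

/-- Model of the fibres of `J¹π`, with coordinates `y^A_μ`. -/
abbrev JetMdl (d n : ℕ) : Type := Base d →L[ℝ] (Fin n → ℝ)

/-- Model of the fibres of `Λ^{m-1} T*M`, with coordinates `s^μ`. -/
abbrev ActMdl (d : ℕ) : Type := Base d [⋀^Fin d]→L[ℝ] ℝ

/-- Model of the fibres of `𝓜π`, with coordinates `p^μ_A` and `p`. -/
abbrev ExtMomMdl (d n : ℕ) : Type := MomMdl d n × (Base d [⋀^Fin (d + 1)]→L[ℝ] ℝ)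

variable [IsManifold 𝓘(ℝ, Base d) ∞ M] [IsManifold 𝓘(ℝ, Mdl d n) ∞ E]

variable {d n π} in
theorem dψ_jet (c : AdaptedChart d n π) {y : E} (hy : y ∈ c.ψ.source) (γ : Jet1 d n π y)
    (u : TangentSpace 𝓘(ℝ, Base d) (π y)) :
    (c.dψ hy (γ.1 u)).1 = c.dφ (c.mapsTo y hy) u := by
  have := c.fst_dψ hy (γ.1 u)
  rw [γ.2 u] at this
  exact this

variable {d n π} in
/-- The coordinates `y^A_μ` of a jet. -/
def jetCoord (c : AdaptedChart d n π) {y : E} (hy : y ∈ c.ψ.source) (γ : Jet1 d n π y) :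
    JetMdl d n :=
  (ContinuousLinearMap.snd ℝ (Base d) (Fin n → ℝ)).comp
    (((c.dψ hy : TangentSpace 𝓘(ℝ, Mdl d n) y →L[ℝ] Mdl d n).comp γ.1).comp
      ((c.dφ (c.mapsTo y hy)).symm : Base d →L[ℝ] TangentSpace 𝓘(ℝ, Base d) (π y)))

variable {d n π} in
theorem graph_jetCoord (c : AdaptedChart d n π) {y : E} (hy : y ∈ c.ψ.source)
    (γ : Jet1 d n π y) (u : Base d) :
    (u, jetCoord c hy γ u) = c.dψ hy (γ.1 ((c.dφ (c.mapsTo y hy)).symm u)) := by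
  refine Prod.ext ?_ rfl
  rw [dψ_jet, ContinuousLinearEquiv.apply_symm_apply]

variable {d n π} in
/-- Jets in an adapted chart. -/
def jetEquiv (c : AdaptedChart d n π) {y : E} (hy : y ∈ c.ψ.source) :
    Jet1 d n π y ≃ JetMdl d n where
  toFun := jetCoord c hy
  invFun := fun Γ => ⟨((c.dψ hy).symm : Mdl d n →L[ℝ] TangentSpace 𝓘(ℝ, Mdl d n) y).comp
    (((ContinuousLinearMap.id ℝ (Base d)).prod Γ).comp
      (c.dφ (c.mapsTo y hy) : TangentSpace 𝓘(ℝ, Base d) (π y) →L[ℝ] Base d)), by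
    intro u
    apply (c.dφ (c.mapsTo y hy)).injective
    rw [← c.fst_dψ hy]
    simp⟩
  left_inv := by
    intro γ
    apply Subtype.ext
    ext u
    apply (c.dψ hy).injective
    have h := graph_jetCoord c hy γ (c.dφ (c.mapsTo y hy) u)
    rw [ContinuousLinearEquiv.symm_apply_apply] at h
    rw [← h]
    exact (c.dψ hy).apply_symm_apply _
  right_inv := by
    intro Γ
    ext u
    simp [jetCoord]

variable {d n π} in
/-- Change of coordinates `y^A_μ`. -/
def jetTr (c c' : AdaptedChart d n π) (q : Mdl d n × JetMdl d n) : JetMdl d n :=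
  (ContinuousLinearMap.snd ℝ (Base d) (Fin n → ℝ)).comp
    (((c.tψ c' q.1).comp ((ContinuousLinearMap.id ℝ (Base d)).prod q.2)).comp
      (c'.tφ c ((c'.ψ ∘ c.ψ.symm) q.1).1))

variable {d n π} in
theorem jetTr_smooth (c c' : AdaptedChart d n π) :
    ContDiffOn ℝ ∞ (jetTr c c') ((c.ψ.symm.trans c'.ψ).source ×ˢ univ) := by
  refine ContDiffOn.clm_comp contDiffOn_const ?_
  refine ((c.smooth_tψ c' _).clm_comp ?_).clm_comp (c.smooth_tφ' c' _)
  exact (contDiff_graph.comp contDiff_snd).contDiffOn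

variable {d n π} in
theorem jetTr_coord (c c' : AdaptedChart d n π) {y : E} (hy : y ∈ c.ψ.source)
    (hy' : y ∈ c'.ψ.source) (γ : Jet1 d n π y) :
    jetTr c c' (c.ψ y, jetCoord c hy γ) = jetCoord c' hy' γ := by
  refine ContinuousLinearMap.ext fun u => ?_
  change (c.tψ c' (c.ψ y) (c'.tφ c ((c'.ψ ∘ c.ψ.symm) (c.ψ y)).1 u,
    jetCoord c hy γ (c'.tφ c ((c'.ψ ∘ c.ψ.symm) (c.ψ y)).1 u))).2 = _
  rw [graph_jetCoord, c.tψ_dψ c' hy hy', c.tφ'_apply c' hy hy',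
    ContinuousLinearEquiv.symm_apply_apply, ← graph_jetCoord]

/-- The bundle `J¹π → E`. -/
def jetModel : FibreModel d n π (Jet1 d n π) (JetMdl d n) where
  coord := jetEquiv
  tr := jetTr
  tr_smooth := jetTr_smooth
  tr_coord := jetTr_coord

/-- The bundle `E ×_M Λ^{m-1} T*M → E`. -/
def actModel : FibreModel d n π (ActFib d π) (ActMdl d) where
  coord c y hy :=
    { toFun := fun s => s.compContinuousLinearMap
        ((c.dφ (c.mapsTo y hy)).symm : Base d →L[ℝ] TangentSpace 𝓘(ℝ, Base d) (π y))
      invFun := fun s => s.compContinuousLinearMap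
        (c.dφ (c.mapsTo y hy) : TangentSpace 𝓘(ℝ, Base d) (π y) →L[ℝ] Base d)
      left_inv := by
        intro s
        ext v
        simp [Function.comp_def]
      right_inv := by
        intro s
        ext v
        simp [Function.comp_def] }
  tr c c' q := q.2.compContinuousLinearMap (c'.tφ c ((c'.ψ ∘ c.ψ.symm) q.1).1)
  tr_smooth c c' := by
    exact (contDiff_altPullback (Base d) (Base d) d).comp_contDiffOn
      (contDiff_snd.contDiffOn.prodMk (c.smooth_tφ' c' _))
  tr_coord c c' y hy hy' s := by
    ext v
    refine congrArg s (funext fun i => ?_)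
    change (c.dφ (c.mapsTo y hy)).symm (c'.tφ c ((c'.ψ ∘ c.ψ.symm) (c.ψ y)).1 (v i)) =
      (c'.dφ (c'.mapsTo y hy')).symm (v i)
    rw [c.tφ'_apply c' hy hy', ContinuousLinearEquiv.symm_apply_apply]

variable {d n π} in
/-- Forms on `T_y E` in an adapted chart. -/
def momEquiv (c : AdaptedChart d n π) {y : E} (hy : y ∈ c.ψ.source) : ExtMom d n π y ≃ₗ[ℝ]
    semibasic2 (ContinuousLinearMap.fst ℝ (Base d) (Fin n → ℝ)) (d + 1) :=
  semibasic2Equiv (c.dψ hy) (c.dφ (c.mapsTo y hy)) (c.fst_dψ hy) (d + 1)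

variable {d n π} in
theorem momEquiv_tr (c c' : AdaptedChart d n π) {y : E} (hy : y ∈ c.ψ.source)
    (hy' : y ∈ c'.ψ.source) (α : ExtMom d n π y) : (momEquiv c' hy' α).1 =
      ((momEquiv c hy α).1).compContinuousLinearMap
        (c'.tψ c ((c'.ψ ∘ c.ψ.symm) (c.ψ y))) := by
  ext v
  refine congrArg α.1 (funext fun i => ?_)
  change (c'.dψ hy').symm (v i) =
    (c.dψ hy).symm (c'.tψ c ((c'.ψ ∘ c.ψ.symm) (c.ψ y)) (v i))
  rw [c.tψ'_apply c' hy hy', ContinuousLinearEquiv.symm_apply_apply]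

variable {d n π} in
theorem momEquiv_dψ (c : AdaptedChart d n π) {y : E} (hy : y ∈ c.ψ.source)
    (α : ExtMom d n π y) (v : Fin (d + 1) → TangentSpace 𝓘(ℝ, Mdl d n) y) :
    (momEquiv c hy α).1 (fun i => c.dψ hy (v i)) = α.1 v := by
  refine congrArg α.1 (funext fun i => ?_)
  exact (c.dψ hy).symm_apply_apply (v i)

/-- A form `p_A^μ dy^A ∧ d^{m-1}x_μ + p d^m x` from its coordinates. -/
def ofParts (P : ExtMomMdl d n) : Mdl d n [⋀^Fin (d + 1)]→L[ℝ] ℝ := ofVer P.1 + ofHor P.2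

/-- The coordinates `p^μ_A`, `p` of a form. -/
def parts (α : Mdl d n [⋀^Fin (d + 1)]→L[ℝ] ℝ) : ExtMomMdl d n := (verPart α, horPart α)

theorem parts_ofParts (P : ExtMomMdl d n) : parts d n (ofParts d n P) = P := by
  refine Prod.ext ?_ ?_
  · change verPart (ofVer P.1 + ofHor P.2) = P.1
    rw [map_add, verPart_ofVer, verPart_ofHor]
    ext v w; simp
  · change horPart (ofVer P.1 + ofHor P.2) = P.2
    rw [map_add, horPart_ofVer, horPart_ofHor, zero_add]

theorem contDiff_ofParts : ContDiff ℝ ∞ (ofParts d n) :=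
  (contDiff_ofVer.comp contDiff_fst).add (contDiff_ofHor.comp contDiff_snd)

theorem contDiff_parts : ContDiff ℝ ∞ (parts d n) :=
  contDiff_verPart.prodMk contDiff_horPart

/-- Local forms and their coordinates. -/
def partsEquiv : semibasic2 (ContinuousLinearMap.fst ℝ (Base d) (Fin n → ℝ)) (d + 1) ≃
    ExtMomMdl d n where
  toFun α := parts d n α.1
  invFun P := ⟨ofParts d n P, Submodule.add_mem _ (ofVer_mem _) (ofHor_mem _)⟩
  left_inv α := Subtype.ext (ofVer_add_ofHor α.2)
  right_inv := parts_ofParts d n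

variable {d n π} in
/-- Change of coordinates `p^μ_A`, `p`. -/
def momTr (c c' : AdaptedChart d n π) (q : Mdl d n × ExtMomMdl d n) : ExtMomMdl d n :=
  parts d n ((ofParts d n q.2).compContinuousLinearMap (c'.tψ c ((c'.ψ ∘ c.ψ.symm) q.1)))

variable {d n π} in
theorem momTr_smooth (c c' : AdaptedChart d n π) :
    ContDiffOn ℝ ∞ (momTr c c') ((c.ψ.symm.trans c'.ψ).source ×ˢ univ) :=
  (contDiff_parts d n).comp_contDiffOn
    ((contDiff_altPullback (Mdl d n) (Mdl d n) (d + 1)).comp_contDiffOn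
      (((contDiff_ofParts d n).comp contDiff_snd).contDiffOn.prodMk (c.smooth_tψ' c' _)))

variable {d n π} in
theorem momTr_coord (c c' : AdaptedChart d n π) {y : E} (hy : y ∈ c.ψ.source)
    (hy' : y ∈ c'.ψ.source) (α : ExtMom d n π y) :
    momTr c c' (c.ψ y, parts d n (momEquiv c hy α).1) = parts d n (momEquiv c' hy' α).1 := by
  have h1 : ofParts d n (parts d n (momEquiv c hy α).1) = (momEquiv c hy α).1 :=
    ofVer_add_ofHor (momEquiv c hy α).2
  rw [momEquiv_tr c c' hy hy' α, momTr, h1]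

/-- The bundle `𝓜π → E`. -/
def extMomModel : FibreModel d n π (ExtMom d n π) (ExtMomMdl d n) where
  coord c _ hy := (momEquiv c hy).toEquiv.trans (partsEquiv d n)
  tr := momTr
  tr_smooth := momTr_smooth
  tr_coord := momTr_coord

variable {d n π} in
/-- The coordinates `p^μ_A` of a form. -/
def resMap (c : AdaptedChart d n π) {y : E} (hy : y ∈ c.ψ.source) (α : ExtMom d n π y) :
    MomMdl d n := verPart (momEquiv c hy α).1

variable {d n π} in
theorem resMap_eq_iff (c : AdaptedChart d n π) {y : E} (hy : y ∈ c.ψ.source)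
    (α α' : ExtMom d n π y) : resMap c hy α = resMap c hy α' ↔
      basicSetoid (mfderiv 𝓘(ℝ, Mdl d n) 𝓘(ℝ, Base d) π y) (d + 1) α α' := by
  have hadd : ∀ a b : Mdl d n [⋀^Fin (d + 1)]→L[ℝ] ℝ, verPart (a + b) = verPart a + verPart b :=
    map_add verPart
  constructor
  · intro h
    have h1 := ofVer_add_ofHor (momEquiv c hy α).2
    have h2 := ofVer_add_ofHor (momEquiv c hy α').2
    have h : verPart (momEquiv c hy α).1 = verPart (momEquiv c hy α').1 := h
    refine ⟨(horPart (momEquiv c hy α).1 - horPart (momEquiv c hy α').1).compContinuousLinearMap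
      (c.dφ (c.mapsTo y hy) : TangentSpace 𝓘(ℝ, Base d) (π y) →L[ℝ] Base d), ?_⟩
    ext v
    rw [ContinuousAlternatingMap.add_apply, ← momEquiv_dψ c hy α, ← momEquiv_dψ c hy α']
    have h3 := congrArg (fun a => a (fun i => c.dψ hy (v i))) h1
    have h4 := congrArg (fun a => a (fun i => c.dψ hy (v i))) h2
    refine h3.symm.trans (Eq.trans ?_ (congrArg (· + _) h4))
    rw [h]
    have e : (fun i => (c.dψ hy (v i)).1) = fun i => c.dφ (c.mapsTo y hy)
        (mfderiv 𝓘(ℝ, Mdl d n) 𝓘(ℝ, Base d) π y (v i)) := funext fun i => c.fst_dψ hy (v i)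
    have e' : ∀ β : Base d [⋀^Fin (d + 1)]→L[ℝ] ℝ, ofHor (n := n) β (fun i => c.dψ hy (v i)) =
        β (fun i => c.dφ (c.mapsTo y hy)
          (mfderiv 𝓘(ℝ, Mdl d n) 𝓘(ℝ, Base d) π y (v i))) := fun β => congrArg β e
    simp only [ContinuousAlternatingMap.add_apply, e']
    have e'' : ∀ β : Base d [⋀^Fin (d + 1)]→L[ℝ] ℝ, ((β.compContinuousLinearMap
        (c.dφ (c.mapsTo y hy) : TangentSpace 𝓘(ℝ, Base d) (π y) →L[ℝ] Base d)
          ).compContinuousLinearMap (mfderiv 𝓘(ℝ, Mdl d n) 𝓘(ℝ, Base d) π y)) v =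
        β (fun i => c.dφ (c.mapsTo y hy)
          (mfderiv 𝓘(ℝ, Mdl d n) 𝓘(ℝ, Base d) π y (v i))) := fun β => rfl
    rw [e'', ContinuousAlternatingMap.sub_apply]
    ring
  · rintro ⟨β, h⟩
    have h1 : (momEquiv c hy α).1 = (momEquiv c hy α').1 + ofHor (β.compContinuousLinearMap
        ((c.dφ (c.mapsTo y hy)).symm : Base d →L[ℝ] TangentSpace 𝓘(ℝ, Base d) (π y))) := by
      ext v
      have e := congrArg (fun a => a (fun i => (c.dψ hy).symm (v i))) h
      refine e.trans ?_
      rw [ContinuousAlternatingMap.add_apply]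
      refine congrArg (_ + ·) (congrArg β (funext fun i => ?_))
      apply (c.dφ (c.mapsTo y hy)).injective
      change c.dφ (c.mapsTo y hy) (mfderiv 𝓘(ℝ, Mdl d n) 𝓘(ℝ, Base d) π y
        ((c.dψ hy).symm (v i))) = c.dφ (c.mapsTo y hy) ((c.dφ (c.mapsTo y hy)).symm (v i).1)
      rw [← c.fst_dψ hy, ContinuousLinearEquiv.apply_symm_apply,
        ContinuousLinearEquiv.apply_symm_apply]
      rfl
    change verPart (momEquiv c hy α).1 = verPart (momEquiv c hy α').1
    rw [h1, hadd, verPart_ofHor]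
    ext v w; simp

variable {d n π} in
theorem resMap_surjective (c : AdaptedChart d n π) {y : E} (hy : y ∈ c.ψ.source) :
    Function.Surjective (resMap c hy) := by
  intro P
  refine ⟨(momEquiv c hy).symm ⟨ofVer P, ofVer_mem P⟩, ?_⟩
  simp [resMap, verPart_ofVer]

variable {d n π} in
/-- Classes of forms in an adapted chart. -/
def resEquiv (c : AdaptedChart d n π) {y : E} (hy : y ∈ c.ψ.source) :
    ResMom d n π y ≃ MomMdl d n := Equiv.ofBijective
  (Quotient.lift (resMap c hy) (fun α α' h => (resMap_eq_iff c hy α α').2 h))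
  ⟨by
    rintro ⟨α⟩ ⟨α'⟩ h
    exact Quotient.sound ((resMap_eq_iff c hy α α').1 h), by
    intro P
    obtain ⟨α, h⟩ := resMap_surjective c hy P
    exact ⟨Quotient.mk _ α, h⟩⟩

variable {d n π} in
/-- Change of coordinates `p^μ_A`. -/
def resTr (c c' : AdaptedChart d n π) (q : Mdl d n × MomMdl d n) : MomMdl d n :=
  (momTr c c' (q.1, (q.2, 0))).1

variable {d n π} in
theorem resTr_coord (c c' : AdaptedChart d n π) {y : E} (hy : y ∈ c.ψ.source)
    (hy' : y ∈ c'.ψ.source) (α : ResMom d n π y) :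
    resTr c c' (c.ψ y, resEquiv c hy α) = resEquiv c' hy' α := by
  obtain ⟨α, rfl⟩ := Quotient.exists_rep α
  change (momTr c c' (c.ψ y, (resMap c hy α, 0))).1 = resMap c' hy' α
  obtain ⟨α', h⟩ := ((extMomModel d n π).coord c hy).surjective (resMap c hy α, 0)
  have h : parts d n (momEquiv c hy α').1 = (resMap c hy α, 0) := h
  rw [← h, momTr_coord c c' hy hy' α']
  exact (resMap_eq_iff c' hy' α' α).2 ((resMap_eq_iff c hy α' α).1 (congrArg Prod.fst h))

/-- The bundle `J¹*π → E`. -/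
def resMomModel : FibreModel d n π (ResMom d n π) (MomMdl d n) where
  coord := resEquiv
  tr := resTr
  tr_smooth c c' := contDiff_fst.comp_contDiffOn ((momTr_smooth c c').comp
    (contDiff_fst.prodMk (contDiff_snd.prodMk contDiff_const)).contDiffOn (fun _ hq => hq))
  tr_coord := resTr_coord

end Concrete

end Bundles

section Forms

section Linear

variable {T : Type*} [AddCommGroup T] [Module ℝ T] [TopologicalSpace T]

/-- The contraction `i_v α = α(v, ·, …, ·)`. -/
def interior {k : ℕ} (v : T) (α : T [⋀^Fin (k + 1)]→L[ℝ] ℝ) : T [⋀^Fin k]→L[ℝ] ℝ :=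
  { α.toAlternatingMap.curryLeft v with
    cont := α.cont.comp (continuous_const.matrixVecCons continuous_id) }

@[simp]
theorem interior_apply {k : ℕ} (v : T) (α : T [⋀^Fin (k + 1)]→L[ℝ] ℝ) (u : Fin k → T) :
    interior v α u = α (Matrix.vecCons v u) := rfl

/-- The one-kernel `{v | i_v α = 0}`. -/
def formKer {k : ℕ} (α : T [⋀^Fin (k + 1)]→L[ℝ] ℝ) : Submodule ℝ T where
  carrier := {v | interior v α = 0}
  add_mem' := by
    intro v w hv hw
    ext u
    have hv' : α (Matrix.vecCons v u) = 0 := congrArg (fun β => β u) hv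
    have hw' : α (Matrix.vecCons w u) = 0 := congrArg (fun β => β u) hw
    have h : α (Matrix.vecCons (v + w) u) = α (Matrix.vecCons v u) + α (Matrix.vecCons w u) :=
      α.toMultilinearMap.cons_add u v w
    simp [h, hv', hw']
  zero_mem' := by
    ext u
    exact α.map_coord_zero 0 rfl
  smul_mem' := by
    intro r v hv
    ext u
    have hv' : α (Matrix.vecCons v u) = 0 := congrArg (fun β => β u) hv
    have h : α (Matrix.vecCons (r • v) u) = r • α (Matrix.vecCons v u) :=
      α.toMultilinearMap.cons_smul u r v
    simp [h, hv']

/-- The `k`-forms annihilated by the contraction with every vector of `D`. -/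
def annForms (D : Submodule ℝ T) (k : ℕ) : Set (T [⋀^Fin k]→L[ℝ] ℝ) :=
  {α | ∀ u : Fin k → T, (∃ i, u i ∈ D) → α u = 0}

/-- The exterior product `σ ∧ β` of a `1`-form and a `k`-form. -/
def wedge {k : ℕ} (σ : T →L[ℝ] ℝ) (β : T [⋀^Fin k]→L[ℝ] ℝ) : T [⋀^Fin (k + 1)]→L[ℝ] ℝ :=
  { AlternatingMap.alternatizeUncurryFin
      ((σ : T →ₗ[ℝ] ℝ).smulRight β.toAlternatingMap) with
    cont := by
      have h : ∀ u : Fin (k + 1) → T, AlternatingMap.alternatizeUncurryFin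
          ((σ : T →ₗ[ℝ] ℝ).smulRight β.toAlternatingMap) u =
          ∑ i : Fin (k + 1), (-1 : ℤ) ^ (i : ℕ) • (σ (u i) * β (i.removeNth u)) := by
        intro u
        rw [AlternatingMap.alternatizeUncurryFin_apply]
        rfl
      change Continuous fun u => AlternatingMap.alternatizeUncurryFin
          ((σ : T →ₗ[ℝ] ℝ).smulRight β.toAlternatingMap) u
      simp_rw [h]
      refine continuous_finsetSum _ fun i _ => (continuous_zsmul ((-1 : ℤ) ^ (i : ℕ))).comp ?_
      refine (σ.continuous.comp (continuous_apply i)).mul (β.cont.comp ?_)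
      exact continuous_pi fun j => continuous_apply _ }

theorem wedge_apply {k : ℕ} (σ : T →L[ℝ] ℝ) (β : T [⋀^Fin k]→L[ℝ] ℝ) (u : Fin (k + 1) → T) :
    wedge σ β u = ∑ i : Fin (k + 1), (-1 : ℤ) ^ (i : ℕ) • (σ (u i) * β (i.removeNth u)) :=
  AlternatingMap.alternatizeUncurryFin_apply _ _

end Linear

variable {V : Type*} [NormedAddCommGroup V] [NormedSpace ℝ V]
  {X : Type*} [TopologicalSpace X] [ChartedSpace V X]
  {V' : Type*} [NormedAddCommGroup V'] [NormedSpace ℝ V']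
  {X' : Type*} [TopologicalSpace X'] [ChartedSpace V' X']

/-- The (not necessarily smooth) differential `k`-forms on a manifold `X` modelled on `V`. -/
abbrev Form (V X : Type*) [NormedAddCommGroup V] [NormedSpace ℝ V] [TopologicalSpace X]
    [ChartedSpace V X] (k : ℕ) : Type _ :=
  ∀ x : X, TangentSpace 𝓘(ℝ, V) x [⋀^Fin k]→L[ℝ] ℝ

/-- The pull-back of a form along a (smooth) map. -/
def pullback (f : X → X') {k : ℕ} (η : Form V' X' k) : Form V X k :=
  fun x => (η (f x)).compContinuousLinearMap (mfderiv 𝓘(ℝ, V) 𝓘(ℝ, V') f x)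

/-- The expression of a form in a chart. -/
def inChart (e : OpenPartialHomeomorph X V) {k : ℕ} (η : Form V X k) :
    V → V [⋀^Fin k]→L[ℝ] ℝ :=
  fun v => (η (e.symm v)).compContinuousLinearMap (mfderiv 𝓘(ℝ, V) 𝓘(ℝ, V) e.symm v)

/-- A form is smooth if its expressions in the charts are. -/
def IsSmooth {k : ℕ} (η : Form V X k) : Prop :=
  ∀ x : X, ContDiffOn ℝ ∞ (inChart (chartAt V x) η) (chartAt V x).target

/-- The exterior derivative of a (smooth) form, computed in a chart. -/
def extD {k : ℕ} (η : Form V X k) : Form V X (k + 1) :=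
  fun x => (extDeriv (inChart (chartAt V x) η) (chartAt V x x)).compContinuousLinearMap
    (mfderiv 𝓘(ℝ, V) 𝓘(ℝ, V) (chartAt V x) x)

/-- A volume form on a manifold whose dimension is `k`. -/
def IsVolumeForm {k : ℕ} (η : Form V X k) : Prop := IsSmooth η ∧ ∀ x, η x ≠ 0

end Forms

section Special

variable {d : ℕ} {V : Type*} [NormedAddCommGroup V] [NormedSpace ℝ V]
  {X : Type*} [TopologicalSpace X] [ChartedSpace V X]

/-- The fibre at `x` of the Reeb distribution of a pair `(Θ, ω)` of `m`-forms, `m = d + 1`. -/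
def reebSpace (Θ ωX : Form V X (d + 1)) (x : X) : Submodule ℝ (TangentSpace 𝓘(ℝ, V) x) where
  carrier := {R | R ∈ formKer (ωX x) ∧ interior R (extD Θ x) ∈ annForms (formKer (ωX x)) (d + 1)}
  add_mem' := by
    rintro R R' ⟨h1, h2⟩ ⟨h1', h2'⟩
    refine ⟨add_mem h1 h1', fun u hu => ?_⟩
    have h : extD Θ x (Matrix.vecCons (R + R') u) =
        extD Θ x (Matrix.vecCons R u) + extD Θ x (Matrix.vecCons R' u) :=
      (extD Θ x).toMultilinearMap.cons_add u R R'
    have e1 : extD Θ x (Matrix.vecCons R u) = 0 := h2 u hu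
    have e2 : extD Θ x (Matrix.vecCons R' u) = 0 := h2' u hu
    rw [interior_apply, h, e1, e2, add_zero]
  zero_mem' := ⟨zero_mem _, fun u _ => (extD Θ x).map_coord_zero 0 rfl⟩
  smul_mem' := by
    rintro r R ⟨h1, h2⟩
    refine ⟨Submodule.smul_mem _ r h1, fun u hu => ?_⟩
    have h : extD Θ x (Matrix.vecCons (r • R) u) = r • extD Θ x (Matrix.vecCons R u) :=
      (extD Θ x).toMultilinearMap.cons_smul u r R
    have e1 : extD Θ x (Matrix.vecCons R u) = 0 := h2 u hu
    rw [interior_apply, h, e1, smul_zero]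

/-- The fibre at `x` of the characteristic distribution `ker ω ∩ ker Θ ∩ ker dΘ`. -/
def charSpace (Θ ωX : Form V X (d + 1)) (x : X) : Submodule ℝ (TangentSpace 𝓘(ℝ, V) x) :=
  formKer (ωX x) ⊓ formKer (Θ x) ⊓ formKer (extD Θ x)

/-- The pair `(Θ, ω)` of smooth `m`-forms, `m = d + 1`, on the manifold `X` of dimension `m + N`,
with `ω` closed, is a special premulticontact structure on the points of `S`, with
characteristic distribution of rank `k ≤ N - m`: all the pointwise conditions of the definition
of a special premulticontact structure hold at the points of `S`. For `S = univ` this is the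
definition of a special premulticontact structure on `X`. -/
structure IsSpecialPremulticontactOn (Θ ωX : Form V X (d + 1)) (k : ℕ) (S : Set X) : Prop where
  smooth_form : IsSmooth Θ
  smooth_omega : IsSmooth ωX
  closed : ∀ x, extD ωX x = 0
  rank_le : 2 * (d + 1) + k ≤ Module.finrank ℝ V
  rank_form : ∃ r : ℕ, ∀ x ∈ S, Module.finrank ℝ (formKer (Θ x)) = r
  rank_ker : ∀ x ∈ S, Module.finrank ℝ (formKer (ωX x)) + (d + 1) = Module.finrank ℝ V
  rank_reeb : ∀ x ∈ S, Module.finrank ℝ (reebSpace Θ ωX x) = d + 1 + k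
  rank_char : ∀ x ∈ S, Module.finrank ℝ (charSpace Θ ωX x) = k
  ann_eq : ∀ x ∈ S, annForms (formKer (ωX x)) d =
    {β | ∃ R ∈ reebSpace Θ ωX x, β = interior R (Θ x)}

/-- `σ` satisfies at `x` the equations `σ ∧ i_R Θ = i_R dΘ`, `R` in the Reeb distribution, that
define the dissipation form. -/
def IsDissipationAt (Θ ωX : Form V X (d + 1)) (x : X) (σ : TangentSpace 𝓘(ℝ, V) x →L[ℝ] ℝ) :
    Prop :=
  ∀ R ∈ reebSpace Θ ωX x, wedge σ (interior R (Θ x)) = interior R (extD Θ x)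

variable {M : Type*} [TopologicalSpace M] [ChartedSpace (Base d) M]

/-- `(X, Θ, κ^* ω_M)` is a special premulticontact bundle on the points of `S`: `κ : X → M` is a
smooth submersion, `ω_M` a volume form and `(Θ, κ^* ω_M)` is special premulticontact there. -/
structure IsSpecialPremulticontactBundleOn (κ : X → M) (ωM : Form (Base d) M (d + 1))
    (Θ : Form V X (d + 1)) (k : ℕ) (S : Set X) : Prop where
  volume : IsVolumeForm ωM
  smooth_proj : ContMDiff 𝓘(ℝ, V) 𝓘(ℝ, Base d) ∞ κ
  submersion : ∀ x, Function.Surjective (mfderiv 𝓘(ℝ, V) 𝓘(ℝ, Base d) κ x)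
  special : IsSpecialPremulticontactOn Θ (pullback κ ωM) k S

/-- `S` is a submanifold of `X` of codimension `q`, transversal to `κ`: near each of its points
it is the zero set of a smooth submersion `f` to `ℝ^q`, and the tangent space of `S`, i.e.
`ker Tf`, projects onto that of `M`. -/
def IsTransversalSubmanifold (κ : X → M) (S : Set X) (q : ℕ) : Prop :=
  ∀ x ∈ S, ∃ (U : Set X) (f : X → (Fin q → ℝ)), IsOpen U ∧ x ∈ U ∧
    ContMDiffOn 𝓘(ℝ, V) 𝓘(ℝ, Fin q → ℝ) ∞ f U ∧ S ∩ U = {z ∈ U | f z = 0} ∧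
    ∀ z ∈ S ∩ U, Function.Surjective (mfderiv 𝓘(ℝ, V) 𝓘(ℝ, Fin q → ℝ) f z) ∧
      ∀ v, ∃ u : TangentSpace 𝓘(ℝ, V) z, mfderiv 𝓘(ℝ, V) 𝓘(ℝ, Fin q → ℝ) f z u = 0 ∧
        mfderiv 𝓘(ℝ, V) 𝓘(ℝ, Base d) κ z u = v

end Special

section Unified

variable (d n : ℕ)
  {M : Type*} [TopologicalSpace M] [ChartedSpace (Base d) M]
  {E : Type*} [TopologicalSpace E] [ChartedSpace (Mdl d n) E] (π : E → M)
  [IsManifold 𝓘(ℝ, Base d) ∞ M] [IsManifold 𝓘(ℝ, Mdl d n) ∞ E]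

/-- The bundle `J¹π ×_M Λ^{m-1} T*M → E`. -/
abbrev velModel := (jetModel d n π).prod (actModel d n π)

/-- The bundle `J^{1*}π ×_M Λ^{m-1} T*M → E`. -/
abbrev momModel := (resMomModel d n π).prod (actModel d n π)

/-- The bundle `(J¹π ×_E 𝓜π) ×_M Λ^{m-1} T*M → E`. -/
abbrev extModel := (jetModel d n π).prod ((extMomModel d n π).prod (actModel d n π))

/-- The bundle `(J¹π ×_E J^{1*}π) ×_M Λ^{m-1} T*M → E`. -/
abbrev unifModel := (jetModel d n π).prod (momModel d n π)

/-- `𝒫 = J¹π ×_M Λ^{m-1} T*M`, with points `⟨y, γ, s⟩`. -/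
abbrev VelSpace : Type _ := (velModel d n π).Tot

/-- `𝒫* = J^{1*}π ×_M Λ^{m-1} T*M`, with points `⟨y, [α], s⟩`. -/
abbrev MomSpace : Type _ := (momModel d n π).Tot

/-- `𝒲 = (J¹π ×_E 𝓜π) ×_M Λ^{m-1} T*M`, with points `⟨y, γ, α, s⟩`. -/
abbrev ExtSpace : Type _ := (extModel d n π).Tot

variable {d n π}

/-- The value `(T_x φ)^* α` of the coupling form at `(j¹φ(x), α)`. -/
def coupling {y : E} (γ : Jet1 d n π y) (α : ExtMom d n π y) :
    TangentSpace 𝓘(ℝ, Base d) (π y) [⋀^Fin (d + 1)]→L[ℝ] ℝ :=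
  α.1.compContinuousLinearMap γ.1

/-- Forms pulled back along `π`. -/
def basicForm {y : E} (β : TangentSpace 𝓘(ℝ, Base d) (π y) [⋀^Fin (d + 1)]→L[ℝ] ℝ) :
    ExtMom d n π y :=
  ⟨β.compContinuousLinearMap (mfderiv 𝓘(ℝ, Mdl d n) 𝓘(ℝ, Base d) π y),
    fun _ i _ _ hi _ => β.map_coord_zero i hi⟩

theorem coupling_add_basicForm {y : E} (γ : Jet1 d n π y) (α : ExtMom d n π y)
    (β : TangentSpace 𝓘(ℝ, Base d) (π y) [⋀^Fin (d + 1)]→L[ℝ] ℝ) :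
    coupling γ (α + basicForm β) = coupling γ α + β := by
  ext u
  change α.1 (fun i => γ.1 (u i)) + β (fun i => mfderiv 𝓘(ℝ, Mdl d n) 𝓘(ℝ, Base d) π y (γ.1 (u i)))
    = α.1 (fun i => γ.1 (u i)) + β u
  simp only [γ.2]

variable (ωM : Form (Base d) M (d + 1)) (L : VelSpace d n π → ℝ)

/-- The fibre over `y` of the Hamiltonian submanifold `𝒲₀ ⊆ 𝒲`, on which the coupling form is the
Lagrangian density `𝓛 = L ω_M`. -/
def HamFib (y : E) : Type _ :=
  {q : Jet1 d n π y × ExtMom d n π y × ActFib d π y //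
    coupling q.1 q.2.1 = L ⟨y, (q.1, q.2.2)⟩ • ωM (π y)}

/-- The map `μ_𝒲 ∘ j₀ : (γ, α, s) ↦ (γ, [α], s)` on the fibres over `y`. -/
def hamMap (y : E) (q : HamFib ωM L y) : Jet1 d n π y × ResMom d n π y × ActFib d π y :=
  (q.1.1, Quotient.mk _ q.1.2.1, q.1.2.2)

theorem hamMap_bijective (y : E) : Function.Bijective (hamMap ωM L y) := by
  constructor
  · rintro ⟨⟨γ, α, s⟩, h⟩ ⟨⟨γ', α', s'⟩, h'⟩ e
    simp only [hamMap, Prod.mk.injEq] at e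
    obtain ⟨rfl, e, rfl⟩ := e
    obtain ⟨β, hβ⟩ := Quotient.exact e
    have hα : α = α' + basicForm β := Subtype.ext hβ
    have h : coupling γ α = L ⟨y, (γ, s)⟩ • ωM (π y) := h
    have h' : coupling γ α' = L ⟨y, (γ, s)⟩ • ωM (π y) := h'
    rw [hα, coupling_add_basicForm, h'] at h
    have hβ0 : β = 0 := by simpa using h
    have hα' : α = α' := by
      rw [hα, hβ0]
      ext u
      exact add_zero _
    subst hα'
    rfl
  · rintro ⟨γ, q, s⟩
    obtain ⟨α, rfl⟩ := Quotient.exists_rep q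
    refine ⟨⟨(γ, α + basicForm (L ⟨y, (γ, s)⟩ • ωM (π y) - coupling γ α), s), ?_⟩, ?_⟩
    · change coupling γ _ = _
      rw [coupling_add_basicForm]
      abel
    · refine Prod.ext rfl (Prod.ext ?_ rfl)
      exact Quotient.sound ⟨_, rfl⟩

/-- The bundle `𝒲₀ → E`, with coordinates `(x^μ, y^A, y^A_μ, p^μ_A, s^μ)`: its differentiable
structure is the one for which `μ_𝒲 ∘ j₀ : 𝒲₀ → (J¹π ×_E J^{1*}π) ×_M Λ^{m-1} T*M` is a
diffeomorphism. -/
abbrev hamModel := (unifModel d n π).congr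
  (fun y => Equiv.ofBijective (hamMap ωM L y) (hamMap_bijective ωM L y))

/-- The manifold `𝒲₀`. -/
abbrev HamSpace : Type _ := (hamModel ωM L).Tot

/-- Model space of `𝒲₀`. -/
abbrev HamMdl (d n : ℕ) : Type := Mdl d n × (JetMdl d n × (MomMdl d n × ActMdl d))

/-- Model space of `𝒲`. -/
abbrev ExtMdl (d n : ℕ) : Type := Mdl d n × (JetMdl d n × (ExtMomMdl d n × ActMdl d))

/-- Model space of `𝒫`. -/
abbrev VelMdl (d n : ℕ) : Type := Mdl d n × (JetMdl d n × ActMdl d)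

/-- Model space of `𝒫*`. -/
abbrev MomSpaceMdl (d n : ℕ) : Type := Mdl d n × (MomMdl d n × ActMdl d)

/-- The projection `ρ_M : 𝒲₀ → M`. -/
def projM (w : HamSpace ωM L) : M := π w.1

/-- The inclusion `j₀ : 𝒲₀ → 𝒲`. -/
def incl (w : HamSpace ωM L) : ExtSpace d n π := ⟨w.1, w.2.1⟩

/-- The projection `𝒲₀ → 𝒫`. -/
def prVel (w : HamSpace ωM L) : VelSpace d n π := ⟨w.1, (w.2.1.1, w.2.1.2.2)⟩

/-- The projection `𝒲₀ → 𝒫*`. -/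
def prMom (w : HamSpace ωM L) : MomSpace d n π := ⟨w.1, (Quotient.mk _ w.2.1.2.1, w.2.1.2.2)⟩

variable [hπ : Fact (Manifold.IsSubmersion 𝓘(ℝ, Mdl d n) 𝓘(ℝ, Base d) ∞ π)]

variable (d n π) in
/-- The pull-back to `𝒲` of the tautological `m`-form of `𝓜π`, whose value at `(y, γ, α, s)` is the
pull-back of `α` along the projection `𝒲 → E`. -/
def tautMom : Form (ExtMdl d n) (ExtSpace d n π) (d + 1) :=
  fun w => w.2.2.1.1.compContinuousLinearMap
    (mfderiv 𝓘(ℝ, ExtMdl d n) 𝓘(ℝ, Mdl d n) (fun w' : ExtSpace d n π => w'.1) w)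

variable (d n π) in
/-- The pull-back to `𝒲` of the tautological `(m-1)`-form of `Λ^{m-1} T*M`, whose value at
`(y, γ, α, s)` is the pull-back of `s` along the projection `𝒲 → M`. -/
def tautAct : Form (ExtMdl d n) (ExtSpace d n π) d :=
  fun w => w.2.2.2.compContinuousLinearMap
    (mfderiv 𝓘(ℝ, ExtMdl d n) 𝓘(ℝ, Base d) (fun w' : ExtSpace d n π => π w'.1) w)

variable (d n π) in
/-- The canonical `m`-form `Θ_𝒲` of `𝒲`. -/
def thetaExt : Form (ExtMdl d n) (ExtSpace d n π) (d + 1) :=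
  fun w => -tautMom d n π w + extD (tautAct d n π) w

/-- The form `Θ₀ = j₀^* Θ_𝒲`. -/
def thetaHam : Form (HamMdl d n) (HamSpace ωM L) (d + 1) :=
  pullback (incl ωM L) (thetaExt d n π)

/-- The form `ω = ρ_M^* ω_M` on `𝒲₀`. -/
def omegaHam : Form (HamMdl d n) (HamSpace ωM L) (d + 1) :=
  pullback (projM ωM L) ωM

/-- The subset `𝒲₁` of `𝒲₀`: the points at which `i_X dΘ₀ = 0` for every tangent vector `X` that is
vertical for the projection `𝒲₀ → 𝒫*`. -/
def W1 : Set (HamSpace ωM L) :=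
  {w | ∀ X : TangentSpace 𝓘(ℝ, HamMdl d n) w,
    mfderiv 𝓘(ℝ, HamMdl d n) 𝓘(ℝ, MomSpaceMdl d n) (prMom ωM L) w X = 0 →
      interior X (extD (thetaHam ωM L) w) = 0}

section Coordinates

variable (d) in
/-- The form `d^m x` on `ℝ^m`, `m = d + 1`. -/
def stdVol : Base d [⋀^Fin (d + 1)]→L[ℝ] ℝ :=
  { (Matrix.detRowAlternating : Base d [⋀^Fin (d + 1)]→ₗ[ℝ] ℝ) with
    cont := by
      change Continuous fun A : Matrix (Fin (d + 1)) (Fin (d + 1)) ℝ => A.det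
      exact continuous_id.matrix_det }

/-- The chart is such that `ω_M = d^m x`. -/
def IsNatural (c : AdaptedChart d n π) : Prop :=
  ∀ x (hx : x ∈ c.φ.source), ωM x = (stdVol d).compContinuousLinearMap
    (c.dφ hx : TangentSpace 𝓘(ℝ, Base d) x →L[ℝ] Base d)

/-- The coordinate `p^μ_A` of `α = p^μ_A dy^A ∧ d^{m-1}x_μ + p d^m x`, i.e.
`(-1)^μ α(∂/∂y^A, ∂/∂x^0, …, omitting ∂/∂x^μ, …, ∂/∂x^d)`. -/
def momCoord (c : AdaptedChart d n π) {y : E} (hy : y ∈ c.ψ.source) (α : ExtMom d n π y)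
    (μ : Fin (d + 1)) (A : Fin n) : ℝ :=
  (-1) ^ (μ : ℕ) * verPart (momEquiv c hy α).1 (Pi.single A 1)
    (fun j => Pi.single (μ.succAbove j) 1)

/-- The partial derivative of `L` at `p` in the direction `v`, in the coordinates
`(x^μ, y^A, y^A_μ, s^μ)` of `𝒫` induced by an adapted chart. -/
def partialL (c : AdaptedChart d n π) (p : VelSpace d n π) (v : VelMdl d n) : ℝ :=
  fderiv ℝ (fun q => L ((velModel d n π).chartInv c p q)) ((velModel d n π).chartFun c p) v

/-- `∂L/∂y^A_μ`. -/
def partialVel (c : AdaptedChart d n π) (p : VelSpace d n π) (μ : Fin (d + 1)) (A : Fin n) : ℝ :=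
  partialL L c p
    (0, ((ContinuousLinearMap.proj (R := ℝ) (φ := fun _ : Fin (d + 1) => ℝ) μ).smulRight
      (Pi.single A (1 : ℝ) : Fin n → ℝ), 0))

/-- `∂L/∂s^μ`, where `s = s^μ d^{m-1}x_μ` and `d^{m-1}x_μ = i_{∂/∂x^μ} d^m x`. -/
def partialAct (c : AdaptedChart d n π) (p : VelSpace d n π) (μ : Fin (d + 1)) : ℝ :=
  partialL L c p (0, (0, interior (Pi.single μ (1 : ℝ) : Base d) (stdVol d)))

/-- The `1`-form `dx^μ` on `𝒲₀`. -/
def dx (c : AdaptedChart d n π) (w : HamSpace ωM L) (μ : Fin (d + 1)) :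
    TangentSpace 𝓘(ℝ, HamMdl d n) w →L[ℝ] ℝ :=
  mfderiv 𝓘(ℝ, HamMdl d n) 𝓘(ℝ, ℝ) (fun w' : HamSpace ωM L => c.φ (projM ωM L w') μ) w

end Coordinates

end Unified

end Multicontact

end

/-! Write $m=d+1$ and use coordinates $(x^\mu,y^A,y^A_\mu,p^\mu_A,s^\mu)$ induced by any adapted
chart. There $\Theta_\circ=-p^\mu_A\,dy^A\wedge d^{m-1}x_\mu-p\,d^mx+ds^\mu\wedge d^{m-1}x_\mu$,
where $p$ is the function obtained by solving the constraint, and $d\Theta_\circ=-dp^\mu_A\wedge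
dy^A\wedge d^{m-1}x_\mu-dp\wedge d^mx$. At a fixed point everything is linear algebra in these two
expressions, and the Lagrangian enters only through the differential $D$ of $p$.

A vector $R$ of $\ker\omega$ has no $\partial/\partial x^\mu$ component. Its contraction with
$-dp\wedge d^mx$ has only horizontal legs, so the Reeb condition concerns the other term alone and
says that the $y^A$ and $p^\mu_A$ components vanish (`ann_dthetaVal_iff`). Hence at every point of
$\mathcal W_\circ$ the Reeb distribution is spanned by the $\partial/\partial y^A_\mu$ and
$\partial/\partial s^\mu$ and has rank $m+nm$. On it $i_R\Theta_\circ=R(s^\mu)\,d^{m-1}x_\mu$, which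
gives condition (4), and $i_Rd\Theta_\circ=-D(R)\,d^mx$. A characteristic vector must also have zero
$s^\mu$ component and $D(R)=0$, so the characteristic space is the kernel of $D$ on the
$nm$-dimensional space of jet directions (`characteristic_iff`, `IsHamModel.finrank_char`).

That kernel is everything exactly when $\partial p/\partial y^A_\mu=0$, and this is the equation of
$\mathcal W_1$ (`mem_W1_iff`). In natural coordinates $p=L-p^\mu_Ay^A_\mu$, so it reads
$p^\mu_A=\partial L/\partial y^A_\mu$. Since the Reeb rank forces $k=nm$, the structure is special
premulticontact precisely on $\mathcal W_1$. The kernel of $\Theta_\circ$ has constant dimension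
everywhere, because a linear shear in $s$ brings $\Theta_\circ$ at any point to $ds^\mu\wedge
d^{m-1}x_\mu$ (`thetaVal_shear`). The momenta enter the equations of $\mathcal W_1$ linearly and
surjectively, so they define a submersion, and they can compensate any displacement in $x$; this is
transversality. For the dissipation form, $\sigma\wedge i_vd^mx=\sigma(v)\,d^mx$ on $\mathbb R^m$
(`wedge_interior`) determines $\sigma$ completely.

Adapted charts suffice for all of this when $p$ and $L\omega_M$ are treated as functions with values
in the top forms of $\mathbb R^m$. The normalization $\omega_M=d^mx$ is used only to read off the
two coordinate formulas. -/

noncomputable section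

namespace Multicontact

/-! ### Forms and maps in charts; independence of the exterior derivative from the chart -/

section LocalExpressions

variable {V : Type*} [NormedAddCommGroup V] [NormedSpace ℝ V]
  {X : Type*} [TopologicalSpace X] [ChartedSpace V X]
  {V' : Type*} [NormedAddCommGroup V'] [NormedSpace ℝ V']
  {X' : Type*} [TopologicalSpace X'] [ChartedSpace V' X']

/-- The tangent map of a chart, with values in the model space. -/
def dchart (e : OpenPartialHomeomorph X V) (x : X) : TangentSpace 𝓘(ℝ, V) x →L[ℝ] V :=
  mfderiv 𝓘(ℝ, V) 𝓘(ℝ, V) e x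

theorem mdifferentiableAt_chart [IsManifold 𝓘(ℝ, V) ∞ X] {e : OpenPartialHomeomorph X V}
    (he : e ∈ IsManifold.maximalAtlas 𝓘(ℝ, V) ∞ X) {x : X} (hx : x ∈ e.source) :
    MDifferentiableAt 𝓘(ℝ, V) 𝓘(ℝ, V) e x :=
  (contMDiffAt_of_mem_maximalAtlas he hx).mdifferentiableAt (by simp)

theorem mdifferentiableAt_chart_symm [IsManifold 𝓘(ℝ, V) ∞ X] {e : OpenPartialHomeomorph X V}
    (he : e ∈ IsManifold.maximalAtlas 𝓘(ℝ, V) ∞ X) {v : V} (hv : v ∈ e.target) :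
    MDifferentiableAt 𝓘(ℝ, V) 𝓘(ℝ, V) e.symm v :=
  (contMDiffAt_symm_of_mem_maximalAtlas he hv).mdifferentiableAt (by simp)

/-- This is the chain rule for `e' ∘ f = F ∘ e` near `x`. Differentiability of `f` is not assumed:
it follows from `f = e'.symm ∘ F ∘ e` near `x`. -/
theorem dchart_mfderiv_of_eventually [IsManifold 𝓘(ℝ, V) ∞ X] [IsManifold 𝓘(ℝ, V') ∞ X']
    {e : OpenPartialHomeomorph X V} {e' : OpenPartialHomeomorph X' V'}
    (he : e ∈ IsManifold.maximalAtlas 𝓘(ℝ, V) ∞ X)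
    (he' : e' ∈ IsManifold.maximalAtlas 𝓘(ℝ, V') ∞ X') {f : X → X'} {F : V → V'} {x : X}
    (hx : x ∈ e.source) (hf : ∀ᶠ z in 𝓝 x, f z ∈ e'.source ∧ e' (f z) = F (e z))
    (hF : DifferentiableAt ℝ F (e x)) (v : TangentSpace 𝓘(ℝ, V) x) :
    dchart e' (f x) (mfderiv 𝓘(ℝ, V) 𝓘(ℝ, V') f x v) = fderiv ℝ F (e x) (dchart e x v) := by
  have h1 : MDifferentiableAt 𝓘(ℝ, V) 𝓘(ℝ, V') (F ∘ e) x :=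
    hF.mdifferentiableAt.comp x (mdifferentiableAt_chart he hx)
  have hfx := hf.self_of_nhds
  have h2 : MDifferentiableAt 𝓘(ℝ, V') 𝓘(ℝ, V') e'.symm (F (e x)) :=
    mdifferentiableAt_chart_symm he'
      (by rw [← hfx.2]; exact e'.map_source hfx.1)
  have h3 : MDifferentiableAt 𝓘(ℝ, V) 𝓘(ℝ, V') f x := by
    refine (h2.comp x h1).congr_of_eventuallyEq ?_
    filter_upwards [hf] with z hz
    simp [← hz.2, e'.left_inv hz.1]
  have e1 : mfderiv 𝓘(ℝ, V) 𝓘(ℝ, V') (e' ∘ f) x = mfderiv 𝓘(ℝ, V) 𝓘(ℝ, V') (F ∘ e) x := by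
    apply Filter.EventuallyEq.mfderiv_eq
    filter_upwards [hf] with z hz using hz.2
  rw [mfderiv_comp x (mdifferentiableAt_chart he' hfx.1) h3,
    mfderiv_comp x hF.mdifferentiableAt
      (mdifferentiableAt_chart he hx), mfderiv_eq_fderiv] at e1
  exact congrArg (fun l => l v) e1

variable [IsManifold 𝓘(ℝ, V) ∞ X] [IsManifold 𝓘(ℝ, V') ∞ X']

/-- The tangent map of a chart as an isomorphism. -/
def dchartEquiv {e : OpenPartialHomeomorph X V}
    (he : e ∈ IsManifold.maximalAtlas 𝓘(ℝ, V) ∞ X) {x : X} (hx : x ∈ e.source) :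
    TangentSpace 𝓘(ℝ, V) x ≃L[ℝ] V :=
  OpenPartialHomeomorph.MDifferentiable.mfderiv (I := 𝓘(ℝ, V)) (I' := 𝓘(ℝ, V)) (e := e)
    ⟨(contMDiffOn_of_mem_maximalAtlas he).mdifferentiableOn (by simp),
      (contMDiffOn_symm_of_mem_maximalAtlas he).mdifferentiableOn (by simp)⟩ hx

theorem dchartEquiv_apply {e : OpenPartialHomeomorph X V}
    (he : e ∈ IsManifold.maximalAtlas 𝓘(ℝ, V) ∞ X) {x : X} (hx : x ∈ e.source)
    (v : TangentSpace 𝓘(ℝ, V) x) : dchartEquiv he hx v = dchart e x v := rfl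

theorem mfderiv_symm_dchart {e : OpenPartialHomeomorph X V}
    (he : e ∈ IsManifold.maximalAtlas 𝓘(ℝ, V) ∞ X) {x : X} (hx : x ∈ e.source)
    (v : TangentSpace 𝓘(ℝ, V) x) :
    mfderiv 𝓘(ℝ, V) 𝓘(ℝ, V) e.symm (e x) (dchart e x v) = v :=
  (dchartEquiv he hx).symm_apply_apply v

theorem dchart_mfderiv_symm {e : OpenPartialHomeomorph X V}
    (he : e ∈ IsManifold.maximalAtlas 𝓘(ℝ, V) ∞ X) {u : V} (hu : u ∈ e.target) (v : V) :
    dchart e (e.symm u) (mfderiv 𝓘(ℝ, V) 𝓘(ℝ, V) e.symm u v) = v := by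
  have := (dchartEquiv he (e.map_target hu)).apply_symm_apply v
  have h : (dchartEquiv he (e.map_target hu)).symm v =
      mfderiv 𝓘(ℝ, V) 𝓘(ℝ, V) e.symm (e (e.symm u)) v := rfl
  rw [h, e.right_inv hu] at this
  exact this

/-- `loc` is the expression of the form `η` in the chart `e`. -/
def IsLocalExpr (e : OpenPartialHomeomorph X V) {k : ℕ} (η : Form V X k)
    (loc : V → V [⋀^Fin k]→L[ℝ] ℝ) : Prop :=
  ∀ x ∈ e.source, η x = (loc (e x)).compContinuousLinearMap (dchart e x)

/-- `F` is the expression of the map `f` in the charts `e` and `e'`. -/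
structure IsLocalRep (e : OpenPartialHomeomorph X V) (e' : OpenPartialHomeomorph X' V')
    (f : X → X') (F : V → V') : Prop where
  mapsTo : ∀ x ∈ e.source, f x ∈ e'.source
  eq : ∀ x ∈ e.source, e' (f x) = F (e x)
  smooth : ContDiffOn ℝ ∞ F e.target

theorem IsLocalRep.dchart_mfderiv {e : OpenPartialHomeomorph X V}
    {e' : OpenPartialHomeomorph X' V'} {f : X → X'} {F : V → V'}
    (he : e ∈ IsManifold.maximalAtlas 𝓘(ℝ, V) ∞ X)
    (he' : e' ∈ IsManifold.maximalAtlas 𝓘(ℝ, V') ∞ X') (h : IsLocalRep e e' f F) {x : X}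
    (hx : x ∈ e.source) (v : TangentSpace 𝓘(ℝ, V) x) :
    dchart e' (f x) (mfderiv 𝓘(ℝ, V) 𝓘(ℝ, V') f x v) = fderiv ℝ F (e x) (dchart e x v) := by
  refine dchart_mfderiv_of_eventually he he' hx ?_
    ((h.smooth.contDiffAt (e.open_target.mem_nhds (e.map_source hx))).differentiableAt (by simp)) v
  filter_upwards [e.open_source.mem_nhds hx] with z hz using ⟨h.mapsTo z hz, h.eq z hz⟩

theorem IsLocalRep.contMDiffAt {e : OpenPartialHomeomorph X V}
    {e' : OpenPartialHomeomorph X' V'} {f : X → X'} {F : V → V'}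
    (he : e ∈ IsManifold.maximalAtlas 𝓘(ℝ, V) ∞ X)
    (he' : e' ∈ IsManifold.maximalAtlas 𝓘(ℝ, V') ∞ X') (h : IsLocalRep e e' f F) {x : X}
    (hx : x ∈ e.source) : ContMDiffAt 𝓘(ℝ, V) 𝓘(ℝ, V') ∞ f x := by
  have h1 : ContMDiffAt 𝓘(ℝ, V) 𝓘(ℝ, V') ∞ (F ∘ e) x :=
    (h.smooth.contDiffAt (e.open_target.mem_nhds (e.map_source hx))).contMDiffAt.comp x
      (contMDiffAt_of_mem_maximalAtlas he hx)
  have h2 : ContMDiffAt 𝓘(ℝ, V') 𝓘(ℝ, V') ∞ e'.symm (F (e x)) :=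
    contMDiffAt_symm_of_mem_maximalAtlas he'
      (by rw [← h.eq x hx]; exact e'.map_source (h.mapsTo x hx))
  refine (ContMDiffAt.comp x h2 h1).congr_of_eventuallyEq ?_
  filter_upwards [e.open_source.mem_nhds hx] with z hz
  simp [← h.eq z hz, e'.left_inv (h.mapsTo z hz)]

theorem isLocalExpr_inChart {e : OpenPartialHomeomorph X V}
    (he : e ∈ IsManifold.maximalAtlas 𝓘(ℝ, V) ∞ X) {k : ℕ} (η : Form V X k) :
    IsLocalExpr e η (inChart e η) := by
  intro x hx
  ext u
  change η x u = η (e.symm (e x)) (fun i => mfderiv 𝓘(ℝ, V) 𝓘(ℝ, V) e.symm (e x)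
    (dchart e x (u i)))
  simp only [mfderiv_symm_dchart he hx]
  -- `η` is a dependent function and `e.symm (e x) = x` is only a propositional equality, so the
  -- point is generalized and the vectors are read in the common model space `V`.
  have key : ∀ z, z = x → η z (fun i => (u i : V)) = η x u := by rintro z rfl; rfl
  exact (key _ (e.left_inv hx)).symm

namespace IsLocalExpr

variable {e : OpenPartialHomeomorph X V} {k : ℕ} {η : Form V X k} {loc : V → V [⋀^Fin k]→L[ℝ] ℝ}

theorem inChart_eq (he : e ∈ IsManifold.maximalAtlas 𝓘(ℝ, V) ∞ X) (h : IsLocalExpr e η loc)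
    {v : V} (hv : v ∈ e.target) : inChart e η v = loc v := by
  ext u
  have h1 := congrArg (fun a => a (fun i => mfderiv 𝓘(ℝ, V) 𝓘(ℝ, V) e.symm v (u i)))
    (h (e.symm v) (e.map_target hv))
  refine h1.trans ?_
  change loc (e (e.symm v)) (fun i => dchart e (e.symm v)
    (mfderiv 𝓘(ℝ, V) 𝓘(ℝ, V) e.symm v (u i))) = _
  simp only [dchart_mfderiv_symm he hv, e.right_inv hv]

theorem congr {loc' : V → V [⋀^Fin k]→L[ℝ] ℝ} (h : IsLocalExpr e η loc)
    (h' : EqOn loc loc' e.target) : IsLocalExpr e η loc' := by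
  intro x hx
  rw [h x hx, h' (e.map_source hx)]

/-- The change of the expression of a form under a change of charts. -/
theorem inChart_change {e' : OpenPartialHomeomorph X V}
    (he : e ∈ IsManifold.maximalAtlas 𝓘(ℝ, V) ∞ X)
    (he' : e' ∈ IsManifold.maximalAtlas 𝓘(ℝ, V) ∞ X) (h : IsLocalExpr e η loc)
    {v : V} (hv : v ∈ (e'.symm.trans e).source) :
    inChart e' η v = (loc (e (e'.symm v))).compContinuousLinearMap
      (fderiv ℝ (e ∘ e'.symm) v) := by
  have hv1 : v ∈ e'.target := by simpa using hv.1
  have hv2 : e'.symm v ∈ e.source := hv.2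
  ext u
  have h1 := congrArg (fun a => a (fun i => mfderiv 𝓘(ℝ, V) 𝓘(ℝ, V) e'.symm v (u i)))
    (h (e'.symm v) hv2)
  refine h1.trans ?_
  change loc (e (e'.symm v)) (fun i => dchart e (e'.symm v)
    (mfderiv 𝓘(ℝ, V) 𝓘(ℝ, V) e'.symm v (u i))) = _
  refine congrArg (loc (e (e'.symm v))) (funext fun i => ?_)
  have h2 : fderiv ℝ (e ∘ e'.symm) v = mfderiv 𝓘(ℝ, V) 𝓘(ℝ, V) (e ∘ e'.symm) v :=
    mfderiv_eq_fderiv.symm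
  rw [h2, mfderiv_comp v (mdifferentiableAt_chart he hv2)
    (mdifferentiableAt_chart_symm he' hv1)]
  rfl

theorem contDiffOn_change {e' : OpenPartialHomeomorph X V}
    (he : e ∈ IsManifold.maximalAtlas 𝓘(ℝ, V) ∞ X)
    (he' : e' ∈ IsManifold.maximalAtlas 𝓘(ℝ, V) ∞ X) :
    ContDiffOn ℝ ∞ (e ∘ e'.symm) (e'.symm.trans e).source :=
  contMDiffOn_iff_contDiffOn.1 ((contMDiffOn_of_mem_maximalAtlas he).comp
    ((contMDiffOn_symm_of_mem_maximalAtlas he').mono (by intro u hu; simp at hu; exact hu.1))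
    (by intro u hu; simp at hu; exact hu.2))

/-- The exterior derivative may be computed in any chart. -/
theorem extD (he : e ∈ IsManifold.maximalAtlas 𝓘(ℝ, V) ∞ X) (h : IsLocalExpr e η loc)
    (hl : DifferentiableOn ℝ loc e.target) : IsLocalExpr e (extD η) (extDeriv loc) := by
  intro x hx
  set e' := chartAt V x
  have he' : e' ∈ IsManifold.maximalAtlas 𝓘(ℝ, V) ∞ X := IsManifold.chart_mem_maximalAtlas x
  have hx' : x ∈ e'.source := mem_chart_source V x
  have hsrc : e' x ∈ (e'.symm.trans e).source := by
    refine ⟨by simpa using e'.map_source hx', ?_⟩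
    change e'.symm (e' x) ∈ e.source
    rwa [e'.left_inv hx']
  have hx1 : e (e'.symm (e' x)) = e x := by rw [e'.left_inv hx']
  -- `extD` is defined through the preferred chart `e'` at `x`. There the form is the pull-back of
  -- `loc` along the transition map, and the exterior derivative commutes with pull-backs.
  have h1 : inChart e' η =ᶠ[𝓝 (e' x)] fun v => (loc ((e ∘ e'.symm) v)).compContinuousLinearMap
      (fderiv ℝ (e ∘ e'.symm) v) := by
    filter_upwards [(e'.symm.trans e).open_source.mem_nhds hsrc] with v hv
      using h.inChart_change he he' hv
  have hd : ContDiffAt ℝ ∞ (e ∘ e'.symm) (e' x) :=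
    (contDiffOn_change he he').contDiffAt ((e'.symm.trans e).open_source.mem_nhds hsrc)
  have h2 : extDeriv (inChart e' η) (e' x) = (extDeriv loc (e x)).compContinuousLinearMap
      (fderiv ℝ (e ∘ e'.symm) (e' x)) := by
    rw [h1.extDeriv_eq, extDeriv_pullback (r := ∞) ?_ hd
      (by simpa using ENat.LEInfty.out (m := 2)), Function.comp_apply, hx1]
    rw [Function.comp_apply, hx1]
    exact hl.differentiableAt (e.open_target.mem_nhds (e.map_source hx))
  ext u
  change extDeriv (inChart e' η) (e' x) (fun i => dchart e' x (u i)) = _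
  rw [h2]
  refine congrArg (extDeriv loc (e x)) (funext fun i => ?_)
  -- The transition map is the identity of `X` written in the charts `e'` and `e`, so its derivative
  -- intertwines the two tangent maps.
  have h3 := dchart_mfderiv_of_eventually he' he (f := id) (F := e ∘ e'.symm) hx' ?_
    (hd.differentiableAt (by simp)) (u i)
  · rw [mfderiv_id] at h3
    exact h3.symm
  · filter_upwards [e.open_source.mem_nhds hx, e'.open_source.mem_nhds hx'] with z hz hz'
    exact ⟨hz, by simp [e'.left_inv hz']⟩

theorem pullback {e' : OpenPartialHomeomorph X' V'} {k : ℕ} {η : Form V' X' k}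
    {loc : V' → V' [⋀^Fin k]→L[ℝ] ℝ} {f : X → X'} {F : V → V'}
    (he : e ∈ IsManifold.maximalAtlas 𝓘(ℝ, V) ∞ X)
    (he' : e' ∈ IsManifold.maximalAtlas 𝓘(ℝ, V') ∞ X')
    (h : IsLocalExpr e' η loc) (hf : IsLocalRep e e' f F) :
    IsLocalExpr e (pullback f η)
      (fun v => (loc (F v)).compContinuousLinearMap (fderiv ℝ F v)) := by
  intro x hx
  ext u
  have h1 := congrArg (fun a => a (fun i => mfderiv 𝓘(ℝ, V) 𝓘(ℝ, V') f x (u i)))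
    (h (f x) (hf.mapsTo x hx))
  refine h1.trans ?_
  change loc (e' (f x)) (fun i => dchart e' (f x) (mfderiv 𝓘(ℝ, V) 𝓘(ℝ, V') f x (u i))) =
    loc (F (e x)) (fun i => fderiv ℝ F (e x) (dchart e x (u i)))
  simp only [hf.dchart_mfderiv he he' hx, hf.eq x hx]

end IsLocalExpr

theorem isSmooth_of_localExpr {k : ℕ} {η : Form V X k}
    (h : ∀ x : X, ∃ loc, IsLocalExpr (chartAt V x) η loc ∧ ContDiffOn ℝ ∞ loc (chartAt V x).target) :
    IsSmooth η := by
  intro x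
  obtain ⟨loc, h1, h2⟩ := h x
  exact h2.congr fun v hv => h1.inChart_eq (IsManifold.chart_mem_maximalAtlas x) hv

/-- `IsSmooth` tests the preferred charts only. Any other chart differs from these by transition
maps, and the pull-back of a form along a linear map is smooth jointly in both. -/
theorem IsSmooth.contDiffOn_inChart [FiniteDimensional ℝ V] {k : ℕ} {η : Form V X k}
    (hη : IsSmooth η) {e : OpenPartialHomeomorph X V}
    (he : e ∈ IsManifold.maximalAtlas 𝓘(ℝ, V) ∞ X) : ContDiffOn ℝ ∞ (inChart e η) e.target := by
  intro v hv
  set e' := chartAt V (e.symm v)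
  have he' : e' ∈ IsManifold.maximalAtlas 𝓘(ℝ, V) ∞ X := IsManifold.chart_mem_maximalAtlas _
  have hsrc : v ∈ (e.symm.trans e').source :=
    ⟨by simpa using hv, mem_chart_source V (e.symm v)⟩
  have hopen := (e.symm.trans e').open_source
  have hd := IsLocalExpr.contDiffOn_change he' he
  have h1 : ContDiffOn ℝ ∞ (fun v => (inChart e' η ((e' ∘ e.symm) v)).compContinuousLinearMap
      (fderiv ℝ (e' ∘ e.symm) v)) (e.symm.trans e').source := by
    refine (contDiff_altPullback V V k).comp_contDiffOn (ContDiffOn.prodMk ?_ ?_)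
    · refine (hη (e.symm v)).comp hd ?_
      intro z hz
      exact e'.map_source hz.2
    · exact hd.fderiv_of_isOpen hopen (by simp)
  refine ((h1.contDiffAt (hopen.mem_nhds hsrc)).congr_of_eventuallyEq ?_).contDiffWithinAt
  filter_upwards [hopen.mem_nhds hsrc] with z hz
    using (isLocalExpr_inChart he' η).inChart_change he' he hz

end LocalExpressions

/-! ### Alternating forms of degree $m-1$, $m$ and $m+1$ on $\mathbb R^m$; jets and momenta -/

section FormAlgebra

variable {d n : ℕ}

/-- The standard frame `∂/∂x^μ`. -/
def frame (d : ℕ) (μ : Fin (d + 1)) : Base d := Pi.single μ 1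

/-- The standard frame without `∂/∂x^μ`. -/
def coframe (μ : Fin (d + 1)) (j : Fin d) : Base d := Pi.single (μ.succAbove j) 1

theorem removeNth_frame (μ : Fin (d + 1)) : μ.removeNth (frame d) = coframe μ := rfl

theorem stdVol_frame : stdVol d (frame d) = 1 := by
  change Matrix.det (Matrix.of (frame d)) = 1
  have : Matrix.of (frame d) = 1 := by
    ext i j
    simp [frame, Matrix.one_apply, Pi.single_apply, eq_comm]
  rw [this, Matrix.det_one]

/-- Every form of top degree is a multiple of the determinant, the factor being its value on the
standard frame. -/
theorem top_ext {β β' : Base d [⋀^Fin (d + 1)]→L[ℝ] ℝ} (h : β (frame d) = β' (frame d)) :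
    β = β' := by
  have h1 : ∀ γ : Base d [⋀^Fin (d + 1)]→L[ℝ] ℝ, γ.toAlternatingMap =
      γ (frame d) • (Pi.basisFun ℝ (Fin (d + 1))).det := by
    intro γ
    have hb : (Pi.basisFun ℝ (Fin (d + 1)) : Fin (d + 1) → Base d) = frame d :=
      funext fun i => by simp [frame]
    have := γ.toAlternatingMap.eq_smul_basis_det (Pi.basisFun ℝ (Fin (d + 1)))
    rw [hb] at this
    exact this
  apply ContinuousAlternatingMap.toAlternatingMap_injective
  rw [h1 β, h1 β', h]

theorem top_eq_smul_stdVol (β : Base d [⋀^Fin (d + 1)]→L[ℝ] ℝ) :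
    β = β (frame d) • stdVol d :=
  top_ext (by simp [stdVol_frame])

theorem frame_ne_zero {β : Base d [⋀^Fin (d + 1)]→L[ℝ] ℝ} (h : β ≠ 0) : β (frame d) ≠ 0 :=
  fun h0 => h (top_ext (by simpa using h0))

/-- Only families of distinct basis vectors matter. Such a family of $m-1$ vectors omits a single
index `μ`, so it is a permutation of `coframe μ`. -/
theorem form_ext {s s' : Base d [⋀^Fin d]→L[ℝ] ℝ} (h : ∀ μ, s (coframe μ) = s' (coframe μ)) :
    s = s' := by
  apply ContinuousAlternatingMap.toAlternatingMap_injective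
  refine Module.Basis.ext_alternating (Pi.basisFun ℝ (Fin (d + 1))) fun v hv => ?_
  obtain ⟨μ, hμ⟩ : ∃ μ, μ ∉ Set.range v := by
    by_contra! hc
    have := Fintype.card_le_of_surjective v hc
    simp at this
  have : ∀ i, ∃ j, μ.succAbove j = v i := fun i =>
    Fin.exists_succAbove_eq (fun e => hμ ⟨i, e⟩)
  choose p hp using this
  have hpinj : Function.Injective p := by
    intro i j e
    apply hv
    rw [← hp, ← hp, e]
  let σ : Equiv.Perm (Fin d) := Equiv.ofBijective p (Finite.injective_iff_bijective.1 hpinj)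
  have e : (fun i => (Pi.basisFun ℝ (Fin (d + 1))) (v i)) = coframe μ ∘ σ := by
    funext i
    simp [coframe, σ, hp]
  rw [e, AlternatingMap.map_perm, AlternatingMap.map_perm]
  exact congrArg _ (h μ)

theorem form_eq_zero_of_card_lt (β : Base d [⋀^Fin (d + 2)]→L[ℝ] ℝ) : β = 0 := by
  apply ContinuousAlternatingMap.toAlternatingMap_injective
  refine Module.Basis.ext_alternating (Pi.basisFun ℝ (Fin (d + 1))) fun v hv => ?_
  have := Fintype.card_le_of_injective v hv
  simp at this

/-- The form $\sigma\wedge\beta$ has degree $m+1$ on a space of dimension $m$, so it vanishes. Its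
contraction with $v$ is $\sigma(v)\beta-\sigma\wedge i_v\beta$. -/
theorem wedge_interior (σ : Base d →L[ℝ] ℝ) (v : Base d) (β : Base d [⋀^Fin (d + 1)]→L[ℝ] ℝ) :
    wedge σ (interior v β) = σ v • β := by
  ext u
  have h := congrArg (fun a => a (Matrix.vecCons v u)) (form_eq_zero_of_card_lt (wedge σ β))
  have h : wedge σ β (Matrix.vecCons v u) = 0 := h
  rw [wedge_apply, Fin.sum_univ_succ] at h
  have e0 : (0 : Fin (d + 2)).removeNth (Matrix.vecCons v u) = u := by
    funext j; simp [Fin.removeNth]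
  have e1 : ∀ i : Fin (d + 1), i.succ.removeNth (Matrix.vecCons v u) =
      Matrix.vecCons v (i.removeNth u) := by
    intro i
    funext j
    refine Fin.cases ?_ (fun j => ?_) j <;> simp [Fin.removeNth]
  simp only [e0, e1, Matrix.cons_val_zero, Matrix.cons_val_succ, Fin.val_zero, pow_zero, one_smul,
    Fin.val_succ, pow_succ] at h
  rw [wedge_apply]
  have h2 : ∑ i : Fin (d + 1), (-1 : ℤ) ^ (i : ℕ) • (σ (u i) * interior v β (i.removeNth u)) =
      -∑ i : Fin (d + 1), ((-1 : ℤ) ^ (i : ℕ) * -1) •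
        (σ (u i) * β (Matrix.vecCons v (i.removeNth u))) := by
    rw [← Finset.sum_neg_distrib]
    refine Finset.sum_congr rfl fun i _ => ?_
    rw [interior_apply, mul_neg_one, neg_smul, neg_neg]
  rw [h2]
  change _ = σ v * β u
  linarith

theorem wedge_proj_frame (μ : Fin (d + 1)) (s : Base d [⋀^Fin d]→L[ℝ] ℝ) :
    wedge (ContinuousLinearMap.proj (R := ℝ) (φ := fun _ : Fin (d + 1) => ℝ) μ) s (frame d) =
      (-1) ^ (μ : ℕ) * s (coframe μ) := by
  rw [wedge_apply, Finset.sum_eq_single μ]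
  · simp [frame, removeNth_frame, ← smul_eq_mul, ← Int.cast_smul_eq_zsmul ℝ]
  · intro i _ hi
    simp [frame, hi]
  · simp

/-- Evaluate $dx^\mu\wedge i_vd^mx=v^\mu d^mx$ on the frame. The coordinate $s^\mu$ of an
$(m-1)$-form $s$ is therefore $(-1)^\mu$ times its value on `coframe μ`. -/
theorem interior_coframe (v : Base d) (μ : Fin (d + 1)) :
    (-1) ^ (μ : ℕ) * interior v (stdVol d) (coframe μ) = v μ := by
  rw [← wedge_proj_frame, wedge_interior]
  simp [stdVol_frame]

/-- If $i_v\beta=0$, then `wedge_interior` with $\sigma=dx^\mu$ gives $v^\mu\beta=0$ for each $\mu$.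
-/
theorem eq_zero_of_interior {β : Base d [⋀^Fin (d + 1)]→L[ℝ] ℝ} (hβ : β ≠ 0) {v : Base d}
    (h : interior v β = 0) : v = 0 := by
  funext μ
  have h1 := wedge_interior (ContinuousLinearMap.proj (R := ℝ) (φ := fun _ => ℝ) μ) v β
  have h2 := congrArg (fun a => a (frame d)) h1
  rw [h] at h2
  have h3 : (0 : ℝ) = v μ * β (frame d) := by
    rw [← show _ = v μ * β (frame d) from h2.symm.symm, wedge_apply]
    simp
  simpa [frame_ne_zero hβ] using h3.symm

theorem exists_interior (s : ActMdl d) : ∃ v : Base d, s = interior v (stdVol d) := by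
  refine ⟨fun μ => (-1) ^ (μ : ℕ) * s (coframe μ), form_ext fun μ => ?_⟩
  have h := interior_coframe (d := d) (fun μ => (-1) ^ (μ : ℕ) * s (coframe μ)) μ
  have h1 : ((-1 : ℝ) ^ (μ : ℕ)) ≠ 0 := by positivity
  exact (mul_left_cancel₀ h1 h).symm

theorem interior_add {T : Type*} [AddCommGroup T] [Module ℝ T] [TopologicalSpace T] {k : ℕ}
    (α : T [⋀^Fin (k + 1)]→L[ℝ] ℝ) (v w : T) :
    interior (v + w) α = interior v α + interior w α := by
  ext u
  exact α.toMultilinearMap.cons_add u v w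

theorem interior_smul {T : Type*} [AddCommGroup T] [Module ℝ T] [TopologicalSpace T] {k : ℕ}
    (α : T [⋀^Fin (k + 1)]→L[ℝ] ℝ) (r : ℝ) (v : T) :
    interior (r • v) α = r • interior v α := by
  ext u
  exact α.toMultilinearMap.cons_smul u r v

/-- `v ↦ i_v d^m x` as an isomorphism. -/
def interiorEquiv (d : ℕ) : Base d ≃ₗ[ℝ] ActMdl d :=
  LinearEquiv.ofBijective
    { toFun := fun v => interior v (stdVol d)
      map_add' := fun v w => interior_add _ v w
      map_smul' := fun r v => interior_smul _ r v }
    ⟨(injective_iff_map_eq_zero _).2 fun v hv => eq_zero_of_interior (β := stdVol d)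
      (fun h => by simpa [h] using stdVol_frame (d := d)) hv,
    fun s => (exists_interior s).imp fun _ h => h.symm⟩

theorem finrank_actMdl : Module.finrank ℝ (ActMdl d) = d + 1 := by
  rw [← (interiorEquiv d).finrank_eq]
  simp

theorem finrank_jetMdl : Module.finrank ℝ (JetMdl d n) = n * (d + 1) := by
  rw [← (LinearMap.toContinuousLinearMap (𝕜 := ℝ) (E := Base d)
    (F' := Fin n → ℝ)).finrank_eq, Module.finrank_linearMap]
  simp [mul_comm]

/-- The jet whose only non-zero coordinate is `y^A_μ = 1`. -/
def jetUnit (μ : Fin (d + 1)) (A : Fin n) : JetMdl d n :=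
  (ContinuousLinearMap.proj (R := ℝ) (φ := fun _ : Fin (d + 1) => ℝ) μ).smulRight
    (Pi.single A (1 : ℝ) : Fin n → ℝ)

theorem jet_eq_sum (Γ : JetMdl d n) :
    Γ = ∑ μ : Fin (d + 1), ∑ A : Fin n, Γ (frame d μ) A • jetUnit μ A := by
  refine ContinuousLinearMap.ext fun u => funext fun A => ?_
  have h := congrFun (LinearMap.pi_apply_eq_sum_univ (Γ : Base d →ₗ[ℝ] (Fin n → ℝ)) u) A
  have hs : ∀ μ : Fin (d + 1), (fun j => if μ = j then (1 : ℝ) else 0) = frame d μ := by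
    intro μ
    funext j
    simp [frame, Pi.single_apply, eq_comm]
  simp only [hs, Finset.sum_apply, Pi.smul_apply, smul_eq_mul] at h
  refine h.trans ?_
  simp only [sum_apply, smul_apply, Finset.sum_apply, Pi.smul_apply, smul_eq_mul, jetUnit]
  refine Finset.sum_congr rfl fun μ _ => ?_
  rw [Finset.sum_eq_single A]
  · simp [mul_comm]
  · intro B _ hB
    simp [hB.symm]
  · simp

theorem jet_hom_eq_zero_iff {W : Type*} [AddCommGroup W] [Module ℝ W] (T : JetMdl d n →ₗ[ℝ] W) :
    T = 0 ↔ ∀ μ A, T (jetUnit μ A) = 0 := by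
  refine ⟨fun h μ A => by rw [h]; rfl, fun h => LinearMap.ext fun Γ => ?_⟩
  rw [jet_eq_sum Γ]
  simp [map_sum, h]

/-- The value `p^μ_A y^A_μ d^m x` of the coupling form, in coordinates. -/
def pairing (Γ : JetMdl d n) (P : MomMdl d n) : Base d [⋀^Fin (d + 1)]→L[ℝ] ℝ :=
  (ofVer P).compContinuousLinearMap ((ContinuousLinearMap.id ℝ (Base d)).prod Γ)

theorem pairing_apply (Γ : JetMdl d n) (P : MomMdl d n) (u : Fin (d + 1) → Base d) :
    pairing Γ P u = ∑ i : Fin (d + 1), (-1 : ℤ) ^ (i : ℕ) • P (Γ (u i)) (i.removeNth u) := by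
  change ofVer P (fun i => (u i, Γ (u i))) = _
  rw [ofVer_apply]
  rfl

/-- Pairing with the unit jet turns a momentum into $dx^\mu\wedge P(\partial/\partial y^A)$, whose
coefficient is $p^\mu_A$. The momentum coordinates can thus be read off by pairing with the unit
jets. -/
theorem pairing_jetUnit (μ : Fin (d + 1)) (A : Fin n) (P : MomMdl d n) :
    pairing (jetUnit μ A) P (frame d) = (-1) ^ (μ : ℕ) * P (Pi.single A 1) (coframe μ) := by
  rw [← wedge_proj_frame, pairing_apply, wedge_apply]
  refine Finset.sum_congr rfl fun i _ => ?_
  simp [jetUnit]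

/-- The pairing as a bilinear map. -/
def pairingLin (d n : ℕ) : JetMdl d n →ₗ[ℝ] MomMdl d n →ₗ[ℝ] Base d [⋀^Fin (d + 1)]→L[ℝ] ℝ :=
  LinearMap.mk₂ ℝ pairing
    (fun Γ Γ' P => by ext u; simp [pairing_apply, Finset.sum_add_distrib])
    (fun r Γ P => by
      ext u
      simp only [pairing_apply, ContinuousAlternatingMap.smul_apply, Finset.smul_sum,
        _root_.smul_apply, map_smul]
      exact Finset.sum_congr rfl fun i _ => smul_comm _ _ _)
    (fun Γ P P' => by ext u; simp [pairing_apply, Finset.sum_add_distrib])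
    (fun r Γ P => by
      ext u
      simp only [pairing_apply, ContinuousAlternatingMap.smul_apply, Finset.smul_sum,
        _root_.smul_apply]
      exact Finset.sum_congr rfl fun i _ => smul_comm _ _ _)

theorem contDiff_pairing : ContDiff ℝ ∞ (fun q : JetMdl d n × MomMdl d n => pairing q.1 q.2) :=
  (contDiff_altPullback (Base d) (Mdl d n) (d + 1)).comp
    ((contDiff_ofVer.comp contDiff_snd).prodMk (contDiff_graph.comp contDiff_fst))

/-- Momenta with prescribed coordinates `p^μ_A`. -/
theorem exists_momentum (p : Fin (d + 1) → Fin n → ℝ) : ∃ P : MomMdl d n,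
    ∀ μ A, pairing (jetUnit μ A) P (frame d) = p μ A := by
  -- `C` sends $\partial/\partial y^A$ to the vector $(p^\mu_A)_\mu$ of the base, which
  -- `interiorEquiv` turns into $p^\mu_A\,d^{m-1}x_\mu$.
  let C : (Fin n → ℝ) →ₗ[ℝ] Base d := LinearMap.pi fun μ => Fintype.linearCombination ℝ (p μ)
  refine ⟨LinearMap.toContinuousLinearMap ((interiorEquiv d).toLinearMap ∘ₗ C), fun μ A => ?_⟩
  rw [pairing_jetUnit]
  change (-1) ^ (μ : ℕ) * interior (C (Pi.single A 1)) (stdVol d) (coframe μ) = p μ A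
  rw [interior_coframe]
  simp [C, Fintype.linearCombination_apply, Pi.single_apply]

end FormAlgebra

/-! ### Linear model of $\Theta_\circ$ and $d\Theta_\circ$ at a point -/

section HamiltonianModel

variable {d n : ℕ}

/-- The value of `-p^μ_A dy^A ∧ d^{m-1}x_μ - p d^m x + ds^μ ∧ d^{m-1}x_μ`. -/
def thetaVal (X : ExtMomMdl d n) (u : Fin (d + 1) → HamMdl d n) : ℝ :=
  ∑ i : Fin (d + 1), (-1 : ℤ) ^ (i : ℕ) •
    ((u i).2.2.2 - X.1 (u i).1.2) (fun j => (i.removeNth u j).1.1) - X.2 (fun i => (u i).1.1)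

/-- The value of `-dp^μ_A ∧ dy^A ∧ d^{m-1}x_μ - dp ∧ d^m x`, where `D` is the differential
of `p`. -/
def dthetaVal (D : HamMdl d n →ₗ[ℝ] Base d [⋀^Fin (d + 1)]→L[ℝ] ℝ)
    (u : Fin (d + 2) → HamMdl d n) : ℝ :=
  -∑ i : Fin (d + 2), (-1 : ℤ) ^ (i : ℕ) •
    ofParts d n ((u i).2.2.1, D (u i)) (fun j => (i.removeNth u j).1)

theorem removeNth_zero_vecCons {α : Type*} {k : ℕ} (R : α) (u : Fin k → α) :
    (0 : Fin (k + 1)).removeNth (Matrix.vecCons R u) = u := by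
  funext j; simp [Fin.removeNth]

theorem removeNth_succ_vecCons {α : Type*} {k : ℕ} (R : α) (u : Fin (k + 1) → α)
    (i : Fin (k + 1)) : i.succ.removeNth (Matrix.vecCons R u) =
      Matrix.vecCons R (i.removeNth u) := by
  funext j
  refine Fin.cases ?_ (fun j => ?_) j <;> simp [Fin.removeNth]

theorem exists_removeNth_succ_vecCons {α : Type*} {k : ℕ} (R : α) (u : Fin k → α) (i : Fin k) :
    ∃ l, i.succ.removeNth (Matrix.vecCons R u) l = R := by
  obtain ⟨l, hl⟩ := Fin.exists_succAbove_eq (Fin.succ_ne_zero i).symm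
  exact ⟨l, by simp [Fin.removeNth, hl]⟩

theorem comp_vecCons {α β : Type*} {k : ℕ} (f : α → β) (R : α) (u : Fin k → α) :
    (fun i => f ((Matrix.vecCons R u : Fin (k + 1) → α) i)) =
      Matrix.vecCons (f R) (fun i => f (u i)) := by
  funext i
  refine Fin.cases ?_ (fun i => ?_) i <;> simp

theorem ofParts_apply (X : ExtMomMdl d n) (u : Fin (d + 1) → Mdl d n) :
    ofParts d n X u = ∑ i : Fin (d + 1), (-1 : ℤ) ^ (i : ℕ) •
      X.1 (u i).2 (fun j => (i.removeNth u j).1) + X.2 (fun i => (u i).1) := by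
  change ofVer X.1 u + ofHor X.2 u = _
  rw [ofVer_apply]
  rfl

/-- All terms but the one in which `R` feeds the momentum have `R` among the arguments of a form on
the base, where its component is zero. The same mechanism gives `thetaVal_vecCons`. -/
theorem ofParts_vecCons (X : ExtMomMdl d n) {R : Mdl d n} (hR : R.1 = 0)
    (w : Fin d → Mdl d n) :
    ofParts d n X (Matrix.vecCons R w) = X.1 R.2 (fun j => (w j).1) := by
  rw [ofParts_apply, Fin.sum_univ_succ, X.2.map_coord_zero 0 hR, Finset.sum_eq_zero]
  · simp [Fin.removeNth]
  · intro i _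
    obtain ⟨l, hl⟩ := exists_removeNth_succ_vecCons R w i
    rw [ContinuousAlternatingMap.map_coord_zero _ l (by rw [hl, hR]), smul_zero]

variable (X : ExtMomMdl d n) (D : HamMdl d n →ₗ[ℝ] Base d [⋀^Fin (d + 1)]→L[ℝ] ℝ)

theorem thetaVal_vecCons {R : HamMdl d n} (hR : R.1.1 = 0) (u : Fin d → HamMdl d n) :
    thetaVal X (Matrix.vecCons R u) = (R.2.2.2 - X.1 R.1.2) (fun j => (u j).1.1) := by
  rw [thetaVal, Fin.sum_univ_succ, X.2.map_coord_zero 0 hR, Finset.sum_eq_zero]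
  · simp [Fin.removeNth]
  · intro i _
    obtain ⟨l, hl⟩ := exists_removeNth_succ_vecCons R u i
    rw [ContinuousAlternatingMap.map_coord_zero _ l (by rw [hl, hR]), smul_zero]

/-- In the term of index `0` the form is differentiated along `R`, which leaves the momentum part of
`R` and `D R`. In the others `R` is the first argument, and by `ofParts_vecCons` the momentum part
of `u i` is evaluated on the fibre component of `R`. -/
theorem dthetaVal_vecCons {R : HamMdl d n} (hR : R.1.1 = 0) (u : Fin (d + 1) → HamMdl d n) :
    dthetaVal D (Matrix.vecCons R u) = ∑ i : Fin (d + 1), (-1 : ℤ) ^ (i : ℕ) •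
      ((u i).2.2.1 R.1.2 (fun j => (i.removeNth u j).1.1) -
        R.2.2.1 (u i).1.2 (fun j => (i.removeNth u j).1.1)) - D R (fun i => (u i).1.1) := by
  rw [dthetaVal, Fin.sum_univ_succ]
  simp only [removeNth_zero_vecCons, removeNth_succ_vecCons, comp_vecCons (Prod.fst),
    Matrix.cons_val_zero, Matrix.cons_val_succ, ofParts_vecCons _ hR, Fin.val_zero, pow_zero,
    one_smul, Fin.val_succ, pow_succ, mul_neg_one, neg_smul, Finset.sum_neg_distrib]
  rw [ofParts_apply]
  simp only [smul_sub, Finset.sum_sub_distrib]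
  change -(∑ i : Fin (d + 1), (-1 : ℤ) ^ (i : ℕ) • R.2.2.1 (u i).1.2
    (fun j => (i.removeNth u j).1.1) + D R (fun i => (u i).1.1) + _) = _
  ring

/-- The condition that defines the Reeb distribution, in coordinates. -/
theorem ann_dthetaVal_iff {R : HamMdl d n} (hR : R.1.1 = 0) :
    (∀ u : Fin (d + 1) → HamMdl d n, (∃ i, (u i).1.1 = 0) →
      dthetaVal D (Matrix.vecCons R u) = 0) ↔ R.1.2 = 0 ∧ R.2.2.1 = 0 := by
  constructor
  · intro h
    -- The test family consists of one vertical vector `U` and horizontal vectors `w`. Every term in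
    -- which `U` is an argument of a base form drops out, which leaves a pairing between the $y$ and
    -- $p$ components of `R` and `U`.
    have key : ∀ (U : HamMdl d n) (w : Fin d → Base d), U.1.1 = 0 →
        U.2.2.1 R.1.2 w = R.2.2.1 U.1.2 w := by
      intro U w hU
      have h1 := h (Matrix.vecCons U (fun j => ((w j, 0), 0))) ⟨0, by simpa using hU⟩
      rw [dthetaVal_vecCons D hR, (D R).map_coord_zero 0 hU, Fin.sum_univ_succ,
        Finset.sum_eq_zero] at h1
      · simp only [removeNth_zero_vecCons, Matrix.cons_val_zero, Fin.val_zero, pow_zero,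
          one_smul, add_zero, sub_zero] at h1
        exact sub_eq_zero.1 h1
      · intro i _
        obtain ⟨l, hl⟩ := exists_removeNth_succ_vecCons U
          (fun j => (((w j, 0), 0) : HamMdl d n)) i
        rw [ContinuousAlternatingMap.map_coord_zero _ l (by rw [hl, hU]),
          ContinuousAlternatingMap.map_coord_zero _ l (by rw [hl, hU]), sub_zero, smul_zero]
    constructor
    · funext A
      -- A vector `U` whose only component is the momentum $y\mapsto y^A\,d^{m-1}x_0$ detects the
      -- component $R(y^A)$; below, a `U` along the fibre of $E$ detects the momentum part of `R`.
      let P : MomMdl d n := (ContinuousLinearMap.proj (R := ℝ) (φ := fun _ : Fin n => ℝ) A).smulRight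
        (interior (frame d 0) (stdVol d))
      have h1 : R.1.2 A * interior (frame d 0) (stdVol d) (coframe 0) = 0 :=
        (key (((0, 0), (0, (P, 0))) : HamMdl d n) (coframe 0) rfl).trans
          (congrArg (fun a => a (coframe 0)) (map_zero R.2.2.1))
      have h3 := interior_coframe (d := d) (frame d 0) 0
      simp only [Fin.val_zero, pow_zero, one_mul] at h3
      rw [h3] at h1
      simpa [frame] using h1
    · ext y w
      exact (key (((0, y), 0) : HamMdl d n) w rfl).symm
  · rintro ⟨h1, h2⟩ u ⟨i, hi⟩
    rw [dthetaVal_vecCons D hR, h1, h2, (D R).map_coord_zero i hi]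
    simp

theorem dthetaVal_vecCons_reeb {R : HamMdl d n} (h1 : R.1 = 0) (h3 : R.2.2.1 = 0)
    (u : Fin (d + 1) → HamMdl d n) :
    dthetaVal D (Matrix.vecCons R u) = -D R (fun i => (u i).1.1) := by
  rw [dthetaVal_vecCons D (by rw [h1]; rfl), h1, h3]
  simp

theorem dthetaVal_reeb_eq_zero_iff {R : HamMdl d n} (h1 : R.1 = 0) (h3 : R.2.2.1 = 0) :
    (∀ u, dthetaVal D (Matrix.vecCons R u) = 0) ↔ D R = 0 := by
  simp only [dthetaVal_vecCons_reeb D h1 h3, neg_eq_zero]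
  refine ⟨fun h => ContinuousAlternatingMap.ext fun u => ?_, fun h u => by rw [h]; rfl⟩
  exact h (fun i => ((u i, 0), 0))

/-- The characteristic distribution, in coordinates. -/
theorem characteristic_iff {R : HamMdl d n} :
    (R.1.1 = 0 ∧ (∀ u, thetaVal X (Matrix.vecCons R u) = 0) ∧
      (∀ u, dthetaVal D (Matrix.vecCons R u) = 0)) ↔
        ∃ Γ : JetMdl d n, D (0, (Γ, 0)) = 0 ∧ (0, (Γ, 0)) = R := by
  constructor
  · rintro ⟨h1, h2, h3⟩
    obtain ⟨h4, h5⟩ := (ann_dthetaVal_iff D h1).1 fun u _ => h3 u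
    have h6 : R.2.2.2 = 0 := by
      ext u
      have := h2 (fun j => ((u j, 0), 0))
      rw [thetaVal_vecCons X h1, h4] at this
      simpa using this
    have hR : R = (0, (R.2.1, 0)) :=
      Prod.ext (Prod.ext h1 h4) (Prod.ext rfl (Prod.ext h5 h6))
    exact ⟨R.2.1, hR ▸ (dthetaVal_reeb_eq_zero_iff D (Prod.ext h1 h4) h5).1 h3, hR.symm⟩
  · rintro ⟨Γ, h, rfl⟩
    refine ⟨rfl, fun u => ?_, (dthetaVal_reeb_eq_zero_iff D rfl rfl).2 h⟩
    rw [thetaVal_vecCons X rfl]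
    simp

/-- A linear automorphism that brings `Θ₀` at a point into a normal form. -/
def shear : HamMdl d n ≃ₗ[ℝ] HamMdl d n :=
  -- This absorbs both $p^\mu_A\,dy^A\wedge d^{m-1}x_\mu$ and $p\,d^mx$ into $ds^\mu\wedge
  -- d^{m-1}x_\mu$. The factor $1/m$ is there because antisymmetrizing $v\mapsto i_v\beta$ gives
  -- back the $m$-form $\beta$ multiplied by $m$.
  let f : HamMdl d n → ActMdl d := fun u =>
    X.1 u.1.2 + ((d + 1 : ℝ)⁻¹) • interior u.1.1 X.2
  have hadd : ∀ u v, f (u + v) = f u + f v := by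
    intro u v
    simp only [f, Prod.fst_add, Prod.snd_add, map_add, interior_add, smul_add]
    abel
  have hsmul : ∀ (r : ℝ) u, f (r • u) = r • f u := by
    intro r u
    simp only [f, Prod.smul_fst, Prod.smul_snd, map_smul, interior_smul, smul_add]
    rw [smul_comm]
  { toFun := fun u => (u.1, (u.2.1, (u.2.2.1, u.2.2.2 - f u)))
    invFun := fun u => (u.1, (u.2.1, (u.2.2.1, u.2.2.2 + f u)))
    map_add' := fun u v => by
      refine Prod.ext rfl (Prod.ext rfl (Prod.ext rfl ?_))
      simp only [hadd, Prod.snd_add]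
      abel
    map_smul' := fun r u => by
      refine Prod.ext rfl (Prod.ext rfl (Prod.ext rfl ?_))
      simp only [hsmul, Prod.smul_snd, RingHom.id_apply, smul_sub]
    left_inv := fun u => Prod.ext rfl (Prod.ext rfl (Prod.ext rfl (sub_add_cancel _ _)))
    right_inv := fun u => Prod.ext rfl (Prod.ext rfl (Prod.ext rfl (add_sub_cancel_right _ _))) }

/-- The normal form `thetaVal 0` is $ds^\mu\wedge d^{m-1}x_\mu$ and no longer depends on the point.
This is the source of the constant rank of $\ker\Theta_\circ$. -/
theorem thetaVal_shear (u : Fin (d + 1) → HamMdl d n) :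
    thetaVal 0 (fun i => shear X (u i)) = thetaVal X u := by
  have h := congrArg (fun a => a (fun i => (u i).1.1))
    (ContinuousAlternatingMap.alternatizeUncurryFin_curryLeft X.2)
  simp only [ContinuousAlternatingMap.alternatizeUncurryFin_apply,
    ContinuousAlternatingMap.smul_apply] at h
  have h' : ∑ i : Fin (d + 1), (-1 : ℤ) ^ (i : ℕ) • interior (u i).1.1 X.2
      (fun j => (i.removeNth u j).1.1) = (d + 1 : ℝ) * X.2 (fun i => (u i).1.1) := by
    refine Eq.trans ?_ (h.trans (by simp))
    rfl
  have e : ∀ i, (shear X (u i)).2.2.2 - (0 : ExtMomMdl d n).1 (shear X (u i)).1.2 =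
      ((u i).2.2.2 - X.1 (u i).1.2) - ((d + 1 : ℝ)⁻¹) • interior (u i).1.1 X.2 := by
    intro i
    change (u i).2.2.2 - (X.1 (u i).1.2 + _) - 0 = _
    abel
  have e' : ∀ i : Fin (d + 1), (fun j => (i.removeNth (fun i => shear X (u i)) j).1.1) =
      fun j => (i.removeNth u j).1.1 := fun i => rfl
  have e2 : ∑ i : Fin (d + 1), (-1 : ℤ) ^ (i : ℕ) • (d + 1 : ℝ)⁻¹ • interior (u i).1.1 X.2
      (fun j => (i.removeNth u j).1.1) = X.2 (fun i => (u i).1.1) := by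
    have : ∀ i : Fin (d + 1), (-1 : ℤ) ^ (i : ℕ) • (d + 1 : ℝ)⁻¹ • interior (u i).1.1 X.2
        (fun j => (i.removeNth u j).1.1) = (d + 1 : ℝ)⁻¹ • ((-1 : ℤ) ^ (i : ℕ) •
          interior (u i).1.1 X.2 (fun j => (i.removeNth u j).1.1)) := fun i => smul_comm _ _ _
    simp only [this, ← Finset.smul_sum, h']
    have : (d + 1 : ℝ) ≠ 0 := by positivity
    rw [smul_eq_mul, inv_mul_cancel_left₀ this]
  simp only [thetaVal, e, e', ContinuousAlternatingMap.sub_apply,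
    ContinuousAlternatingMap.smul_apply, smul_sub, Finset.sum_sub_distrib]
  rw [← e2]
  simp

end HamiltonianModel

/-! ### Transfer of the linear model to tangent spaces -/

section HamiltonianTangent

variable {T T' : Type*} [AddCommGroup T] [Module ℝ T] [TopologicalSpace T]
  [AddCommGroup T'] [Module ℝ T'] [TopologicalSpace T']

theorem mem_formKer_iff {k : ℕ} {α : T [⋀^Fin (k + 1)]→L[ℝ] ℝ} {v : T} :
    v ∈ formKer α ↔ ∀ u, α (Matrix.vecCons v u) = 0 :=
  ⟨fun h u => congrArg (fun a => a u) (show interior v α = 0 from h),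
    fun h => show interior v α = 0 from ContinuousAlternatingMap.ext h⟩

theorem formKer_comp_equiv {k : ℕ}
    {α : T [⋀^Fin (k + 1)]→L[ℝ] ℝ} {α' : T' [⋀^Fin (k + 1)]→L[ℝ] ℝ} (A : T ≃ₗ[ℝ] T')
    (h : ∀ u, α u = α' (fun i => A (u i))) :
    formKer α = (formKer α').map (A.symm : T' →ₗ[ℝ] T) := by
  ext v
  rw [Submodule.mem_map_equiv, LinearEquiv.symm_symm, mem_formKer_iff, mem_formKer_iff]
  constructor
  · intro hv u
    have := hv (fun i => A.symm (u i))
    rw [h, comp_vecCons A] at this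
    simpa using this
  · intro hv u
    rw [h, comp_vecCons A]
    exact hv _

variable {d n : ℕ}

/-- In the linear coordinates `c`, the forms `θ`, `Ω` and `ωX` are the values of `Θ₀`, `dΘ₀`
and `ω` at a point, where `X` collects the momenta and `D` is the differential of `p`. -/
structure IsHamModel (c : T ≃ₗ[ℝ] HamMdl d n) (θ : T [⋀^Fin (d + 1)]→L[ℝ] ℝ)
    (Ω : T [⋀^Fin (d + 2)]→L[ℝ] ℝ) (ωX : T [⋀^Fin (d + 1)]→L[ℝ] ℝ) (X : ExtMomMdl d n)
    (D : HamMdl d n →ₗ[ℝ] Base d [⋀^Fin (d + 1)]→L[ℝ] ℝ)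
    (ω₀ : Base d [⋀^Fin (d + 1)]→L[ℝ] ℝ) : Prop where
  theta : ∀ u, θ u = thetaVal X (fun i => c (u i))
  dtheta : ∀ u, Ω u = dthetaVal D (fun i => c (u i))
  omega : ∀ u, ωX u = ω₀ (fun i => (c (u i)).1.1)
  omega_ne : ω₀ ≠ 0

/-- The restriction of a differential to the directions `∂/∂y^A_μ`. -/
def velPart (D : HamMdl d n →ₗ[ℝ] Base d [⋀^Fin (d + 1)]→L[ℝ] ℝ) :
    JetMdl d n →ₗ[ℝ] Base d [⋀^Fin (d + 1)]→L[ℝ] ℝ :=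
  D ∘ₗ LinearMap.inr ℝ (Mdl d n) (JetMdl d n × (MomMdl d n × ActMdl d)) ∘ₗ
    LinearMap.inl ℝ (JetMdl d n) (MomMdl d n × ActMdl d)

/-- The restriction of a differential to the directions `∂/∂s^μ`. -/
def actPart (D : HamMdl d n →ₗ[ℝ] Base d [⋀^Fin (d + 1)]→L[ℝ] ℝ) :
    ActMdl d →ₗ[ℝ] Base d [⋀^Fin (d + 1)]→L[ℝ] ℝ :=
  D ∘ₗ LinearMap.inr ℝ (Mdl d n) (JetMdl d n × (MomMdl d n × ActMdl d)) ∘ₗ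
    LinearMap.inr ℝ (JetMdl d n) (MomMdl d n × ActMdl d) ∘ₗ
      LinearMap.inr ℝ (MomMdl d n) (ActMdl d)

/-- After shearing, both forms have the same expression `thetaVal 0`, so a linear isomorphism of `T`
onto `T'` carries one to the other, even if they are taken at different points. -/
theorem finrank_formKer_theta {c : T ≃ₗ[ℝ] HamMdl d n} {θ : T [⋀^Fin (d + 1)]→L[ℝ] ℝ}
    {X : ExtMomMdl d n} (h : ∀ u, θ u = thetaVal X (fun i => c (u i)))
    {c' : T' ≃ₗ[ℝ] HamMdl d n} {θ' : T' [⋀^Fin (d + 1)]→L[ℝ] ℝ}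
    {X' : ExtMomMdl d n} (h' : ∀ u, θ' u = thetaVal X' (fun i => c' (u i))) :
    Module.finrank ℝ (formKer θ) = Module.finrank ℝ (formKer θ') := by
  rw [formKer_comp_equiv (((c.trans (shear X)).trans (shear X').symm).trans c'.symm)
    (α' := θ') ?_, LinearEquiv.finrank_map_eq]
  intro u
  rw [h, h', ← thetaVal_shear X, ← thetaVal_shear X']
  simp

end HamiltonianTangent

/-! ### Reeb and characteristic spaces, condition (4) and the dissipation equation at a point -/

namespace IsHamModel

variable {T : Type*} [AddCommGroup T] [Module ℝ T] [TopologicalSpace T] {d n : ℕ}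
  {c : T ≃ₗ[ℝ] HamMdl d n} {θ : T [⋀^Fin (d + 1)]→L[ℝ] ℝ}
  {Ω : T [⋀^Fin (d + 2)]→L[ℝ] ℝ} {ωX : T [⋀^Fin (d + 1)]→L[ℝ] ℝ} {X : ExtMomMdl d n}
  {D : HamMdl d n →ₗ[ℝ] Base d [⋀^Fin (d + 1)]→L[ℝ] ℝ}
  {ω₀ : Base d [⋀^Fin (d + 1)]→L[ℝ] ℝ}

theorem theta_vecCons (h : IsHamModel c θ Ω ωX X D ω₀) {R : T} (hR : (c R).1.1 = 0)
    (u : Fin d → T) :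
    θ (Matrix.vecCons R u) = ((c R).2.2.2 - X.1 (c R).1.2) (fun j => (c (u j)).1.1) := by
  rw [h.theta, comp_vecCons c, thetaVal_vecCons X hR]

/-- The horizontal lift of the vectors of the base. -/
def lift (c : T ≃ₗ[ℝ] HamMdl d n) : Base d →ₗ[ℝ] T :=
  c.symm.toLinearMap ∘ₗ LinearMap.inl ℝ (Mdl d n) (JetMdl d n × (MomMdl d n × ActMdl d)) ∘ₗ
    LinearMap.inl ℝ (Base d) (Fin n → ℝ)

theorem apply_lift (c : T ≃ₗ[ℝ] HamMdl d n) (v : Base d) : c (lift c v) = ((v, 0), 0) :=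
  c.apply_symm_apply _

theorem mem_ker_omega (h : IsHamModel c θ Ω ωX X D ω₀) {R : T} :
    R ∈ formKer ωX ↔ (c R).1.1 = 0 := by
  rw [mem_formKer_iff]
  simp only [h.omega]
  constructor
  · intro hR
    refine eq_zero_of_interior h.omega_ne (ContinuousAlternatingMap.ext fun u => ?_)
    have h1 := hR (fun j => lift c (u j))
    rw [comp_vecCons fun v => (c v).1.1] at h1
    simp only [apply_lift] at h1
    exact h1
  · intro hR u
    exact ω₀.map_coord_zero 0 hR

theorem finrank_ker_omega [FiniteDimensional ℝ T] (h : IsHamModel c θ Ω ωX X D ω₀) :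
    Module.finrank ℝ (formKer ωX) + (d + 1) = Module.finrank ℝ T := by
  let f : T →ₗ[ℝ] Base d := LinearMap.fst ℝ (Base d) (Fin n → ℝ) ∘ₗ
    LinearMap.fst ℝ (Mdl d n) (JetMdl d n × (MomMdl d n × ActMdl d)) ∘ₗ c.toLinearMap
  have h1 : formKer ωX = LinearMap.ker f := by
    ext R
    exact h.mem_ker_omega
  have h2 : LinearMap.range f = ⊤ := LinearMap.range_eq_top.2 fun v =>
    ⟨lift c v, congrArg (fun q => q.1.1) (apply_lift c v)⟩
  have h3 := LinearMap.finrank_range_add_finrank_ker f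
  rw [h2, finrank_top, Module.finrank_fin_fun] at h3
  rw [h1]
  omega

/-- The answer does not involve `D`: the term $D(R)\,d^mx$ of $i_Rd\Theta_\circ$ is annihilated by
$\ker\omega$. The Reeb vectors are the combinations of the $\partial/\partial y^A_\mu$ and
$\partial/\partial s^\mu$ at every point. -/
theorem mem_reeb (h : IsHamModel c θ Ω ωX X D ω₀) {R : T} :
    (R ∈ formKer ωX ∧ interior R Ω ∈ annForms (formKer ωX) (d + 1)) ↔
      (c R).1 = 0 ∧ (c R).2.2.1 = 0 := by
  rw [h.mem_ker_omega]
  have key : (c R).1.1 = 0 → (interior R Ω ∈ annForms (formKer ωX) (d + 1) ↔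
      (c R).1.2 = 0 ∧ (c R).2.2.1 = 0) := by
    intro hR
    rw [← ann_dthetaVal_iff D hR]
    constructor
    · rintro h1 u ⟨i, hi⟩
      have h2 : Ω (Matrix.vecCons R fun i => c.symm (u i)) = 0 :=
        h1 (fun i => c.symm (u i)) ⟨i, by rw [h.mem_ker_omega]; simpa using hi⟩
      rw [h.dtheta, comp_vecCons c] at h2
      simpa using h2
    · rintro h1 u ⟨i, hi⟩
      rw [h.mem_ker_omega] at hi
      rw [interior_apply, h.dtheta, comp_vecCons c]
      exact h1 _ ⟨i, hi⟩
  constructor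
  · rintro ⟨h1, h2⟩
    obtain ⟨h3, h4⟩ := (key h1).1 h2
    exact ⟨Prod.ext h1 h3, h4⟩
  · rintro ⟨h1, h2⟩
    have h3 : (c R).1.1 = 0 := by rw [h1]; rfl
    exact ⟨h3, (key h3).2 ⟨by rw [h1]; rfl, h2⟩⟩

/-- The summand $m$ counts the directions $\partial/\partial s^\mu$ and the summand $nm$ the
directions $\partial/\partial y^A_\mu$. The submodule is given by its membership condition because
`T` is here a bare vector space. -/
theorem finrank_reeb (h : IsHamModel c θ Ω ωX X D ω₀) (p : Submodule ℝ T)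
    (hp : ∀ R, R ∈ p ↔ R ∈ formKer ωX ∧ interior R Ω ∈ annForms (formKer ωX) (d + 1)) :
    Module.finrank ℝ p = d + 1 + n * (d + 1) := by
  have hp' : ∀ R, R ∈ p ↔ (c R).1 = 0 ∧ (c R).2.2.1 = 0 := fun R => (hp R).trans h.mem_reeb
  let f : (JetMdl d n × ActMdl d) →ₗ[ℝ] T := c.symm.toLinearMap ∘ₗ
    LinearMap.inr ℝ (Mdl d n) (JetMdl d n × (MomMdl d n × ActMdl d)) ∘ₗ
      LinearMap.prodMap LinearMap.id (LinearMap.inr ℝ (MomMdl d n) (ActMdl d))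
  have hf : Function.Injective f := by
    refine c.symm.injective.comp (LinearMap.inr_injective.comp ?_)
    exact Function.injective_id.prodMap LinearMap.inr_injective
  have h0 : p = LinearMap.range f := by
    ext R
    rw [hp', LinearMap.mem_range]
    constructor
    · rintro ⟨h1, h2⟩
      refine ⟨((c R).2.1, (c R).2.2.2), (c.symm_apply_eq).2 ?_⟩
      exact Prod.ext h1.symm (Prod.ext rfl (Prod.ext h2.symm rfl))
    · rintro ⟨q, rfl⟩
      have : c (f q) = (0, (q.1, (0, q.2))) := c.apply_symm_apply _
      rw [this]
      exact ⟨rfl, rfl⟩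
  rw [h0, LinearMap.finrank_range_of_inj hf, Module.finrank_prod, finrank_jetMdl,
    finrank_actMdl]
  ring

/-- The characteristic space is the copy of $\ker$ `(velPart D)` inside the jet directions. These
have dimension $nm$, so the rank is $nm$ exactly when the kernel is the whole space. -/
theorem finrank_char (h : IsHamModel c θ Ω ωX X D ω₀) :
    Module.finrank ℝ (formKer ωX ⊓ formKer θ ⊓ formKer Ω : Submodule ℝ T) = n * (d + 1) ↔
      velPart D = 0 := by
  let f : JetMdl d n →ₗ[ℝ] T := c.symm.toLinearMap ∘ₗ
    LinearMap.inr ℝ (Mdl d n) (JetMdl d n × (MomMdl d n × ActMdl d)) ∘ₗ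
      LinearMap.inl ℝ (JetMdl d n) (MomMdl d n × ActMdl d)
  have hf : Function.Injective f :=
    c.symm.injective.comp (LinearMap.inr_injective.comp LinearMap.inl_injective)
  have h0 : formKer ωX ⊓ formKer θ ⊓ formKer Ω = (LinearMap.ker (velPart D)).map f := by
    ext R
    have h1 : (∀ u, θ (Matrix.vecCons R u) = 0) ↔ ∀ u, thetaVal X (Matrix.vecCons (c R) u) = 0 := by
      simp only [h.theta, comp_vecCons c]
      exact ⟨fun h u => by simpa using h (fun i => c.symm (u i)), fun h u => h _⟩
    have h2 : (∀ u, Ω (Matrix.vecCons R u) = 0) ↔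
        ∀ u, dthetaVal D (Matrix.vecCons (c R) u) = 0 := by
      simp only [h.dtheta, comp_vecCons c]
      exact ⟨fun h u => by simpa using h (fun i => c.symm (u i)), fun h u => h _⟩
    rw [Submodule.mem_inf, Submodule.mem_inf, h.mem_ker_omega, mem_formKer_iff, h1,
      mem_formKer_iff, h2, and_assoc, characteristic_iff, Submodule.mem_map]
    refine exists_congr fun Γ => and_congr Iff.rfl ?_
    exact (c.symm_apply_eq (x := (0, (Γ, 0)))).symm
  rw [h0, ← (Submodule.equivMapOfInjective f hf _).finrank_eq, ← finrank_jetMdl,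
    ← LinearMap.ker_eq_top]
  constructor
  · exact fun h => Submodule.eq_top_of_finrank_eq h
  · intro h
    rw [h, finrank_top]

theorem interior_theta (h : IsHamModel c θ Ω ωX X D ω₀) {R : T} (h1 : (c R).1 = 0)
    (u : Fin d → T) : interior R θ u = (c R).2.2.2 (fun j => (c (u j)).1.1) := by
  rw [interior_apply, h.theta_vecCons (by rw [h1]; rfl), h1]
  simp

theorem interior_dtheta (h : IsHamModel c θ Ω ωX X D ω₀) {R : T} (h1 : (c R).1 = 0)
    (h2 : (c R).2.2.1 = 0) (u : Fin (d + 1) → T) :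
    interior R Ω u = -D (c R) (fun j => (c (u j)).1.1) := by
  rw [interior_apply, h.dtheta, comp_vecCons c, dthetaVal_vecCons_reeb D h1 h2]

/-- A form annihilated by $\ker\omega$ is determined by its restriction `s` to horizontal lifts, and
the Reeb vector whose only component is `s` contracts $\Theta_\circ$ to it. -/
theorem annForms_eq [IsTopologicalAddGroup T] [ContinuousSMul ℝ T]
    (h : IsHamModel c θ Ω ωX X D ω₀) :
    annForms (formKer ωX) d = {β | ∃ R : T, (R ∈ formKer ωX ∧
      interior R Ω ∈ annForms (formKer ωX) (d + 1)) ∧ β = interior R θ} := by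
  ext β
  constructor
  · intro hβ
    have hβ : ∀ u : Fin d → T, (∃ i, (c (u i)).1.1 = 0) → β u = 0 := by
      rintro u ⟨i, hi⟩
      exact hβ u ⟨i, h.mem_ker_omega.2 hi⟩
    let s : ActMdl d := β.compContinuousLinearMap (LinearMap.toContinuousLinearMap (lift c))
    have hR : c (c.symm (0, (0, (0, s)))) = (0, (0, (0, s))) := c.apply_symm_apply _
    refine ⟨c.symm (0, (0, (0, s))), h.mem_reeb.2 (by rw [hR]; exact ⟨rfl, rfl⟩), ?_⟩
    ext u
    rw [h.interior_theta (by rw [hR]), hR]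
    change β u = β (fun j => lift c (c (u j)).1.1)
    -- Each argument is split into a lift and a vector of $\ker\omega$. In the multilinear expansion
    -- only the term without vertical arguments survives.
    have hu : u = (fun j => lift c (c (u j)).1.1) + (fun j => u j - lift c (c (u j)).1.1) := by
      funext j
      simp
    have hexp : β u = ∑ t : Finset (Fin d), β (t.piecewise (fun j => lift c (c (u j)).1.1)
        (fun j => u j - lift c (c (u j)).1.1)) := by
      conv_lhs => rw [hu]
      exact β.toMultilinearMap.map_add_univ _ _
    rw [hexp, Finset.sum_eq_single Finset.univ]
    · rw [Finset.piecewise_univ]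
    · intro t _ ht
      obtain ⟨i, hi⟩ : ∃ i, i ∉ t := by
        by_contra! hc
        exact ht (Finset.eq_univ_of_forall hc)
      exact hβ _ ⟨i, by simp [hi, apply_lift]⟩
    · simp
  · rintro ⟨R, hR, rfl⟩ u ⟨i, hi⟩
    obtain ⟨h1, h2⟩ := h.mem_reeb.1 hR
    rw [h.interior_theta h1]
    exact (c R).2.2.2.map_coord_zero i (h.mem_ker_omega.1 hi)

/-- The dissipation form is `-∂ℓ/∂s^μ dx^μ`, where `ℓ` is the Lagrangian density. -/
theorem isDissipation_iff [IsTopologicalAddGroup T] [ContinuousSMul ℝ T]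
    (h : IsHamModel c θ Ω ωX X D ω₀) (hD : velPart D = 0) (σ : T →L[ℝ] ℝ) :
    (∀ R : T, (R ∈ formKer ωX ∧ interior R Ω ∈ annForms (formKer ωX) (d + 1)) →
      wedge σ (interior R θ) = interior R Ω) ↔
    ∀ u, σ u = -actPart D (interior (c u).1.1 (stdVol d)) (frame d) := by
  -- Since `velPart D` vanishes, `D` ignores the jet component of a Reeb vector. Both sides of the
  -- dissipation equation then depend only on its `s` component.
  have hval : ∀ R : T, (c R).1 = 0 → (c R).2.2.1 = 0 → D (c R) = actPart D (c R).2.2.2 := by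
    intro R h1 h2
    have e : c R = (0, ((c R).2.1, 0)) + (0, (0, (0, (c R).2.2.2))) := by
      refine Prod.ext ?_ (Prod.ext ?_ (Prod.ext ?_ ?_))
      · exact h1.trans (add_zero _).symm
      · exact (add_zero _).symm
      · exact h2.trans (add_zero (0 : MomMdl d n)).symm
      · exact (zero_add _).symm
    have e2 : D (0, ((c R).2.1, 0)) = 0 := LinearMap.congr_fun hD _
    conv_lhs => rw [e, map_add, e2, zero_add]
    rfl
  have key : (∀ R : T, (R ∈ formKer ωX ∧ interior R Ω ∈ annForms (formKer ωX) (d + 1)) →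
      wedge σ (interior R θ) = interior R Ω) ↔ ∀ (s : ActMdl d) (u : Fin (d + 1) → T),
        ∑ i : Fin (d + 1), (-1 : ℤ) ^ (i : ℕ) • (σ (u i) * s (fun j => (c (i.removeNth u j)).1.1)) =
          -actPart D s (fun j => (c (u j)).1.1) := by
    constructor
    · intro hσ s u
      have hR : c (c.symm (0, (0, (0, s)))) = (0, (0, (0, s))) := c.apply_symm_apply _
      have h1 := congrArg (fun a => a u) (hσ (c.symm (0, (0, (0, s))))
        (h.mem_reeb.2 (by rw [hR]; exact ⟨rfl, rfl⟩)))
      simp only [wedge_apply] at h1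
      simp only [h.interior_theta (R := c.symm (0, (0, (0, s)))) (by rw [hR]), hR,
        h.interior_dtheta (R := c.symm (0, (0, (0, s)))) (by rw [hR]) (by rw [hR])] at h1
      exact h1
    · intro hσ R hR
      obtain ⟨h1, h2⟩ := h.mem_reeb.1 hR
      ext u
      simp only [wedge_apply, h.interior_theta h1, h.interior_dtheta h1 h2, hval R h1 h2]
      exact hσ _ u
  rw [key]
  let τ : Base d →L[ℝ] ℝ := LinearMap.toContinuousLinearMap (σ.toLinearMap ∘ₗ lift c)
  have hτ : ∀ (v : Base d) (w : Fin (d + 1) → Base d), ∑ i : Fin (d + 1), (-1 : ℤ) ^ (i : ℕ) •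
      (τ (w i) * interior v (stdVol d) (i.removeNth w)) = τ v * stdVol d w := by
    intro v w
    rw [← wedge_apply, wedge_interior]
    rfl
  constructor
  · intro hσ
    -- Take $s=i_{\partial_0}d^mx$ and the family of `u` followed by lifts of `coframe 0`. The right
    -- side has a vertical argument and vanishes, while on the left only $\sigma(u)\cdot 1$ remains.
    have hvert : ∀ u, (c u).1.1 = 0 → σ u = 0 := by
      intro u hu
      have h1 := hσ (interior (frame d 0) (stdVol d))
        (Matrix.vecCons u (fun j => lift c (coframe 0 j)))
      rw [Fin.sum_univ_succ, Finset.sum_eq_zero] at h1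
      · have h2 : actPart D (interior (frame d 0) (stdVol d)) (fun j =>
            (c ((Matrix.vecCons u (fun j => lift c (coframe 0 j)) : Fin (d + 1) → T) j)).1.1) = 0 :=
          ContinuousAlternatingMap.map_coord_zero _ 0 hu
        have h3 := interior_coframe (d := d) (frame d 0) 0
        simp only [Fin.val_zero, pow_zero, one_mul] at h3
        rw [h2] at h1
        simp only [removeNth_zero_vecCons, Matrix.cons_val_zero, apply_lift, Fin.val_zero,
          pow_zero, one_smul, h3] at h1
        simpa [frame] using h1
      · intro i _
        obtain ⟨l, hl⟩ := exists_removeNth_succ_vecCons u (fun j => lift c (coframe 0 j)) i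
        rw [ContinuousAlternatingMap.map_coord_zero _ l (by rw [hl, hu]), mul_zero, smul_zero]
    intro u
    have h1 : σ u = τ (c u).1.1 := by
      have := hvert (u - lift c (c u).1.1) (by simp [apply_lift])
      rw [map_sub, sub_eq_zero] at this
      exact this
    -- Now $\sigma$ comes from the form $\tau$ on the base. With $s=i_vd^mx$ the left side is
    -- $\tau(v)\,d^mx$, so the value on the frame gives $\tau(v)$.
    have h2 := hσ (interior (c u).1.1 (stdVol d)) (fun j => lift c (frame d j))
    have h3 := hτ (c u).1.1 (frame d)
    rw [stdVol_frame, mul_one] at h3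
    rw [h1, ← h3]
    simp only [apply_lift] at h2
    refine Eq.trans ?_ h2
    refine Finset.sum_congr rfl fun i _ => ?_
    simp only [Fin.removeNth, apply_lift]
    rfl
  · intro hσ s u
    -- Conversely, every `s` has the form $i_vd^mx$, so the equation reduces to the formula for
    -- $\tau(v)$ by `wedge_interior`.
    obtain ⟨v, rfl⟩ := exists_interior s
    have h1 : ∀ u, σ u = τ (c u).1.1 := by
      intro u
      rw [hσ u]
      change _ = σ (lift c (c u).1.1)
      rw [hσ, apply_lift]
    have h2 : τ v = -actPart D (interior v (stdVol d)) (frame d) := by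
      change σ (lift c v) = _
      rw [hσ, apply_lift]
    simp only [h1]
    refine (hτ v (fun j => (c (u j)).1.1)).trans ?_
    rw [h2, top_eq_smul_stdVol (actPart D (interior v (stdVol d)))]
    simp [stdVol_frame]

end IsHamModel

/-! ### Derivatives of the canonical forms in coordinates -/

section CanonicalForms

variable {V : Type*} [NormedAddCommGroup V] [NormedSpace ℝ V]
  {V' : Type*} [NormedAddCommGroup V'] [NormedSpace ℝ V']
  {W : Type*} [NormedAddCommGroup W] [NormedSpace ℝ W]
  {W' : Type*} [NormedAddCommGroup W'] [NormedSpace ℝ W']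
  {A B C : Type*} [NormedAddCommGroup A] [NormedSpace ℝ A] [NormedAddCommGroup B]
  [NormedSpace ℝ B] [NormedAddCommGroup C] [NormedSpace ℝ C]

theorem fderiv_linear_comp [FiniteDimensional ℝ W] (f : W → W')
    (h1 : ∀ x y, f (x + y) = f x + f y) (h2 : ∀ (r : ℝ) x, f (r • x) = r • f x) {g : V → W}
    {v : V} (hg : DifferentiableAt ℝ g v) (u : V) :
    fderiv ℝ (fun v => f (g v)) v u = f (fderiv ℝ g v u) := by
  let F : W →L[ℝ] W' := LinearMap.toContinuousLinearMap
    ({ toFun := f, map_add' := h1, map_smul' := h2 } : W →ₗ[ℝ] W')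
  have h : HasFDerivAt (fun v => F (g v)) (F.comp (fderiv ℝ g v)) v :=
    F.hasFDerivAt.comp v hg.hasFDerivAt
  exact congrArg (fun l => l u) h.fderiv

theorem fderiv_fourth (v u : A × (B × (C × W))) :
    fderiv ℝ (fun q : A × (B × (C × W)) => q.2.2.2) v u = u.2.2.2 := by
  have h : HasFDerivAt (fun q : A × (B × (C × W)) => q.2.2.2)
      ((ContinuousLinearMap.snd ℝ C W).comp ((ContinuousLinearMap.snd ℝ B (C × W)).comp
        (ContinuousLinearMap.snd ℝ A (B × (C × W))))) v :=
    ((ContinuousLinearMap.snd ℝ C W).comp ((ContinuousLinearMap.snd ℝ B (C × W)).comp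
        (ContinuousLinearMap.snd ℝ A (B × (C × W))))).hasFDerivAt
  rw [h.fderiv]
  rfl

theorem fderiv_forget (v u : A × (B × C)) :
    fderiv ℝ (fun q : A × (B × C) => (q.1, q.2.2)) v u = (u.1, u.2.2) := by
  have h : HasFDerivAt (fun q : A × (B × C) => (q.1, q.2.2))
      ((ContinuousLinearMap.fst ℝ A (B × C)).prod
        ((ContinuousLinearMap.snd ℝ B C).comp (ContinuousLinearMap.snd ℝ A (B × C)))) v :=
    ((ContinuousLinearMap.fst ℝ A (B × C)).prod
      ((ContinuousLinearMap.snd ℝ B C).comp (ContinuousLinearMap.snd ℝ A (B × C)))).hasFDerivAt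
  rw [h.fderiv]
  rfl

theorem hasFDerivAt_omit_third (v : A × (B × (C × W))) :
    HasFDerivAt (fun q : A × (B × (C × W)) => (q.1, (q.2.1, q.2.2.2)))
      ((ContinuousLinearMap.fst ℝ A (B × (C × W))).prod
        (((ContinuousLinearMap.fst ℝ B (C × W)).comp
          (ContinuousLinearMap.snd ℝ A (B × (C × W)))).prod
            ((ContinuousLinearMap.snd ℝ C W).comp ((ContinuousLinearMap.snd ℝ B (C × W)).comp
              (ContinuousLinearMap.snd ℝ A (B × (C × W))))))) v :=
  ((ContinuousLinearMap.fst ℝ A (B × (C × W))).prod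
    (((ContinuousLinearMap.fst ℝ B (C × W)).comp
      (ContinuousLinearMap.snd ℝ A (B × (C × W)))).prod
        ((ContinuousLinearMap.snd ℝ C W).comp ((ContinuousLinearMap.snd ℝ B (C × W)).comp
          (ContinuousLinearMap.snd ℝ A (B × (C × W))))))).hasFDerivAt

theorem hasFDerivAt_third (v : A × (B × (C × W))) :
    HasFDerivAt (fun q : A × (B × (C × W)) => q.2.2.1)
      ((ContinuousLinearMap.fst ℝ C W).comp ((ContinuousLinearMap.snd ℝ B (C × W)).comp
        (ContinuousLinearMap.snd ℝ A (B × (C × W))))) v :=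
  ((ContinuousLinearMap.fst ℝ C W).comp ((ContinuousLinearMap.snd ℝ B (C × W)).comp
    (ContinuousLinearMap.snd ℝ A (B × (C × W))))).hasFDerivAt

theorem fderiv_sub_linear [FiniteDimensional ℝ C] {a : A × (B × W) → W'} (b : C →ₗ[ℝ] W')
    {v : A × (B × (C × W))} (ha : DifferentiableAt ℝ a (v.1, (v.2.1, v.2.2.2)))
    (u : A × (B × (C × W))) :
    fderiv ℝ (fun q : A × (B × (C × W)) => a (q.1, (q.2.1, q.2.2.2)) - b q.2.2.1) v u =
      fderiv ℝ a (v.1, (v.2.1, v.2.2.2)) (u.1, (u.2.1, u.2.2.2)) - b u.2.2.1 := by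
  have h1 := ha.hasFDerivAt.comp v (hasFDerivAt_omit_third v)
  have h2 := (LinearMap.toContinuousLinearMap b).hasFDerivAt.comp v (hasFDerivAt_third v)
  exact congrArg (fun l => l u) (h1.sub h2).fderiv

theorem fderiv_sub_bilinear [FiniteDimensional ℝ B] [FiniteDimensional ℝ C]
    {a : A × (B × W) → W'} (b : B →ₗ[ℝ] C →ₗ[ℝ] W')
    {v : A × (B × (C × W))} (ha : DifferentiableAt ℝ a (v.1, (v.2.1, v.2.2.2)))
    (u : A × (B × (C × W))) :
    fderiv ℝ (fun q : A × (B × (C × W)) => a (q.1, (q.2.1, q.2.2.2)) - b q.2.1 q.2.2.1) v u =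
      fderiv ℝ a (v.1, (v.2.1, v.2.2.2)) (u.1, (u.2.1, u.2.2.2)) -
        (b v.2.1 u.2.2.1 + b u.2.1 v.2.2.1) := by
  have h1 := ha.hasFDerivAt.comp v (hasFDerivAt_omit_third v)
  have h2 := b.toContinuousBilinearMap.hasFDerivAt_of_bilinear
    ((ContinuousLinearMap.fst ℝ B (C × W)).comp
      (ContinuousLinearMap.snd ℝ A (B × (C × W)))).hasFDerivAt (hasFDerivAt_third v)
  exact congrArg (fun l => l u) (h1.sub h2).fderiv

theorem fderiv_third_prodMk {h : A × (B × (C × W)) → W'} {v : A × (B × (C × W))}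
    (hh : DifferentiableAt ℝ h v) (u : A × (B × (C × W))) :
    fderiv ℝ (fun q => (q.2.2.1, h q)) v u = (u.2.2.1, fderiv ℝ h v u) := by
  rw [((hasFDerivAt_third v).prodMk hh.hasFDerivAt).fderiv]
  rfl

theorem differentiableAt_third_prodMk {h : A × (B × (C × W)) → W'} {v : A × (B × (C × W))}
    (hh : DifferentiableAt ℝ h v) : DifferentiableAt ℝ (fun q => (q.2.2.1, h q)) v :=
  ((hasFDerivAt_third v).prodMk hh.hasFDerivAt).differentiableAt

/-- Differentiate `l ∘ F = l'`: where a component of a nonlinear map is linear, the same component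
of its derivative is given by the same linear map. -/
theorem fderiv_apply_of_comp_linear (l : V' →L[ℝ] W') (l' : V →L[ℝ] W') {F : V → V'} {v : V}
    (hF : DifferentiableAt ℝ F v) (h : ∀ q, l (F q) = l' q) (u : V) :
    l (fderiv ℝ F v u) = l' u := by
  have h1 : HasFDerivAt (fun q => l (F q)) (l.comp (fderiv ℝ F v)) v :=
    l.hasFDerivAt.comp v hF.hasFDerivAt
  have h2 : HasFDerivAt (fun q => l (F q)) l' v := by
    simp only [h]
    exact l'.hasFDerivAt
  exact congrArg (fun a => a u) (h1.unique h2)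

/-- The alternating `k`-forms on a normed space. -/
abbrev AltForm (V : Type*) [NormedAddCommGroup V] [NormedSpace ℝ V] (k : ℕ) : Type _ :=
  V [⋀^Fin k]→L[ℝ] ℝ

/-- The expression `s^μ d^{m-1}x_μ` of the tautological form of `Λ^{m-1} T*M`, where `z ↦ x z`
are the coordinates of the base. -/
def actLoc (x : A →L[ℝ] V) {k : ℕ} (q : A × (B × (C × (V [⋀^Fin k]→L[ℝ] ℝ)))) :
    AltForm (A × (B × (C × (V [⋀^Fin k]→L[ℝ] ℝ)))) k :=
  q.2.2.2.compContinuousLinearMap (x.comp (ContinuousLinearMap.fst ℝ A _))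

theorem contDiff_actLoc [FiniteDimensional ℝ V] (x : A →L[ℝ] V) {k : ℕ} :
    ContDiff ℝ ∞ (actLoc (B := B) (C := C) x (k := k)) :=
  (contDiff_of_linear (fun s : V [⋀^Fin k]→L[ℝ] ℝ => s.compContinuousLinearMap
    (x.comp (ContinuousLinearMap.fst ℝ A (B × (C × (V [⋀^Fin k]→L[ℝ] ℝ))))))
    (fun _ _ => rfl) (fun _ _ => rfl)).comp
      (contDiff_snd.comp (contDiff_snd.comp contDiff_snd))

theorem differentiableOn_actLoc [FiniteDimensional ℝ V] (x : A →L[ℝ] V) {k : ℕ}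
    (U : Set (A × (B × (C × (V [⋀^Fin k]→L[ℝ] ℝ))))) :
    DifferentiableOn ℝ (actLoc (B := B) (C := C) x (k := k)) U :=
  ((contDiff_actLoc (B := B) (C := C) (k := k) x).differentiable (by simp)).differentiableOn

/-- `actLoc` is linear in `s` and does not depend on the other coordinates. Its derivative along `u
i` is the same expression with `s` replaced by the last component of `u i`, hence is independent of
`q`. -/
theorem extDeriv_actLoc_apply [FiniteDimensional ℝ V] (x : A →L[ℝ] V) {k : ℕ}
    (q : A × (B × (C × (V [⋀^Fin k]→L[ℝ] ℝ))))
    (u : Fin (k + 1) → A × (B × (C × (V [⋀^Fin k]→L[ℝ] ℝ)))) :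
    extDeriv (actLoc x) q u = ∑ i : Fin (k + 1), (-1 : ℤ) ^ (i : ℕ) •
      (u i).2.2.2 (fun j => x (i.removeNth u j).1) := by
  rw [extDeriv, ContinuousAlternatingMap.alternatizeUncurryFin_apply]
  refine Finset.sum_congr rfl fun i _ => ?_
  have h := fderiv_linear_comp (fun s : V [⋀^Fin k]→L[ℝ] ℝ => s.compContinuousLinearMap
    (x.comp (ContinuousLinearMap.fst ℝ A (B × (C × (V [⋀^Fin k]→L[ℝ] ℝ))))))
    (fun _ _ => rfl) (fun _ _ => rfl)
    (g := fun q : A × (B × (C × (V [⋀^Fin k]→L[ℝ] ℝ))) => q.2.2.2) (v := q)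
    (by fun_prop) (u i)
  rw [fderiv_fourth] at h
  exact congrArg (fun a => (-1 : ℤ) ^ (i : ℕ) • a (i.removeNth u)) h

/-- The form `-α + d(s^μ d^{m-1}x_μ)`, where `α` is a form in the coordinates `z`. -/
def thetaLoc (x : A →L[ℝ] V) {k : ℕ} (α : A [⋀^Fin (k + 1)]→L[ℝ] ℝ) :
    AltForm (A × (B × (C × (V [⋀^Fin k]→L[ℝ] ℝ)))) (k + 1) :=
  -α.compContinuousLinearMap (ContinuousLinearMap.fst ℝ A (B × (C × (V [⋀^Fin k]→L[ℝ] ℝ)))) +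
    -- The derivative is the same at all points by `extDeriv_actLoc_apply`, so evaluating it at `0`
    -- is an arbitrary choice.
    extDeriv (actLoc (B := B) (C := C) x (k := k)) 0

theorem thetaLoc_apply [FiniteDimensional ℝ V] (x : A →L[ℝ] V) {k : ℕ}
    (α : A [⋀^Fin (k + 1)]→L[ℝ] ℝ)
    (u : Fin (k + 1) → A × (B × (C × (V [⋀^Fin k]→L[ℝ] ℝ)))) :
    thetaLoc x α u = -α (fun i => (u i).1) + ∑ i : Fin (k + 1), (-1 : ℤ) ^ (i : ℕ) •
      (u i).2.2.2 (fun j => x (i.removeNth u j).1) := by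
  rw [← extDeriv_actLoc_apply x 0]
  rfl

/-- `thetaLoc` sees only the first and the last component of its arguments. The inclusion of
$\mathcal W_\circ$ into $\mathcal W$ preserves both, as it merely inserts the value of $p$. -/
theorem thetaLoc_comp_fderiv [FiniteDimensional ℝ V] {C' : Type*} [NormedAddCommGroup C']
    [NormedSpace ℝ C'] (x : A →L[ℝ] V) {k : ℕ} (α : A [⋀^Fin (k + 1)]→L[ℝ] ℝ)
    {F : A × (B × (C × (V [⋀^Fin k]→L[ℝ] ℝ))) → A × (B × (C' × (V [⋀^Fin k]→L[ℝ] ℝ)))}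
    {v : A × (B × (C × (V [⋀^Fin k]→L[ℝ] ℝ)))} (hF : DifferentiableAt ℝ F v)
    (h1 : ∀ q, (F q).1 = q.1) (h4 : ∀ q, (F q).2.2.2 = q.2.2.2)
    (u : Fin (k + 1) → A × (B × (C × (V [⋀^Fin k]→L[ℝ] ℝ)))) :
    thetaLoc x α (fun i => fderiv ℝ F v (u i)) = thetaLoc x α u := by
  have e1 : ∀ u, (fderiv ℝ F v u).1 = u.1 := fderiv_apply_of_comp_linear
    (ContinuousLinearMap.fst ℝ A _) (ContinuousLinearMap.fst ℝ A _) hF h1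
  have e4 : ∀ u, (fderiv ℝ F v u).2.2.2 = u.2.2.2 := fderiv_apply_of_comp_linear
    ((ContinuousLinearMap.snd ℝ C' (V [⋀^Fin k]→L[ℝ] ℝ)).comp
      ((ContinuousLinearMap.snd ℝ B (C' × (V [⋀^Fin k]→L[ℝ] ℝ))).comp
        (ContinuousLinearMap.snd ℝ A (B × (C' × (V [⋀^Fin k]→L[ℝ] ℝ))))))
    ((ContinuousLinearMap.snd ℝ C (V [⋀^Fin k]→L[ℝ] ℝ)).comp
      ((ContinuousLinearMap.snd ℝ B (C × (V [⋀^Fin k]→L[ℝ] ℝ))).comp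
        (ContinuousLinearMap.snd ℝ A (B × (C × (V [⋀^Fin k]→L[ℝ] ℝ)))))) hF h4
  rw [thetaLoc_apply, thetaLoc_apply]
  simp only [Fin.removeNth, e1, e4]

theorem contDiffOn_thetaLoc [FiniteDimensional ℝ A] (x : A →L[ℝ] V) {k : ℕ}
    {α : A × (B × (C × (V [⋀^Fin k]→L[ℝ] ℝ))) → A [⋀^Fin (k + 1)]→L[ℝ] ℝ}
    {U : Set (A × (B × (C × (V [⋀^Fin k]→L[ℝ] ℝ))))} (hα : ContDiffOn ℝ ∞ α U) :
    ContDiffOn ℝ ∞ (fun q => thetaLoc (B := B) (C := C) x (α q)) U := by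
  refine ContDiffOn.add (ContDiffOn.neg ?_) contDiffOn_const
  exact (contDiff_of_linear (fun a : A [⋀^Fin (k + 1)]→L[ℝ] ℝ => a.compContinuousLinearMap
    (ContinuousLinearMap.fst ℝ A (B × (C × (V [⋀^Fin k]→L[ℝ] ℝ)))))
    (fun _ _ => rfl) (fun _ _ => rfl)).comp_contDiffOn hα

/-- The summand $d(s^\mu d^{m-1}x_\mu)$ has constant coefficients, so only the derivative of
$-\alpha$ contributes. -/
theorem extDeriv_thetaLoc_apply [FiniteDimensional ℝ A] (x : A →L[ℝ] V) {k : ℕ}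
    {α : A × (B × (C × (V [⋀^Fin k]→L[ℝ] ℝ))) → A [⋀^Fin (k + 1)]→L[ℝ] ℝ}
    {q : A × (B × (C × (V [⋀^Fin k]→L[ℝ] ℝ)))} (hα : DifferentiableAt ℝ α q)
    (u : Fin (k + 2) → A × (B × (C × (V [⋀^Fin k]→L[ℝ] ℝ)))) :
    extDeriv (fun q => thetaLoc (B := B) (C := C) x (α q)) q u =
      -∑ i : Fin (k + 2), (-1 : ℤ) ^ (i : ℕ) •
        fderiv ℝ α q (u i) (fun j => (i.removeNth u j).1) := by
  rw [extDeriv, ContinuousAlternatingMap.alternatizeUncurryFin_apply, ← Finset.sum_neg_distrib]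
  refine Finset.sum_congr rfl fun i _ => ?_
  have h := fderiv_linear_comp (fun a : A [⋀^Fin (k + 1)]→L[ℝ] ℝ => -a.compContinuousLinearMap
    (ContinuousLinearMap.fst ℝ A (B × (C × (V [⋀^Fin k]→L[ℝ] ℝ)))))
    (fun _ _ => by ext; simp [add_comm]) (fun _ _ => by ext; simp) hα (u i)
  have h2 : fderiv ℝ (fun q => thetaLoc (B := B) (C := C) x (α q)) q =
      fderiv ℝ (fun q => -(α q).compContinuousLinearMap
        (ContinuousLinearMap.fst ℝ A (B × (C × (V [⋀^Fin k]→L[ℝ] ℝ))))) q :=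
    fderiv_add_const (𝕜 := ℝ) (x := q) (f := fun q => -(α q).compContinuousLinearMap
        (ContinuousLinearMap.fst ℝ A (B × (C × (V [⋀^Fin k]→L[ℝ] ℝ)))))
      (extDeriv (actLoc (B := B) (C := C) x (k := k)) 0)
  rw [h2, ← smul_neg]
  exact congrArg (fun a => (-1 : ℤ) ^ (i : ℕ) • a (i.removeNth u)) h

end CanonicalForms

/-! ### Charts of the total spaces induced by adapted charts -/

section NaturalCharts

variable {d n : ℕ}
  {M : Type*} [TopologicalSpace M] [ChartedSpace (Base d) M]
  {E : Type*} [TopologicalSpace E] [ChartedSpace (Mdl d n) E] {π : E → M}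
  [IsManifold 𝓘(ℝ, Base d) ∞ M] [IsManifold 𝓘(ℝ, Mdl d n) ∞ E]
  [hπ : Fact (Manifold.IsSubmersion 𝓘(ℝ, Mdl d n) 𝓘(ℝ, Base d) ∞ π)]
  {Y : E → Type*} {V : Type*} [NormedAddCommGroup V] [NormedSpace ℝ V]
  (K : FibreModel d n π Y V)

theorem AdaptedChart.fst_mem_target (c : AdaptedChart d n π) {z : Mdl d n}
    (hz : z ∈ c.ψ.target) : z.1 ∈ c.φ.target := by
  have h := c.ψ.map_target hz
  have h1 := c.proj _ h
  rw [c.ψ.right_inv hz] at h1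
  rw [← h1]
  exact c.φ.map_source (c.mapsTo _ h)

namespace FibreModel

/-- The natural chart induced by an adapted chart, as a homeomorphism. -/
def natChart (c : AdaptedChart d n π) (w₀ : K.Tot) : OpenPartialHomeomorph K.Tot (Mdl d n × V) :=
  K.core.openPartialHomeomorph (K.chart c w₀) ⟨c, w₀, rfl⟩

theorem natChart_mem (c : AdaptedChart d n π) (w₀ : K.Tot) :
    K.natChart c w₀ ∈ IsManifold.maximalAtlas 𝓘(ℝ, Mdl d n × V) ∞ K.Tot := by
  refine IsManifold.subset_maximalAtlas ?_
  simp only [atlas, ChartedSpace.atlas, mem_iUnion, mem_singleton_iff]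
  exact ⟨K.chart c w₀, ⟨c, w₀, rfl⟩, rfl⟩

theorem exists_chartAt_eq (w : K.Tot) : ∃ c : AdaptedChart d n π, w.1 ∈ c.ψ.source ∧
    chartAt (Mdl d n × V) w = K.natChart c w :=
  ⟨(exists_adaptedChart hπ.out w.1).choose, (exists_adaptedChart hπ.out w.1).choose_spec, rfl⟩

theorem natChart_apply (c : AdaptedChart d n π) (w₀ : K.Tot) {w : K.Tot}
    (hw : w.1 ∈ c.ψ.source) : K.natChart c w₀ w = (c.ψ w.1, K.coord c hw w.2) :=
  K.chartFun_apply c hw w.2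

theorem chartInv_chartFun (c : AdaptedChart d n π) (w₀ : K.Tot) {w : K.Tot}
    (hw : w.1 ∈ c.ψ.source) : K.chartInv c w₀ (K.chartFun c w) = w :=
  (K.natChart c w₀).left_inv hw

theorem isLocalRep_proj (c : AdaptedChart d n π) (w₀ : K.Tot) :
    IsLocalRep (K.natChart c w₀) c.ψ (fun w : K.Tot => w.1) Prod.fst where
  mapsTo _ hw := hw
  eq w hw := by rw [K.natChart_apply c w₀ hw]
  smooth := contDiff_fst.contDiffOn

theorem isLocalRep_base (c : AdaptedChart d n π) (w₀ : K.Tot) :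
    IsLocalRep (K.natChart c w₀) c.φ (fun w : K.Tot => π w.1) (fun q => q.1.1) where
  mapsTo w hw := c.mapsTo w.1 hw
  eq w hw := by rw [K.natChart_apply c w₀ hw, c.proj w.1 hw]
  smooth := (contDiff_fst.comp contDiff_fst).contDiffOn

theorem dchart_proj (c : AdaptedChart d n π) (w₀ : K.Tot) {w : K.Tot} (hw : w.1 ∈ c.ψ.source)
    (u : TangentSpace 𝓘(ℝ, Mdl d n × V) w) :
    dchart c.ψ w.1 (mfderiv 𝓘(ℝ, Mdl d n × V) 𝓘(ℝ, Mdl d n) (fun w : K.Tot => w.1) w u) =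
      (dchart (K.natChart c w₀) w u).1 := by
  rw [(K.isLocalRep_proj c w₀).dchart_mfderiv (K.natChart_mem c w₀) c.ψ_mem hw, fderiv_fst]
  rfl

theorem dchart_base (c : AdaptedChart d n π) (w₀ : K.Tot) {w : K.Tot} (hw : w.1 ∈ c.ψ.source)
    (u : TangentSpace 𝓘(ℝ, Mdl d n × V) w) :
    dchart c.φ (π w.1)
      (mfderiv 𝓘(ℝ, Mdl d n × V) 𝓘(ℝ, Base d) (fun w : K.Tot => π w.1) w u) =
      (dchart (K.natChart c w₀) w u).1.1 := by
  rw [(K.isLocalRep_base c w₀).dchart_mfderiv (K.natChart_mem c w₀) c.φ_mem hw]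
  have h : HasFDerivAt (fun q : Mdl d n × V => q.1.1)
      ((ContinuousLinearMap.fst ℝ (Base d) (Fin n → ℝ)).comp
        (ContinuousLinearMap.fst ℝ (Mdl d n) V)) (K.natChart c w₀ w) :=
    ((ContinuousLinearMap.fst ℝ (Base d) (Fin n → ℝ)).comp
        (ContinuousLinearMap.fst ℝ (Mdl d n) V)).hasFDerivAt
  rw [h.fderiv]
  rfl

end FibreModel

end NaturalCharts

/-! ### The Lagrangian density and the constraint that defines $\mathcal W_\circ$ -/

section LocalForms

variable {d n : ℕ}
  {M : Type*} [TopologicalSpace M] [ChartedSpace (Base d) M]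
  {E : Type*} [TopologicalSpace E] [ChartedSpace (Mdl d n) E] {π : E → M}
  [IsManifold 𝓘(ℝ, Base d) ∞ M] [IsManifold 𝓘(ℝ, Mdl d n) ∞ E]

variable (ωM : Form (Base d) M (d + 1)) (L : VelSpace d n π → ℝ)

/-- The Lagrangian density `L ω_M` in natural coordinates. -/
def lagDensity (c : AdaptedChart d n π) (p₀ : VelSpace d n π) (q : VelMdl d n) :
    Base d [⋀^Fin (d + 1)]→L[ℝ] ℝ :=
  L ((velModel d n π).chartInv c p₀ q) • inChart c.φ ωM q.1.1

/-- The projection `𝒲₀ → 𝒫` in natural coordinates. -/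
def velOfHam (q : HamMdl d n) : VelMdl d n := (q.1, (q.2.1, q.2.2.2))

/-- The coordinate `p = L - p^μ_A y^A_μ` of the points of `𝒲₀`, times `d^m x`. -/
def hamDensity (c : AdaptedChart d n π) (p₀ : VelSpace d n π) (q : HamMdl d n) :
    Base d [⋀^Fin (d + 1)]→L[ℝ] ℝ :=
  lagDensity ωM L c p₀ (velOfHam q) - pairing q.2.1 q.2.2.1

theorem contDiff_velOfHam : ContDiff ℝ ∞ (velOfHam (d := d) (n := n)) :=
  contDiff_fst.prodMk ((contDiff_fst.comp contDiff_snd).prodMk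
    (contDiff_snd.comp (contDiff_snd.comp contDiff_snd)))

variable [hπ : Fact (Manifold.IsSubmersion 𝓘(ℝ, Mdl d n) 𝓘(ℝ, Base d) ∞ π)]

theorem contDiffOn_lagDensity (hω : IsSmooth ωM) (hL : ContMDiff 𝓘(ℝ, VelMdl d n) 𝓘(ℝ, ℝ) ∞ L)
    (c : AdaptedChart d n π) (p₀ : VelSpace d n π) :
    ContDiffOn ℝ ∞ (lagDensity ωM L c p₀) (c.ψ.target ×ˢ univ) := by
  have h1 : ContDiffOn ℝ ∞ (fun q => L ((velModel d n π).chartInv c p₀ q))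
      (c.ψ.target ×ˢ univ) :=
    contMDiffOn_iff_contDiffOn.1 (hL.comp_contMDiffOn
      (contMDiffOn_symm_of_mem_maximalAtlas ((velModel d n π).natChart_mem c p₀)))
  refine h1.smul ((hω.contDiffOn_inChart c.φ_mem).comp
    (contDiff_fst.comp contDiff_fst).contDiffOn ?_)
  rintro q ⟨hq, -⟩
  exact c.fst_mem_target hq

theorem contDiffOn_hamDensity (hω : IsSmooth ωM)
    (hL : ContMDiff 𝓘(ℝ, VelMdl d n) 𝓘(ℝ, ℝ) ∞ L)
    (c : AdaptedChart d n π) (p₀ : VelSpace d n π) :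
    ContDiffOn ℝ ∞ (hamDensity ωM L c p₀) (c.ψ.target ×ˢ univ) := by
  refine ContDiffOn.sub ?_ ?_
  · refine (contDiffOn_lagDensity ωM L hω hL c p₀).comp contDiff_velOfHam.contDiffOn ?_
    rintro q ⟨hq, -⟩
    exact ⟨hq, trivial⟩
  · exact (contDiff_pairing.comp ((contDiff_fst.comp contDiff_snd).prodMk
      (contDiff_fst.comp (contDiff_snd.comp contDiff_snd)))).contDiffOn

theorem inChart_omega (c : AdaptedChart d n π) {x : M} (hx : x ∈ c.φ.source) :
    (ωM x).compContinuousLinearMap ((c.dφ hx).symm : Base d →L[ℝ] TangentSpace 𝓘(ℝ, Base d) x) =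
      inChart c.φ ωM (c.φ x) := by
  ext u
  rw [isLocalExpr_inChart c.φ_mem ωM x hx]
  change inChart c.φ ωM (c.φ x) (fun i => c.dφ hx ((c.dφ hx).symm (u i))) = _
  simp only [ContinuousLinearEquiv.apply_symm_apply]

/-- In coordinates a jet is the graph map $u\mapsto(u,\Gamma u)$. Pulling back the two parts of the
covector along it gives $p^\mu_Ay^A_\mu$ and $p$. -/
theorem coupling_coord (c : AdaptedChart d n π) {y : E} (hy : y ∈ c.ψ.source)
    (γ : Jet1 d n π y) (α : ExtMom d n π y) :
    (coupling γ α).compContinuousLinearMap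
      ((c.dφ (c.mapsTo y hy)).symm : Base d →L[ℝ] TangentSpace 𝓘(ℝ, Base d) (π y)) =
      pairing (jetCoord c hy γ) (resMap c hy α) + horPart (momEquiv c hy α).1 := by
  have h1 : ofVer (verPart (momEquiv c hy α).1) + ofHor (horPart (momEquiv c hy α).1) =
    (momEquiv c hy α).1 := ofVer_add_ofHor (momEquiv c hy α).2
  ext u
  change α.1 (fun i => γ.1 ((c.dφ (c.mapsTo y hy)).symm (u i))) = _
  rw [← momEquiv_dψ c hy α]
  simp only [← graph_jetCoord]
  conv_lhs => rw [← h1]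
  rfl

/-- The defining equation of $\mathcal W_\circ$, read through `coupling_coord`, is solved for $p$.
The points `p₀` and `w₀` are default values of inverse charts and have no influence over the domain
of `c`. -/
theorem horPart_ham (c : AdaptedChart d n π) (p₀ : VelSpace d n π) (w₀ w : HamSpace ωM L)
    (hw : w.1 ∈ c.ψ.source) : horPart (momEquiv c hw w.2.1.2.1).1 =
      hamDensity ωM L c p₀ ((hamModel ωM L).natChart c w₀ w) := by
  have h1 := congrArg (fun a => a.compContinuousLinearMap
    ((c.dφ (c.mapsTo w.1 hw)).symm : Base d →L[ℝ] TangentSpace 𝓘(ℝ, Base d) (π w.1))) w.2.2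
  have h2 : (L ⟨w.1, (w.2.1.1, w.2.1.2.2)⟩ • ωM (π w.1)).compContinuousLinearMap
      ((c.dφ (c.mapsTo w.1 hw)).symm : Base d →L[ℝ] TangentSpace 𝓘(ℝ, Base d) (π w.1)) =
      L ⟨w.1, (w.2.1.1, w.2.1.2.2)⟩ • inChart c.φ ωM (c.φ (π w.1)) := by
    rw [← inChart_omega]
    rfl
  have h3 : pairing (jetCoord c hw w.2.1.1) (resMap c hw w.2.1.2.1) +
      horPart (momEquiv c hw w.2.1.2.1).1 =
        L ⟨w.1, (w.2.1.1, w.2.1.2.2)⟩ • inChart c.φ ωM (c.φ (π w.1)) :=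
    (coupling_coord c hw w.2.1.1 w.2.1.2.1).symm.trans (h1.trans h2)
  rw [(hamModel ωM L).natChart_apply c w₀ hw]
  have h4 : (velModel d n π).chartInv c p₀ (velOfHam (c.ψ w.1, (hamModel ωM L).coord c hw w.2)) =
      ⟨w.1, (w.2.1.1, w.2.1.2.2)⟩ := by
    have h5 := (velModel d n π).chartInv_chartFun c p₀ (w := ⟨w.1, (w.2.1.1, w.2.1.2.2)⟩) hw
    rw [(velModel d n π).chartFun_apply c hw] at h5
    exact h5
  rw [hamDensity, lagDensity, h4]
  rw [c.proj w.1 hw] at h3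
  exact eq_sub_of_add_eq' h3

end LocalForms

/-! ### The canonical form of $\mathcal W$ in coordinates -/

section ExtendedForms

variable {d n : ℕ}
  {M : Type*} [TopologicalSpace M] [ChartedSpace (Base d) M]
  {E : Type*} [TopologicalSpace E] [ChartedSpace (Mdl d n) E] {π : E → M}
  [IsManifold 𝓘(ℝ, Base d) ∞ M] [IsManifold 𝓘(ℝ, Mdl d n) ∞ E]
  [hπ : Fact (Manifold.IsSubmersion 𝓘(ℝ, Mdl d n) 𝓘(ℝ, Base d) ∞ π)]

/-- The coordinates `x^μ` on the model space of `E`. -/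
abbrev baseCoord (d n : ℕ) : Mdl d n →L[ℝ] Base d :=
  ContinuousLinearMap.fst ℝ (Base d) (Fin n → ℝ)

theorem isLocalExpr_tautAct (c : AdaptedChart d n π) (w₀ : ExtSpace d n π) :
    IsLocalExpr ((extModel d n π).natChart c w₀) (tautAct d n π) (actLoc (baseCoord d n)) := by
  intro w hw
  ext u
  rw [(extModel d n π).natChart_apply c w₀ hw]
  change w.2.2.2 (fun i => _) = w.2.2.2 (fun i => (c.dφ (c.mapsTo w.1 hw)).symm
    (dchart ((extModel d n π).natChart c w₀) w (u i)).1.1)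
  refine congrArg w.2.2.2 (funext fun i => ?_)
  rw [← (extModel d n π).dchart_base c w₀ hw]
  exact ((c.dφ (c.mapsTo w.1 hw)).symm_apply_apply _).symm

/-- The tautological $m$-form at a point is the momentum of that point pulled back from $E$, so its
expression is rebuilt by `ofParts` from the coordinates $p^\mu_A,p$. The other summand is the chart
expression of $d\theta$. -/
theorem isLocalExpr_thetaExt (c : AdaptedChart d n π) (w₀ : ExtSpace d n π) :
    IsLocalExpr ((extModel d n π).natChart c w₀) (thetaExt d n π)
      (fun q => thetaLoc (baseCoord d n) (ofParts d n q.2.2.1)) := by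
  intro w hw
  have hd := differentiableOn_actLoc (B := JetMdl d n) (C := ExtMomMdl d n) (k := d)
    (baseCoord d n) ((extModel d n π).natChart c w₀).target
  have h2 := (isLocalExpr_tautAct c w₀).extD ((extModel d n π).natChart_mem c w₀)
    hd w hw
  ext u
  have h3 := congrArg (fun a => a u) h2
  have h4 : tautMom d n π w u = ofParts d n ((extModel d n π).natChart c w₀ w).2.2.1
      (fun i => (dchart ((extModel d n π).natChart c w₀) w (u i)).1) := by
    have e : ofParts d n (parts d n (momEquiv c hw w.2.2.1).1) = (momEquiv c hw w.2.2.1).1 :=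
      ofVer_add_ofHor (momEquiv c hw w.2.2.1).2
    have e' : ((extModel d n π).natChart c w₀ w).2.2.1 = parts d n (momEquiv c hw w.2.2.1).1 := by
      rw [(extModel d n π).natChart_apply c w₀ hw]
      rfl
    rw [e', e]
    simp only [← (extModel d n π).dchart_proj c w₀ hw]
    exact (momEquiv_dψ c hw w.2.2.1 _).symm
  have h5 : thetaExt d n π w u = -tautMom d n π w u + extD (tautAct d n π) w u := rfl
  rw [h5, h3, h4]
  change _ = thetaLoc (baseCoord d n) _ (fun i => dchart ((extModel d n π).natChart c w₀) w (u i))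
  rw [thetaLoc_apply]
  congr 1
  exact extDeriv_actLoc_apply _ _ _

end ExtendedForms

/-! ### $\Theta_\circ$ and $d\Theta_\circ$ in coordinates -/

section HamiltonianForms

set_option maxSynthPendingDepth 6

variable {d n : ℕ}

theorem thetaLoc_ofParts (X : ExtMomMdl d n) (u : Fin (d + 1) → HamMdl d n) :
    thetaLoc (B := JetMdl d n) (C := MomMdl d n) (baseCoord d n) (ofParts d n X) u =
      thetaVal X u := by
  rw [thetaLoc_apply, ofParts_apply, thetaVal]
  simp only [ContinuousAlternatingMap.sub_apply, smul_sub, Finset.sum_sub_distrib]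
  change -(_ + _) + ∑ i : Fin (d + 1), (-1 : ℤ) ^ (i : ℕ) •
      (u i).2.2.2 (fun j => (i.removeNth u j).1.1) = _ - ∑ i : Fin (d + 1), (-1 : ℤ) ^ (i : ℕ) •
        X.1 (u i).1.2 (fun j => (i.removeNth u j).1.1) - X.2 (fun i => (u i).1.1)
  simp only [Fin.removeNth]
  ring

/-- `ofParts` is linear, so differentiating the covector with coordinates $(p^\mu_A,h)$ along `u`
yields the one with coordinates $(u(p^\mu_A),dh(u))$. The `D` of the linear model is thus the
differential of the density `h`. -/
theorem extDeriv_thetaLoc_ofParts {h : HamMdl d n → Base d [⋀^Fin (d + 1)]→L[ℝ] ℝ}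
    {q : HamMdl d n} (hh : DifferentiableAt ℝ h q) (u : Fin (d + 2) → HamMdl d n) :
    extDeriv (fun q : HamMdl d n => thetaLoc (B := JetMdl d n) (C := MomMdl d n) (baseCoord d n)
      (ofParts d n (q.2.2.1, h q))) q u = dthetaVal (fderiv ℝ h q).toLinearMap u := by
  have h1 : DifferentiableAt ℝ (fun q : HamMdl d n => ofParts d n (q.2.2.1, h q)) q :=
    ((contDiff_ofParts d n).differentiable (by simp)).differentiableAt.comp q
      (differentiableAt_third_prodMk hh)
  rw [extDeriv_thetaLoc_apply _ h1, dthetaVal]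
  congr 1
  refine Finset.sum_congr rfl fun i _ => ?_
  have h2 := fderiv_linear_comp (ofParts d n)
    (fun a b => by
      change ofVer (a.1 + b.1) + ofHor (a.2 + b.2) = _
      rw [map_add, map_add]
      exact add_add_add_comm _ _ _ _)
    (fun r a => by
      change ofVer (r • a.1) + ofHor (r • a.2) = _
      rw [map_smul, map_smul]
      exact (smul_add _ _ _).symm)
    (differentiableAt_third_prodMk hh) (u i)
  rw [fderiv_third_prodMk hh] at h2
  rw [h2]
  rfl

variable {M : Type*} [TopologicalSpace M] [ChartedSpace (Base d) M]
  {E : Type*} [TopologicalSpace E] [ChartedSpace (Mdl d n) E] {π : E → M}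
  [IsManifold 𝓘(ℝ, Base d) ∞ M] [IsManifold 𝓘(ℝ, Mdl d n) ∞ E]
  [hπ : Fact (Manifold.IsSubmersion 𝓘(ℝ, Mdl d n) 𝓘(ℝ, Base d) ∞ π)]
  {ωM : Form (Base d) M (d + 1)} {L : VelSpace d n π → ℝ}

/-- The inclusion `𝒲₀ → 𝒲` in natural coordinates. -/
def inclLoc (h : HamMdl d n → Base d [⋀^Fin (d + 1)]→L[ℝ] ℝ) (q : HamMdl d n) : ExtMdl d n :=
  (q.1, (q.2.1, ((q.2.2.1, h q), q.2.2.2)))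

theorem contDiffOn_inclLoc {h : HamMdl d n → Base d [⋀^Fin (d + 1)]→L[ℝ] ℝ}
    {U : Set (HamMdl d n)} (hh : ContDiffOn ℝ ∞ h U) : ContDiffOn ℝ ∞ (inclLoc h) U :=
  contDiff_fst.contDiffOn.prodMk ((contDiff_fst.comp contDiff_snd).contDiffOn.prodMk
    (((contDiff_fst.comp (contDiff_snd.comp contDiff_snd)).contDiffOn.prodMk hh).prodMk
      (contDiff_snd.comp (contDiff_snd.comp contDiff_snd)).contDiffOn))

theorem isLocalRep_incl (hω : IsSmooth ωM) (hL : ContMDiff 𝓘(ℝ, VelMdl d n) 𝓘(ℝ, ℝ) ∞ L)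
    (c : AdaptedChart d n π) (p₀ : VelSpace d n π) (w₀ : HamSpace ωM L) :
    IsLocalRep ((hamModel ωM L).natChart c w₀) ((extModel d n π).natChart c (incl ωM L w₀))
      (incl ωM L) (inclLoc (hamDensity ωM L c p₀)) where
  mapsTo _ hw := hw
  eq w hw := by
    have h := horPart_ham ωM L c p₀ w₀ w hw
    have h' := (hamModel ωM L).natChart_apply c w₀ hw
    rw [(extModel d n π).natChart_apply c (incl ωM L w₀) (w := incl ωM L w) hw, inclLoc, ← h, h']
    rfl
  smooth := contDiffOn_inclLoc (contDiffOn_hamDensity ωM L hω hL c p₀)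

theorem differentiableAt_hamDensity (hω : IsSmooth ωM)
    (hL : ContMDiff 𝓘(ℝ, VelMdl d n) 𝓘(ℝ, ℝ) ∞ L) (c : AdaptedChart d n π)
    (p₀ : VelSpace d n π) {q : HamMdl d n} (hq : q.1 ∈ c.ψ.target) :
    DifferentiableAt ℝ (hamDensity ωM L c p₀) q :=
  ((contDiffOn_hamDensity ωM L hω hL c p₀).contDiffAt
    ((c.ψ.open_target.prod isOpen_univ).mem_nhds ⟨hq, trivial⟩)).differentiableAt (by simp)

/-- The form `Θ₀` in natural coordinates. -/
def thetaHamLoc (ωM : Form (Base d) M (d + 1)) (L : VelSpace d n π → ℝ)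
    (c : AdaptedChart d n π) (p₀ : VelSpace d n π) (q : HamMdl d n) :
    AltForm (HamMdl d n) (d + 1) :=
  thetaLoc (B := JetMdl d n) (C := MomMdl d n) (baseCoord d n)
    (ofParts d n (q.2.2.1, hamDensity ωM L c p₀ q))

theorem contDiffOn_thetaHamLoc (hω : IsSmooth ωM)
    (hL : ContMDiff 𝓘(ℝ, VelMdl d n) 𝓘(ℝ, ℝ) ∞ L) (c : AdaptedChart d n π)
    (p₀ : VelSpace d n π) :
    ContDiffOn ℝ ∞ (thetaHamLoc ωM L c p₀) (c.ψ.target ×ˢ univ) :=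
  contDiffOn_thetaLoc _ ((contDiff_ofParts d n).comp_contDiffOn
    ((contDiff_fst.comp (contDiff_snd.comp contDiff_snd)).contDiffOn.prodMk
      (contDiffOn_hamDensity ωM L hω hL c p₀)))

/-- The pull-back along the inclusion only substitutes the value of $p$; its derivative disappears
by `thetaLoc_comp_fderiv`. -/
theorem isLocalExpr_thetaHam (hω : IsSmooth ωM)
    (hL : ContMDiff 𝓘(ℝ, VelMdl d n) 𝓘(ℝ, ℝ) ∞ L) (c : AdaptedChart d n π)
    (p₀ : VelSpace d n π) (w₀ : HamSpace ωM L) :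
    IsLocalExpr ((hamModel ωM L).natChart c w₀) (thetaHam ωM L) (thetaHamLoc ωM L c p₀) := by
  have hF := isLocalRep_incl hω hL c p₀ w₀
  refine ((isLocalExpr_thetaExt c (incl ωM L w₀)).pullback ((hamModel ωM L).natChart_mem c w₀)
    ((extModel d n π).natChart_mem c (incl ωM L w₀)) hF).congr ?_
  intro q hq
  refine ContinuousAlternatingMap.ext fun u => ?_
  exact thetaLoc_comp_fderiv (baseCoord d n) _ ((hF.smooth.contDiffAt
    (((hamModel ωM L).natChart c w₀).open_target.mem_nhds hq)).differentiableAt (by simp))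
    (fun _ => rfl) (fun _ => rfl) u

theorem isLocalExpr_extD_thetaHam (hω : IsSmooth ωM)
    (hL : ContMDiff 𝓘(ℝ, VelMdl d n) 𝓘(ℝ, ℝ) ∞ L) (c : AdaptedChart d n π)
    (p₀ : VelSpace d n π) (w₀ : HamSpace ωM L) :
    IsLocalExpr ((hamModel ωM L).natChart c w₀) (extD (thetaHam ωM L))
      (extDeriv (thetaHamLoc ωM L c p₀)) :=
  (isLocalExpr_thetaHam hω hL c p₀ w₀).extD ((hamModel ωM L).natChart_mem c w₀)
    ((contDiffOn_thetaHamLoc hω hL c p₀).differentiableOn (by simp))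

end HamiltonianForms

/-! ### Forms pulled back from the base; the projection onto $M$ -/

section PulledBack

variable {d n : ℕ}
  {M : Type*} [TopologicalSpace M] [ChartedSpace (Base d) M]
  {E : Type*} [TopologicalSpace E] [ChartedSpace (Mdl d n) E] {π : E → M}
  [IsManifold 𝓘(ℝ, Base d) ∞ M] [IsManifold 𝓘(ℝ, Mdl d n) ∞ E]
  [hπ : Fact (Manifold.IsSubmersion 𝓘(ℝ, Mdl d n) 𝓘(ℝ, Base d) ∞ π)]
  {Y : E → Type*} {V : Type*} [NormedAddCommGroup V] [NormedSpace ℝ V]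
  (K : FibreModel d n π Y V)

/-- A form on the base, pulled back to the total space of a bundle, in natural coordinates. -/
def baseFormLoc (V : Type*) [NormedAddCommGroup V] [NormedSpace ℝ V] (c : AdaptedChart d n π)
    {k : ℕ} (η : Form (Base d) M k) (q : Mdl d n × V) : AltForm (Mdl d n × V) k :=
  (inChart c.φ η q.1.1).compContinuousLinearMap
    ((baseCoord d n).comp (ContinuousLinearMap.fst ℝ (Mdl d n) V))

theorem contDiffOn_baseFormLoc {k : ℕ} {η : Form (Base d) M k} (hη : IsSmooth η)
    (c : AdaptedChart d n π) :
    ContDiffOn ℝ ∞ (baseFormLoc V c η) (c.ψ.target ×ˢ univ) := by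
  refine (contDiff_of_linear (fun a : Base d [⋀^Fin k]→L[ℝ] ℝ => a.compContinuousLinearMap
    ((baseCoord d n).comp (ContinuousLinearMap.fst ℝ (Mdl d n) V)))
    (fun _ _ => rfl) (fun _ _ => rfl)).comp_contDiffOn
      ((hη.contDiffOn_inChart c.φ_mem).comp (contDiff_fst.comp contDiff_fst).contDiffOn ?_)
  rintro q ⟨hq, -⟩
  exact c.fst_mem_target hq

/-- The exterior derivative commutes with the pull-back, and a form of degree $m+1$ on $\mathbb R^m$
is zero. This makes $\omega$ closed. -/
theorem extDeriv_baseFormLoc {η : Form (Base d) M (d + 1)} (hη : IsSmooth η)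
    (c : AdaptedChart d n π) {q : Mdl d n × V} (hq : q.1 ∈ c.ψ.target) :
    extDeriv (baseFormLoc V c η) q = 0 := by
  let l := (baseCoord d n).comp (ContinuousLinearMap.fst ℝ (Mdl d n) V)
  have h1 : DifferentiableAt ℝ (inChart c.φ η) (l q) :=
    ((hη.contDiffOn_inChart c.φ_mem).contDiffAt
      (c.φ.open_target.mem_nhds (c.fst_mem_target hq))).differentiableAt (by simp)
  have h2 := extDeriv_pullback (r := ∞) h1 l.contDiff.contDiffAt
    (by simpa using ENat.LEInfty.out (m := 2))
  have h3 : baseFormLoc V c η = fun q => (inChart c.φ η (l q)).compContinuousLinearMap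
      (fderiv ℝ l q) := by
    funext q
    rw [l.fderiv]
    rfl
  rw [h3, h2, form_eq_zero_of_card_lt (extDeriv (inChart c.φ η) (l q))]
  rfl

theorem FibreModel.isLocalExpr_baseForm (c : AdaptedChart d n π) (w₀ : K.Tot) {k : ℕ}
    (η : Form (Base d) M k) : IsLocalExpr (K.natChart c w₀)
      (pullback (fun w : K.Tot => π w.1) η) (baseFormLoc V c η) := by
  intro w hw
  ext u
  have h := congrArg (fun a => a (fun i => mfderiv 𝓘(ℝ, Mdl d n × V) 𝓘(ℝ, Base d)
    (fun w : K.Tot => π w.1) w (u i))) (isLocalExpr_inChart c.φ_mem η (π w.1) (c.mapsTo w.1 hw))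
  refine h.trans ?_
  change inChart c.φ η _ (fun i => dchart c.φ (π w.1) (mfderiv 𝓘(ℝ, Mdl d n × V) 𝓘(ℝ, Base d)
    (fun w : K.Tot => π w.1) w (u i))) = _
  simp only [K.dchart_base c w₀ hw]
  rw [c.proj w.1 hw, K.natChart_apply c w₀ hw]
  rfl

theorem FibreModel.isSmooth_baseForm {k : ℕ} {η : Form (Base d) M k} (hη : IsSmooth η) :
    IsSmooth (pullback (V := Mdl d n × V) (fun w : K.Tot => π w.1) η) := by
  refine isSmooth_of_localExpr fun w => ?_
  obtain ⟨c, -, h⟩ := K.exists_chartAt_eq w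
  rw [h]
  exact ⟨_, K.isLocalExpr_baseForm c w η, contDiffOn_baseFormLoc hη c⟩

theorem FibreModel.extD_baseForm {η : Form (Base d) M (d + 1)} (hη : IsSmooth η) (w : K.Tot) :
    extD (pullback (V := Mdl d n × V) (fun w : K.Tot => π w.1) η) w = 0 := by
  obtain ⟨c, hw, -⟩ := K.exists_chartAt_eq w
  rw [(K.isLocalExpr_baseForm c w η).extD (K.natChart_mem c w)
    ((contDiffOn_baseFormLoc hη c).differentiableOn (by simp)) w hw, extDeriv_baseFormLoc hη c]
  · rfl
  · rw [K.natChart_apply c w hw]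
    exact c.ψ.map_source hw

theorem FibreModel.contMDiff_base : ContMDiff 𝓘(ℝ, Mdl d n × V) 𝓘(ℝ, Base d) ∞
    (fun w : K.Tot => π w.1) := by
  intro w
  obtain ⟨c, hw, -⟩ := K.exists_chartAt_eq w
  exact (K.isLocalRep_base c w).contMDiffAt (K.natChart_mem c w) c.φ_mem hw

/-- The components along the fibres of the lift of `v` are free. This gives the submersion property,
and it lets the momentum component be adjusted in the proof of transversality. -/
theorem FibreModel.exists_mfderiv_base_eq (c : AdaptedChart d n π) (w₀ : K.Tot) {w : K.Tot}
    (hw : w.1 ∈ c.ψ.source) (v : TangentSpace 𝓘(ℝ, Base d) (π w.1)) (y : Fin n → ℝ) (x : V) :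
    ∃ u : TangentSpace 𝓘(ℝ, Mdl d n × V) w,
      dchart (K.natChart c w₀) w u = ((dchart c.φ (π w.1) v, y), x) ∧
      mfderiv 𝓘(ℝ, Mdl d n × V) 𝓘(ℝ, Base d) (fun w : K.Tot => π w.1) w u = v := by
  let e := dchartEquiv (K.natChart_mem c w₀) (show w ∈ (K.natChart c w₀).source from hw)
  have h : dchart (K.natChart c w₀) w (e.symm ((dchart c.φ (π w.1) v, y), x)) =
    ((dchart c.φ (π w.1) v, y), x) := e.apply_symm_apply _
  refine ⟨e.symm ((dchart c.φ (π w.1) v, y), x), h, ?_⟩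
  apply (dchartEquiv c.φ_mem (c.mapsTo w.1 hw)).injective
  rw [dchartEquiv_apply, K.dchart_base c w₀ hw, h]
  rfl

end PulledBack

/-! ### Reduction of the geometry of $\mathcal W_\circ$ to the linear model -/

section HamiltonianModelAt

set_option maxSynthPendingDepth 6

variable {d n : ℕ}
  {M : Type*} [TopologicalSpace M] [ChartedSpace (Base d) M]
  {E : Type*} [TopologicalSpace E] [ChartedSpace (Mdl d n) E] {π : E → M}
  [IsManifold 𝓘(ℝ, Base d) ∞ M] [IsManifold 𝓘(ℝ, Mdl d n) ∞ E]
  [hπ : Fact (Manifold.IsSubmersion 𝓘(ℝ, Mdl d n) 𝓘(ℝ, Base d) ∞ π)]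
  {ωM : Form (Base d) M (d + 1)} {L : VelSpace d n π → ℝ}

/-- The coordinates of the tangent vectors of `𝒲₀` induced by an adapted chart. -/
def hamTangent (c : AdaptedChart d n π) {w : HamSpace ωM L} (hw : w.1 ∈ c.ψ.source) :
    TangentSpace 𝓘(ℝ, HamMdl d n) w ≃ₗ[ℝ] HamMdl d n :=
  (dchartEquiv ((hamModel ωM L).natChart_mem c w)
    (show w ∈ ((hamModel ωM L).natChart c w).source from hw)).toLinearEquiv

/-- The differential of the coordinate `p` on `𝒲₀`. -/
def hamDiff (c : AdaptedChart d n π) (p₀ : VelSpace d n π) (w : HamSpace ωM L) :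
    HamMdl d n →ₗ[ℝ] Base d [⋀^Fin (d + 1)]→L[ℝ] ℝ :=
  (fderiv ℝ (hamDensity ωM L c p₀) ((hamModel ωM L).natChart c w w)).toLinearMap

/-- This is the bridge from the manifold to linear algebra: the rank conditions, condition (4) and
the dissipation equation at `w` become statements about the differential of $p$. -/
theorem isHamModel (hω : IsVolumeForm ωM) (hL : ContMDiff 𝓘(ℝ, VelMdl d n) 𝓘(ℝ, ℝ) ∞ L)
    (c : AdaptedChart d n π) (p₀ : VelSpace d n π) {w : HamSpace ωM L} (hw : w.1 ∈ c.ψ.source) :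
    IsHamModel (hamTangent c hw) (thetaHam ωM L w) (extD (thetaHam ωM L) w) (omegaHam ωM L w)
      (((hamModel ωM L).natChart c w w).2.2.1,
        hamDensity ωM L c p₀ ((hamModel ωM L).natChart c w w))
      (hamDiff c p₀ w) (inChart c.φ ωM (c.φ (π w.1))) where
  theta u := by
    rw [isLocalExpr_thetaHam hω.1 hL c p₀ w w hw]
    exact thetaLoc_ofParts _ _
  dtheta u := by
    rw [isLocalExpr_extD_thetaHam hω.1 hL c p₀ w w hw]
    refine extDeriv_thetaLoc_ofParts (differentiableAt_hamDensity hω.1 hL c _ ?_) _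
    exact (((hamModel ωM L).natChart c w).map_source hw).1
  omega u := by
    have h := (hamModel ωM L).isLocalExpr_baseForm c w ωM w hw
    have h2 : ((hamModel ωM L).natChart c w w).1.1 = c.φ (π w.1) := by
      rw [(hamModel ωM L).natChart_apply c w hw, c.proj w.1 hw]
    rw [← h2]
    exact congrArg (fun a => a u) h
  omega_ne := by
    intro h
    have h1 := isLocalExpr_inChart c.φ_mem ωM (π w.1) (c.mapsTo w.1 hw)
    rw [h] at h1
    exact hω.2 _ h1

theorem isLocalRep_prMom (c : AdaptedChart d n π) (w₀ : HamSpace ωM L) :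
    IsLocalRep ((hamModel ωM L).natChart c w₀) ((momModel d n π).natChart c (prMom ωM L w₀))
      (prMom ωM L) (fun q => (q.1, q.2.2)) where
  mapsTo _ hw := hw
  eq w hw := by
    have h' := (hamModel ωM L).natChart_apply c w₀ hw
    rw [(momModel d n π).natChart_apply c (prMom ωM L w₀) (w := prMom ωM L w) hw, h']
    rfl
  smooth := (contDiff_fst.prodMk (contDiff_snd.comp contDiff_snd)).contDiffOn

theorem mfderiv_prMom_eq_zero_iff (c : AdaptedChart d n π) {w : HamSpace ωM L}
    (hw : w.1 ∈ c.ψ.source) (X : TangentSpace 𝓘(ℝ, HamMdl d n) w) :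
    mfderiv 𝓘(ℝ, HamMdl d n) 𝓘(ℝ, MomSpaceMdl d n) (prMom ωM L) w X = 0 ↔
      (hamTangent c hw X).1 = 0 ∧ (hamTangent c hw X).2.2 = 0 := by
  have h := (isLocalRep_prMom c w).dchart_mfderiv ((hamModel ωM L).natChart_mem c w)
    ((momModel d n π).natChart_mem c (prMom ωM L w)) hw X
  rw [← (dchartEquiv ((momModel d n π).natChart_mem c (prMom ωM L w))
    (show prMom ωM L w ∈ _ from hw)).map_eq_zero_iff, dchartEquiv_apply, h, fderiv_forget]
  exact Prod.ext_iff

/-- The vertical vectors of $\mathcal W_\circ\to\mathcal P^*$ are the jet directions. These are Reeb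
vectors, so $i_Xd\Theta_\circ=-D(X)\,d^mx$, and its vanishing for all of them says $\partial
p/\partial y^A_\mu=0$. -/
theorem mem_W1_iff (hω : IsVolumeForm ωM) (hL : ContMDiff 𝓘(ℝ, VelMdl d n) 𝓘(ℝ, ℝ) ∞ L)
    (c : AdaptedChart d n π) (p₀ : VelSpace d n π) {w : HamSpace ωM L} (hw : w.1 ∈ c.ψ.source) :
    w ∈ W1 ωM L ↔ velPart (hamDiff c p₀ w) = 0 := by
  have hm := isHamModel hω hL c p₀ hw
  have key : ∀ X, interior X (extD (thetaHam ωM L) w) = 0 ↔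
      ∀ u, dthetaVal (hamDiff c p₀ w) (Matrix.vecCons (hamTangent c hw X) u) = 0 := by
    intro X
    constructor
    · intro h u
      have h1 := congrArg (fun a => a (fun i => (hamTangent c hw).symm (u i))) h
      have h2 := (hm.dtheta (Matrix.vecCons X (fun i => (hamTangent c hw).symm (u i)))).symm.trans h1
      rw [comp_vecCons (hamTangent c hw)] at h2
      simpa using h2
    · intro h
      refine ContinuousAlternatingMap.ext fun u => (hm.dtheta (Matrix.vecCons X u)).trans ?_
      rw [comp_vecCons (hamTangent c hw)]
      exact h _
  constructor
  · intro h
    refine LinearMap.ext fun Γ => ?_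
    have hX : hamTangent c hw ((hamTangent c hw).symm (0, (Γ, 0))) = (0, (Γ, 0)) :=
      (hamTangent c hw).apply_symm_apply _
    have h1 := (key _).1 (h ((hamTangent c hw).symm (0, (Γ, 0)))
      ((mfderiv_prMom_eq_zero_iff c hw _).2 (by rw [hX]; exact ⟨rfl, rfl⟩)))
    rw [hX] at h1
    exact (dthetaVal_reeb_eq_zero_iff (hamDiff c p₀ w) rfl rfl).1 h1
  · intro h X hX
    obtain ⟨h1, h2⟩ := (mfderiv_prMom_eq_zero_iff c hw X).1 hX
    rw [key, dthetaVal_reeb_eq_zero_iff _ h1 (by rw [h2]; rfl)]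
    have h3 : hamTangent c hw X = (0, ((hamTangent c hw X).2.1, 0)) :=
      Prod.ext h1 (Prod.ext rfl h2)
    rw [h3]
    exact LinearMap.congr_fun h (hamTangent c hw X).2.1

end HamiltonianModelAt

/-! ### The equations of $\mathcal W_1$; submanifold and transversality -/

section LegendreEquations

set_option maxSynthPendingDepth 6

variable {d n : ℕ}
  {M : Type*} [TopologicalSpace M] [ChartedSpace (Base d) M]
  {E : Type*} [TopologicalSpace E] [ChartedSpace (Mdl d n) E] {π : E → M}
  [IsManifold 𝓘(ℝ, Base d) ∞ M] [IsManifold 𝓘(ℝ, Mdl d n) ∞ E]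
  [hπ : Fact (Manifold.IsSubmersion 𝓘(ℝ, Mdl d n) 𝓘(ℝ, Base d) ∞ π)]
  {ωM : Form (Base d) M (d + 1)} {L : VelSpace d n π → ℝ}

theorem differentiableAt_lagDensity (hω : IsSmooth ωM)
    (hL : ContMDiff 𝓘(ℝ, VelMdl d n) 𝓘(ℝ, ℝ) ∞ L) (c : AdaptedChart d n π)
    (p₀ : VelSpace d n π) {q : VelMdl d n} (hq : q.1 ∈ c.ψ.target) :
    DifferentiableAt ℝ (lagDensity ωM L c p₀) q :=
  ((contDiffOn_lagDensity ωM L hω hL c p₀).contDiffAt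
    ((c.ψ.open_target.prod isOpen_univ).mem_nhds ⟨hq, trivial⟩)).differentiableAt (by simp)

theorem fderiv_hamDensity (hω : IsSmooth ωM)
    (hL : ContMDiff 𝓘(ℝ, VelMdl d n) 𝓘(ℝ, ℝ) ∞ L) (c : AdaptedChart d n π)
    (p₀ : VelSpace d n π) {q : HamMdl d n} (hq : q.1 ∈ c.ψ.target) (u : HamMdl d n) :
    fderiv ℝ (hamDensity ωM L c p₀) q u =
      fderiv ℝ (lagDensity ωM L c p₀) (velOfHam q) (velOfHam u) -
        (pairing q.2.1 u.2.2.1 + pairing u.2.1 q.2.2.1) :=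
  fderiv_sub_bilinear (pairingLin d n) (v := q)
    (differentiableAt_lagDensity (q := velOfHam q) hω hL c p₀ hq) u

/-- The functions `∂L/∂y^A_μ` in natural coordinates. -/
def velMomentum (ωM : Form (Base d) M (d + 1)) (L : VelSpace d n π → ℝ) (c : AdaptedChart d n π)
    (p₀ : VelSpace d n π) (q : VelMdl d n) (i : Fin (n * (d + 1))) : ℝ :=
  fderiv ℝ (lagDensity ωM L c p₀) q
    (0, (jetUnit (finProdFinEquiv.symm i).2 (finProdFinEquiv.symm i).1, 0)) (frame d)

/-- The functions `p^μ_A` in natural coordinates. -/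
def momentum (d n : ℕ) : MomMdl d n →ₗ[ℝ] (Fin (n * (d + 1)) → ℝ) where
  toFun P i := pairing (jetUnit (finProdFinEquiv.symm i).2 (finProdFinEquiv.symm i).1) P (frame d)
  map_add' P P' := funext fun i => congrArg (fun a => a (frame d))
    ((pairingLin d n (jetUnit (finProdFinEquiv.symm i).2 (finProdFinEquiv.symm i).1)).map_add P P')
  map_smul' r P := funext fun i => congrArg (fun a => a (frame d))
    ((pairingLin d n (jetUnit (finProdFinEquiv.symm i).2 (finProdFinEquiv.symm i).1)).map_smul r P)

theorem momentum_surjective : Function.Surjective (momentum d n) := by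
  intro p
  obtain ⟨P, hP⟩ := exists_momentum (fun μ A => p (finProdFinEquiv (A, μ)))
  refine ⟨P, funext fun i => ?_⟩
  exact (hP _ _).trans (congrArg p (finProdFinEquiv.apply_symm_apply i))

/-- The functions `∂L/∂y^A_μ - p^μ_A` in natural coordinates. -/
def legendreDefect (ωM : Form (Base d) M (d + 1)) (L : VelSpace d n π → ℝ)
    (c : AdaptedChart d n π) (p₀ : VelSpace d n π) (q : HamMdl d n) : Fin (n * (d + 1)) → ℝ :=
  velMomentum ωM L c p₀ (velOfHam q) - momentum d n q.2.2.1

theorem contDiffOn_velMomentum (hω : IsSmooth ωM)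
    (hL : ContMDiff 𝓘(ℝ, VelMdl d n) 𝓘(ℝ, ℝ) ∞ L) (c : AdaptedChart d n π)
    (p₀ : VelSpace d n π) :
    ContDiffOn ℝ ∞ (velMomentum ωM L c p₀) (c.ψ.target ×ˢ univ) := by
  refine contDiffOn_pi.2 fun i => ?_
  exact (contDiff_of_linear (fun a : Base d [⋀^Fin (d + 1)]→L[ℝ] ℝ => a (frame d))
    (fun _ _ => rfl) (fun _ _ => rfl)).comp_contDiffOn
      (((contDiffOn_lagDensity ωM L hω hL c p₀).fderiv_of_isOpen
        (c.ψ.open_target.prod isOpen_univ) (by simp)).clm_apply contDiffOn_const)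

theorem contDiffOn_legendreDefect (hω : IsSmooth ωM)
    (hL : ContMDiff 𝓘(ℝ, VelMdl d n) 𝓘(ℝ, ℝ) ∞ L) (c : AdaptedChart d n π)
    (p₀ : VelSpace d n π) :
    ContDiffOn ℝ ∞ (legendreDefect ωM L c p₀) (c.ψ.target ×ˢ univ) := by
  refine ContDiffOn.sub ?_ ?_
  · refine (contDiffOn_velMomentum hω hL c p₀).comp contDiff_velOfHam.contDiffOn ?_
    rintro q ⟨hq, -⟩
    exact ⟨hq, trivial⟩
  · exact ((contDiff_of_linear (momentum d n) (map_add _) (map_smul _)).comp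
      (contDiff_fst.comp (contDiff_snd.comp contDiff_snd))).contDiffOn

theorem fderiv_legendreDefect (hω : IsSmooth ωM)
    (hL : ContMDiff 𝓘(ℝ, VelMdl d n) 𝓘(ℝ, ℝ) ∞ L) (c : AdaptedChart d n π)
    (p₀ : VelSpace d n π) {q : HamMdl d n} (hq : q.1 ∈ c.ψ.target) (u : HamMdl d n) :
    fderiv ℝ (legendreDefect ωM L c p₀) q u =
      fderiv ℝ (velMomentum ωM L c p₀) (velOfHam q) (velOfHam u) - momentum d n u.2.2.1 :=
  fderiv_sub_linear (momentum d n) (v := q)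
    (((contDiffOn_velMomentum hω hL c p₀).contDiffAt (x := velOfHam q)
      ((c.ψ.open_target.prod isOpen_univ).mem_nhds ⟨hq, trivial⟩)).differentiableAt (by simp)) u

theorem natChart_fst_mem (c : AdaptedChart d n π) (w₀ : HamSpace ωM L) {w : HamSpace ωM L}
    (hw : w.1 ∈ c.ψ.source) : ((hamModel ωM L).natChart c w₀ w).1 ∈ c.ψ.target :=
  (((hamModel ωM L).natChart c w₀).map_source hw).1

/-- The derivative of $p=L-p^\mu_Ay^A_\mu$ along $y^A_\mu$ is $\partial L/\partial y^A_\mu-p^\mu_A$.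
As the chart is only adapted, $L$ stands here for the coefficient of the density $L\omega_M$. -/
theorem mem_W1_iff_legendreDefect (hω : IsVolumeForm ωM)
    (hL : ContMDiff 𝓘(ℝ, VelMdl d n) 𝓘(ℝ, ℝ) ∞ L) (c : AdaptedChart d n π)
    (p₀ : VelSpace d n π) (w₀ : HamSpace ωM L) {w : HamSpace ωM L} (hw : w.1 ∈ c.ψ.source) :
    w ∈ W1 ωM L ↔ legendreDefect ωM L c p₀ ((hamModel ωM L).natChart c w₀ w) = 0 := by
  have key : ∀ μ A, velPart (hamDiff c p₀ w) (jetUnit μ A) = 0 ↔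
      legendreDefect ωM L c p₀ ((hamModel ωM L).natChart c w₀ w) (finProdFinEquiv (A, μ)) = 0 := by
    intro μ A
    have h : velPart (hamDiff c p₀ w) (jetUnit μ A) =
        fderiv ℝ (lagDensity ωM L c p₀) (velOfHam ((hamModel ωM L).natChart c w₀ w))
          (0, (jetUnit μ A, 0)) - pairing (jetUnit μ A) ((hamModel ωM L).natChart c w₀ w).2.2.1 := by
      refine (fderiv_hamDensity hω.1 hL c p₀ (natChart_fst_mem c w₀ hw)
        (0, (jetUnit μ A, 0))).trans ?_
      have h0 := (pairingLin d n ((hamModel ωM L).natChart c w₀ w).2.1).map_zero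
      refine congrArg (_ - ·) ?_
      exact (congrArg (· + _) h0).trans (zero_add _)
    rw [h]
    have h1 : legendreDefect ωM L c p₀ ((hamModel ωM L).natChart c w₀ w)
        (finProdFinEquiv (A, μ)) =
        (fderiv ℝ (lagDensity ωM L c p₀) (velOfHam ((hamModel ωM L).natChart c w₀ w))
          (0, (jetUnit μ A, 0)) - pairing (jetUnit μ A)
            ((hamModel ωM L).natChart c w₀ w).2.2.1) (frame d) := by
      change fderiv ℝ (lagDensity ωM L c p₀) _ (0, (jetUnit _ _, 0)) (frame d) -
        pairing (jetUnit _ _) _ (frame d) = _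
      rw [Equiv.symm_apply_apply]
      rfl
    rw [h1]
    exact ⟨fun h => by rw [h]; rfl, fun h => top_ext h⟩
  rw [mem_W1_iff hω hL c p₀ hw, jet_hom_eq_zero_iff]
  constructor
  · intro h
    funext i
    have := (key (finProdFinEquiv.symm i).2 (finProdFinEquiv.symm i).1).1 (h _ _)
    rwa [Prod.mk.eta, Equiv.apply_symm_apply] at this
  · intro h μ A
    exact (key μ A).2 (congrFun h _)

/-- The momenta enter the defect through the surjective linear map `momentum`. Varying them alone
makes the differential surjective, and choosing them suitably makes a lift of any `v` tangent to
$\mathcal W_1$. -/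
theorem isTransversalSubmanifold_W1 (hω : IsVolumeForm ωM)
    (hL : ContMDiff 𝓘(ℝ, VelMdl d n) 𝓘(ℝ, ℝ) ∞ L) :
    IsTransversalSubmanifold (d := d) (V := HamMdl d n) (projM ωM L) (W1 ωM L)
      (n * (d + 1)) := by
  intro w _
  obtain ⟨c, hw, -⟩ := (hamModel ωM L).exists_chartAt_eq w
  set e := (hamModel ωM L).natChart c w with he
  have hmem : e ∈ IsManifold.maximalAtlas 𝓘(ℝ, HamMdl d n) ∞ (HamSpace ωM L) :=
    (hamModel ωM L).natChart_mem c w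
  set F := legendreDefect ωM L c (prVel ωM L w) with hF
  have hsm : ContDiffOn ℝ ∞ F e.target := contDiffOn_legendreDefect hω.1 hL c _
  have hder : ∀ z ∈ e.source, ∀ u : TangentSpace 𝓘(ℝ, HamMdl d n) z,
      mfderiv 𝓘(ℝ, HamMdl d n) 𝓘(ℝ, Fin (n * (d + 1)) → ℝ) (fun z => F (e z)) z u =
        fderiv ℝ (velMomentum ωM L c (prVel ωM L w)) (velOfHam (e z)) (velOfHam (dchart e z u)) -
          momentum d n (dchart e z u).2.2.1 := by
    intro z hz u
    have h1 : DifferentiableAt ℝ F (e z) := (hsm.contDiffAt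
      (e.open_target.mem_nhds (e.map_source hz))).differentiableAt (by simp)
    have h2 : mfderiv 𝓘(ℝ, HamMdl d n) 𝓘(ℝ, Fin (n * (d + 1)) → ℝ) (F ∘ e) z u =
        fderiv ℝ F (e z) (dchart e z u) := by
      rw [mfderiv_comp z h1.mdifferentiableAt (mdifferentiableAt_chart hmem hz), mfderiv_eq_fderiv]
      rfl
    exact h2.trans (fderiv_legendreDefect hω.1 hL c _ (natChart_fst_mem c w hz) _)
  refine ⟨e.source, fun z => F (e z), e.open_source, hw, ?_, ?_, ?_⟩
  · exact hsm.contMDiffOn.comp (contMDiffOn_of_mem_maximalAtlas hmem) fun z hz => e.map_source hz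
  · ext z
    exact ⟨fun h => ⟨h.2, (mem_W1_iff_legendreDefect hω hL c _ w h.2).1 h.1⟩,
      fun h => ⟨(mem_W1_iff_legendreDefect hω hL c _ w h.1).2 h.2, h.1⟩⟩
  · rintro z ⟨-, hz⟩
    constructor
    · intro p
      -- The momenta occur with a minus sign in the defect, hence `-p`.
      obtain ⟨P, hP⟩ := momentum_surjective (d := d) (n := n) (-p)
      obtain ⟨u, hu, -⟩ := (hamModel ωM L).exists_mfderiv_base_eq c w (w := z) hz 0 0 (0, (P, 0))
      refine ⟨u, ?_⟩
      rw [hder z hz, hu, map_zero]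
      have h0 : velOfHam ((((0 : Base d), (0 : Fin n → ℝ)), (0, (P, 0))) : HamMdl d n) = 0 := rfl
      rw [h0, map_zero, zero_sub]
      exact neg_eq_iff_eq_neg.2 hP
    · intro v
      -- `P` cancels the variation of $\partial L/\partial y^A_\mu$ along the horizontal
      -- displacement `v`.
      obtain ⟨P, hP⟩ := momentum_surjective (d := d) (n := n)
        (fderiv ℝ (velMomentum ωM L c (prVel ωM L w)) (velOfHam (e z))
          ((dchart c.φ (π z.1) v, 0), 0))
      obtain ⟨u, hu, hu'⟩ := (hamModel ωM L).exists_mfderiv_base_eq c w (w := z) hz v 0 (0, (P, 0))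
      refine ⟨u, ?_, hu'⟩
      rw [hder z hz, hu]
      exact sub_eq_zero.2 hP.symm

end LegendreEquations

/-! ### The special premulticontact structure and the dissipation form -/

section Special

set_option maxSynthPendingDepth 6

variable {d n : ℕ}
  {M : Type*} [TopologicalSpace M] [ChartedSpace (Base d) M]
  {E : Type*} [TopologicalSpace E] [ChartedSpace (Mdl d n) E] {π : E → M}
  [IsManifold 𝓘(ℝ, Base d) ∞ M] [IsManifold 𝓘(ℝ, Mdl d n) ∞ E]
  [hπ : Fact (Manifold.IsSubmersion 𝓘(ℝ, Mdl d n) 𝓘(ℝ, Base d) ∞ π)]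
  {ωM : Form (Base d) M (d + 1)} {L : VelSpace d n π → ℝ}

theorem isSmooth_thetaHam (hω : IsVolumeForm ωM)
    (hL : ContMDiff 𝓘(ℝ, VelMdl d n) 𝓘(ℝ, ℝ) ∞ L) : IsSmooth (thetaHam ωM L) := by
  refine isSmooth_of_localExpr fun w => ?_
  obtain ⟨c, -, h⟩ := (hamModel ωM L).exists_chartAt_eq w
  rw [h]
  exact ⟨_, isLocalExpr_thetaHam hω.1 hL c (prVel ωM L w) w,
    contDiffOn_thetaHamLoc hω.1 hL c (prVel ωM L w)⟩

theorem le_finrank_hamMdl : 2 * (d + 1) + n * (d + 1) ≤ Module.finrank ℝ (HamMdl d n) := by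
  rw [Module.finrank_prod, Module.finrank_prod, Module.finrank_prod, Module.finrank_prod,
    finrank_jetMdl, finrank_actMdl, Module.finrank_fin_fun]
  omega

theorem finrank_reebSpace (hω : IsVolumeForm ωM) (hL : ContMDiff 𝓘(ℝ, VelMdl d n) 𝓘(ℝ, ℝ) ∞ L)
    (w : HamSpace ωM L) :
    Module.finrank ℝ (reebSpace (thetaHam ωM L) (omegaHam ωM L) w) = d + 1 + n * (d + 1) := by
  obtain ⟨c, hw, -⟩ := (hamModel ωM L).exists_chartAt_eq w
  exact (isHamModel hω hL c (prVel ωM L w) hw).finrank_reeb _ fun _ => Iff.rfl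

theorem finrank_charSpace_iff (hω : IsVolumeForm ωM)
    (hL : ContMDiff 𝓘(ℝ, VelMdl d n) 𝓘(ℝ, ℝ) ∞ L) (w : HamSpace ωM L) :
    Module.finrank ℝ (charSpace (thetaHam ωM L) (omegaHam ωM L) w) = n * (d + 1) ↔
      w ∈ W1 ωM L := by
  obtain ⟨c, hw, -⟩ := (hamModel ωM L).exists_chartAt_eq w
  rw [mem_W1_iff hω hL c (prVel ωM L w) hw]
  exact (isHamModel hω hL c (prVel ωM L w) hw).finrank_char

theorem exists_finrank_formKer_thetaHam (hω : IsVolumeForm ωM)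
    (hL : ContMDiff 𝓘(ℝ, VelMdl d n) 𝓘(ℝ, ℝ) ∞ L) :
    ∃ r : ℕ, ∀ w, Module.finrank ℝ (formKer (thetaHam ωM L w)) = r := by
  rcases isEmpty_or_nonempty (HamSpace ωM L) with h | ⟨⟨w₀⟩⟩
  · exact ⟨0, fun w => h.elim w⟩
  · obtain ⟨c₀, h₀, -⟩ := (hamModel ωM L).exists_chartAt_eq w₀
    refine ⟨Module.finrank ℝ (formKer (thetaHam ωM L w₀)), fun w => ?_⟩
    obtain ⟨c, hw, -⟩ := (hamModel ωM L).exists_chartAt_eq w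
    exact finrank_formKer_theta (isHamModel hω hL c (prVel ωM L w) hw).theta
      (isHamModel hω hL c₀ (prVel ωM L w₀) h₀).theta

/-- All conditions except the rank of the characteristic distribution hold at every point of
$\mathcal W_\circ$; only `rank_char` uses `hS`. -/
theorem isSpecialPremulticontactBundleOn (hω : IsVolumeForm ωM)
    (hL : ContMDiff 𝓘(ℝ, VelMdl d n) 𝓘(ℝ, ℝ) ∞ L) {S : Set (HamSpace ωM L)}
    (hS : S ⊆ W1 ωM L) : IsSpecialPremulticontactBundleOn (projM ωM L) ωM
      (thetaHam ωM L) (n * (d + 1)) S where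
  volume := hω
  smooth_proj := (hamModel ωM L).contMDiff_base
  submersion w v := by
    obtain ⟨c, hw, -⟩ := (hamModel ωM L).exists_chartAt_eq w
    obtain ⟨u, -, hu⟩ := (hamModel ωM L).exists_mfderiv_base_eq c w hw v 0 0
    exact ⟨u, hu⟩
  special :=
    { smooth_form := isSmooth_thetaHam hω hL
      smooth_omega := (hamModel ωM L).isSmooth_baseForm hω.1
      closed := (hamModel ωM L).extD_baseForm hω.1
      rank_le := le_finrank_hamMdl
      rank_form := by
        obtain ⟨r, hr⟩ := exists_finrank_formKer_thetaHam hω hL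
        exact ⟨r, fun w _ => hr w⟩
      rank_ker := by
        intro w _
        obtain ⟨c, hw, -⟩ := (hamModel ωM L).exists_chartAt_eq w
        have : FiniteDimensional ℝ (TangentSpace 𝓘(ℝ, HamMdl d n) w) :=
          inferInstanceAs (FiniteDimensional ℝ (HamMdl d n))
        exact (isHamModel hω hL c (prVel ωM L w) hw).finrank_ker_omega
      rank_reeb := fun w _ => finrank_reebSpace hω hL w
      rank_char := fun w hw => (finrank_charSpace_iff hω hL w).2 (hS hw)
      ann_eq := by
        intro w _
        obtain ⟨c, hw, -⟩ := (hamModel ωM L).exists_chartAt_eq w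
        exact (isHamModel hω hL c (prVel ωM L w) hw).annForms_eq }

/-- The Reeb space has dimension $m+nm$ at every point, which forces $k=nm$ as soon as `S` has a
point. The characteristic rank then places that point in $\mathcal W_1$. -/
theorem subset_W1_of_isSpecial (hω : IsVolumeForm ωM)
    (hL : ContMDiff 𝓘(ℝ, VelMdl d n) 𝓘(ℝ, ℝ) ∞ L) {S : Set (HamSpace ωM L)} {k : ℕ}
    (h : IsSpecialPremulticontactBundleOn (projM ωM L) ωM (thetaHam ωM L) k S) :
    S ⊆ W1 ωM L := by
  intro w hw
  rw [← finrank_charSpace_iff hω hL]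
  have h1 := h.special.rank_reeb w hw
  have h2 := finrank_reebSpace hω hL w
  have h3 : d + 1 + k = d + 1 + n * (d + 1) := h1.symm.trans h2
  exact (h.special.rank_char w hw).trans (by omega)

theorem isDissipationAt_iff (hω : IsVolumeForm ωM)
    (hL : ContMDiff 𝓘(ℝ, VelMdl d n) 𝓘(ℝ, ℝ) ∞ L) (c : AdaptedChart d n π)
    (p₀ : VelSpace d n π) {w : HamSpace ωM L} (hw : w.1 ∈ c.ψ.source) (h : w ∈ W1 ωM L)
    (σ : TangentSpace 𝓘(ℝ, HamMdl d n) w →L[ℝ] ℝ) :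
    IsDissipationAt (thetaHam ωM L) (omegaHam ωM L) w σ ↔ ∀ u, σ u =
      -fderiv ℝ (lagDensity ωM L c p₀) (velOfHam ((hamModel ωM L).natChart c w w))
        (0, (0, interior (dchart ((hamModel ωM L).natChart c w) w u).1.1 (stdVol d))) (frame d) := by
  have h1 := (isHamModel hω hL c p₀ hw).isDissipation_iff
    ((mem_W1_iff hω hL c p₀ hw).1 h) σ
  refine h1.trans (forall_congr' fun u => ?_)
  have h2 : actPart (hamDiff c p₀ w) (interior (hamTangent c hw u).1.1 (stdVol d)) =
      fderiv ℝ (lagDensity ωM L c p₀) (velOfHam ((hamModel ωM L).natChart c w w))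
        (0, (0, interior (hamTangent c hw u).1.1 (stdVol d))) := by
    refine (fderiv_hamDensity hω.1 hL c p₀ (natChart_fst_mem c w hw)
      (0, (0, (0, interior (hamTangent c hw u).1.1 (stdVol d))))).trans ?_
    -- The direction $\partial/\partial s^\mu$ has neither jet nor momentum component, so both terms
    -- of the product rule for $p^\mu_Ay^A_\mu$ vanish.
    have e1 := (pairingLin d n ((hamModel ωM L).natChart c w w).2.1).map_zero
    have e2 := (pairingLin d n).map_zero₂ ((hamModel ωM L).natChart c w w).2.2.1
    have e3 : pairing ((hamModel ωM L).natChart c w w).2.1 0 + pairing 0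
        ((hamModel ωM L).natChart c w w).2.2.1 = 0 :=
      (congrArg₂ (· + ·) e1 e2).trans (add_zero 0)
    exact (congrArg (_ - ·) e3).trans (sub_zero _)
  rw [h2]
  rfl

/-- `isDissipationAt_iff` prescribes all values of $\sigma$, whence uniqueness; for existence the
prescription is linear in the vector. Any adapted chart at `w` serves, so no natural chart is
required. -/
theorem existsUnique_dissipation (hω : IsVolumeForm ωM)
    (hL : ContMDiff 𝓘(ℝ, VelMdl d n) 𝓘(ℝ, ℝ) ∞ L) {w : HamSpace ωM L} (h : w ∈ W1 ωM L) :
    ∃! σ, IsDissipationAt (thetaHam ωM L) (omegaHam ωM L) w σ := by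
  obtain ⟨c, hw, -⟩ := (hamModel ωM L).exists_chartAt_eq w
  have hiff := isDissipationAt_iff hω hL c (prVel ωM L w) hw h
  let D := fderiv ℝ (lagDensity ωM L c (prVel ωM L w))
    (velOfHam ((hamModel ωM L).natChart c w w))
  let τ : Base d →ₗ[ℝ] ℝ :=
    { toFun := fun v => -D (0, (0, interiorEquiv d v)) (frame d)
      map_add' := fun v v' => by
        have e : ((0, (0, interiorEquiv d (v + v'))) : VelMdl d n) =
            (0, (0, interiorEquiv d v)) + (0, (0, interiorEquiv d v')) := by
          rw [map_add]
          simp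
        rw [e, map_add, ContinuousAlternatingMap.add_apply, neg_add]
      map_smul' := fun r v => by
        have e : ((0, (0, interiorEquiv d (r • v))) : VelMdl d n) =
            r • (0, (0, interiorEquiv d v)) := by
          rw [map_smul]
          simp
        rw [e, map_smul, ContinuousAlternatingMap.smul_apply, RingHom.id_apply, smul_neg] }
  -- The prescribed values depend only on the image in $TM$: `σ` is `τ` composed with the chart of
  -- the base and the tangent map of $\rho_M$.
  let σ : TangentSpace 𝓘(ℝ, HamMdl d n) w →L[ℝ] ℝ := (LinearMap.toContinuousLinearMap τ).comp
    ((dchart c.φ (π w.1)).comp (mfderiv 𝓘(ℝ, HamMdl d n) 𝓘(ℝ, Base d)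
      (fun w' : HamSpace ωM L => π w'.1) w))
  refine ⟨σ, (hiff σ).2 fun u => ?_, fun σ' hσ' => ContinuousLinearMap.ext fun u => ?_⟩
  · exact congrArg τ ((hamModel ωM L).dchart_base c w hw u)
  · refine ((hiff σ').1 hσ' u).trans ?_
    exact congrArg τ ((hamModel ωM L).dchart_base c w hw u).symm

theorem IsNatural.inChart_eq {c : AdaptedChart d n π} (hc : IsNatural ωM c) {v : Base d}
    (hv : v ∈ c.φ.target) : inChart c.φ ωM v = stdVol d :=
  IsLocalExpr.inChart_eq (loc := fun _ => stdVol d) c.φ_mem (fun x hx => hc x hx) hv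

theorem chartFun_prVel (c : AdaptedChart d n π) (w₀ : HamSpace ωM L) {w : HamSpace ωM L}
    (hw : w.1 ∈ c.ψ.source) : (velModel d n π).chartFun c (prVel ωM L w) =
      velOfHam ((hamModel ωM L).natChart c w₀ w) := by
  rw [(hamModel ωM L).natChart_apply c w₀ hw]
  exact (velModel d n π).chartFun_apply c hw _

/-- In a natural chart the density is $L\,d^mx$ with $d^mx$ constant and equal to $1$ on the frame,
so its coefficient has the derivatives of $L$. -/
theorem fderiv_lagDensity_of_isNatural (hL : ContMDiff 𝓘(ℝ, VelMdl d n) 𝓘(ℝ, ℝ) ∞ L)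
    {c : AdaptedChart d n π} (hc : IsNatural ωM c) {w : HamSpace ωM L} (hw : w.1 ∈ c.ψ.source)
    (v : VelMdl d n) :
    fderiv ℝ (lagDensity ωM L c (prVel ωM L w)) (velOfHam ((hamModel ωM L).natChart c w w)) v
      (frame d) = partialL L c (prVel ωM L w) v := by
  rw [← chartFun_prVel c w hw]
  have hq : (velModel d n π).chartFun c (prVel ωM L w) ∈
      ((velModel d n π).natChart c (prVel ωM L w)).target :=
    ((velModel d n π).natChart c (prVel ωM L w)).map_source hw
  have hopen := ((velModel d n π).natChart c (prVel ωM L w)).open_target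
  have h1 : lagDensity ωM L c (prVel ωM L w)
      =ᶠ[𝓝 ((velModel d n π).chartFun c (prVel ωM L w))]
      fun q => L ((velModel d n π).chartInv c (prVel ωM L w) q) • stdVol d := by
    filter_upwards [hopen.mem_nhds hq] with q hq
    rw [lagDensity, hc.inChart_eq (c.fst_mem_target hq.1)]
  have h2 : ContDiffOn ℝ ∞ (fun q => L ((velModel d n π).chartInv c (prVel ωM L w) q))
      ((velModel d n π).natChart c (prVel ωM L w)).target :=
    contMDiffOn_iff_contDiffOn.1 (hL.comp_contMDiffOn (contMDiffOn_symm_of_mem_maximalAtlas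
      ((velModel d n π).natChart_mem c (prVel ωM L w))))
  have h3 := ((h2.contDiffAt (hopen.mem_nhds hq)).differentiableAt (by simp)).hasFDerivAt.smul_const
    (stdVol d)
  rw [h1.fderiv_eq, h3.fderiv]
  change partialL L c (prVel ωM L w) v * stdVol d (frame d) = _
  rw [stdVol_frame, mul_one]

theorem mem_W1_iff_momCoord (hω : IsVolumeForm ωM)
    (hL : ContMDiff 𝓘(ℝ, VelMdl d n) 𝓘(ℝ, ℝ) ∞ L) {c : AdaptedChart d n π}
    (hc : IsNatural ωM c) (w : HamSpace ωM L) (hw : w.1 ∈ c.ψ.source) :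
    w ∈ W1 ωM L ↔ ∀ (μ : Fin (d + 1)) (A : Fin n),
      momCoord c hw w.2.1.2.1 μ A = partialVel L c (prVel ωM L w) μ A := by
  have h1 : ∀ μ A, momCoord c hw w.2.1.2.1 μ A =
      momentum d n ((hamModel ωM L).natChart c w w).2.2.1 (finProdFinEquiv (A, μ)) := by
    intro μ A
    rw [(hamModel ωM L).natChart_apply c w hw]
    change _ = pairing (jetUnit _ _) _ (frame d)
    rw [Equiv.symm_apply_apply, pairing_jetUnit]
    rfl
  have h2 : ∀ μ A, partialVel L c (prVel ωM L w) μ A = velMomentum ωM L c (prVel ωM L w)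
      (velOfHam ((hamModel ωM L).natChart c w w)) (finProdFinEquiv (A, μ)) := by
    intro μ A
    rw [velMomentum, fderiv_lagDensity_of_isNatural hL hc hw, Equiv.symm_apply_apply]
    rfl
  rw [mem_W1_iff_legendreDefect hω hL c (prVel ωM L w) w hw, legendreDefect, sub_eq_zero]
  simp only [h1, h2]
  constructor
  · intro h μ A
    exact (congrFun h _).symm
  · intro h
    funext i
    have := h (finProdFinEquiv.symm i).2 (finProdFinEquiv.symm i).1
    rw [Prod.mk.eta, Equiv.apply_symm_apply] at this
    exact this.symm

theorem dx_apply (c : AdaptedChart d n π) {w : HamSpace ωM L} (hw : w.1 ∈ c.ψ.source)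
    (μ : Fin (d + 1)) (u : TangentSpace 𝓘(ℝ, HamMdl d n) w) :
    dx ωM L c w μ u = (dchart ((hamModel ωM L).natChart c w) w u).1.1 μ := by
  have h1 : MDifferentiableAt 𝓘(ℝ, Base d) 𝓘(ℝ, Base d) c.φ (π w.1) :=
    mdifferentiableAt_chart c.φ_mem (c.mapsTo w.1 hw)
  have h2 : MDifferentiableAt 𝓘(ℝ, HamMdl d n) 𝓘(ℝ, Base d)
      (fun w' : HamSpace ωM L => π w'.1) w :=
    ((hamModel ωM L).contMDiff_base w).mdifferentiableAt (by simp)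
  have h3 : HasFDerivAt (fun x : Base d => x μ)
      (ContinuousLinearMap.proj (R := ℝ) (φ := fun _ : Fin (d + 1) => ℝ) μ) (c.φ (π w.1)) :=
    (ContinuousLinearMap.proj (R := ℝ) (φ := fun _ : Fin (d + 1) => ℝ) μ).hasFDerivAt
  have h4 := (h3.hasMFDerivAt.comp (π w.1) h1.hasMFDerivAt).comp w h2.hasMFDerivAt
  rw [← (hamModel ωM L).dchart_base c w hw]
  exact congrArg (fun l => l u) h4.mfderiv

theorem isDissipationAt_of_isNatural (hω : IsVolumeForm ωM)
    (hL : ContMDiff 𝓘(ℝ, VelMdl d n) 𝓘(ℝ, ℝ) ∞ L) {c : AdaptedChart d n π}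
    (hc : IsNatural ωM c) {w : HamSpace ωM L} (hw : w.1 ∈ c.ψ.source) (h : w ∈ W1 ωM L) :
    IsDissipationAt (thetaHam ωM L) (omegaHam ωM L) w
      (-∑ μ : Fin (d + 1), partialAct L c (prVel ωM L w) μ • dx ωM L c w μ) := by
  rw [isDissipationAt_iff hω hL c (prVel ωM L w) hw h]
  intro u
  rw [fderiv_lagDensity_of_isNatural hL hc hw, _root_.neg_apply,
    _root_.sum_apply]
  congr 1
  -- The map $v\mapsto\partial L(i_vd^mx)$ is linear, and its value at $\partial/\partial x^\mu$ is
  -- $\partial L/\partial s^\mu$. Expanding the base component of `u` in the standard basis produces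
  -- the sum.
  let τ : Base d →ₗ[ℝ] ℝ := (fderiv ℝ (fun q => L ((velModel d n π).chartInv c (prVel ωM L w) q))
    ((velModel d n π).chartFun c (prVel ωM L w))).toLinearMap ∘ₗ
      LinearMap.inr ℝ (Mdl d n) (JetMdl d n × ActMdl d) ∘ₗ
        LinearMap.inr ℝ (JetMdl d n) (ActMdl d) ∘ₗ (interiorEquiv d).toLinearMap
  have hτ := LinearMap.pi_apply_eq_sum_univ τ (dchart ((hamModel ωM L).natChart c w) w u).1.1
  refine Eq.trans ?_ hτ.symm
  refine Finset.sum_congr rfl fun μ _ => ?_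
  rw [_root_.smul_apply, dx_apply c hw, smul_eq_mul, smul_eq_mul, mul_comm]
  have hs : (fun j => if μ = j then (1 : ℝ) else 0) = Pi.single μ 1 := by
    funext j
    simp [Pi.single_apply, eq_comm]
  rw [hs]
  rfl

end Special

end Multicontact

end

/-! ### The proposition -/

theorem mainTheorem4 {d n : ℕ}
    {M : Type*} [TopologicalSpace M] [ChartedSpace (Multicontact.Base d) M]
    [IsManifold 𝓘(ℝ, Multicontact.Base d) ∞ M]
    {E : Type*} [TopologicalSpace E] [ChartedSpace (Multicontact.Mdl d n) E]
    [IsManifold 𝓘(ℝ, Multicontact.Mdl d n) ∞ E]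
    (π : E → M)
    [Fact (Manifold.IsSubmersion 𝓘(ℝ, Multicontact.Mdl d n) 𝓘(ℝ, Multicontact.Base d) ∞ π)]
    (ωM : Multicontact.Form (Multicontact.Base d) M (d + 1))
    (hω : Multicontact.IsVolumeForm ωM)
    (L : Multicontact.VelSpace d n π → ℝ)
    (hL : ContMDiff 𝓘(ℝ, Multicontact.VelMdl d n) 𝓘(ℝ, ℝ) ∞ L) :
    Multicontact.IsTransversalSubmanifold (d := d) (V := Multicontact.HamMdl d n)
      (Multicontact.projM ωM L) (Multicontact.W1 ωM L) (n * (d + 1)) ∧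
    (∀ c : Multicontact.AdaptedChart d n π, Multicontact.IsNatural ωM c →
      ∀ (w : Multicontact.HamSpace ωM L) (hw : w.1 ∈ c.ψ.source),
        w ∈ Multicontact.W1 ωM L ↔
          ∀ (μ : Fin (d + 1)) (A : Fin n), Multicontact.momCoord c hw w.2.1.2.1 μ A =
            Multicontact.partialVel L c (Multicontact.prVel ωM L w) μ A) ∧
    Multicontact.IsSpecialPremulticontactBundleOn (Multicontact.projM ωM L) ωM
      (Multicontact.thetaHam ωM L) (n * (d + 1)) (Multicontact.W1 ωM L) ∧
    (∀ S : Set (Multicontact.HamSpace ωM L),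
      (∃ k : ℕ, Multicontact.IsSpecialPremulticontactBundleOn (Multicontact.projM ωM L) ωM
        (Multicontact.thetaHam ωM L) k S) ↔ S ⊆ Multicontact.W1 ωM L) ∧
    (∀ w ∈ Multicontact.W1 ωM L,
      (∃! σ, Multicontact.IsDissipationAt (Multicontact.thetaHam ωM L)
        (Multicontact.omegaHam ωM L) w σ) ∧
      ∀ c : Multicontact.AdaptedChart d n π, Multicontact.IsNatural ωM c → w.1 ∈ c.ψ.source →
        Multicontact.IsDissipationAt (Multicontact.thetaHam ωM L)
          (Multicontact.omegaHam ωM L) w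
          (-∑ μ : Fin (d + 1), Multicontact.partialAct L c (Multicontact.prVel ωM L w) μ •
            Multicontact.dx ωM L c w μ)) :=
  ⟨Multicontact.isTransversalSubmanifold_W1 hω hL,
    fun _ hc w hw => Multicontact.mem_W1_iff_momCoord hω hL hc w hw,
    Multicontact.isSpecialPremulticontactBundleOn hω hL subset_rfl,
    fun _ => ⟨fun ⟨_, h⟩ => Multicontact.subset_W1_of_isSpecial hω hL h,
      fun h => ⟨_, Multicontact.isSpecialPremulticontactBundleOn hω hL h⟩⟩,
    fun _ h => ⟨Multicontact.existsUnique_dissipation hω hL h,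
      fun _ hc hw => Multicontact.isDissipationAt_of_isNatural hω hL hc hw h⟩⟩
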